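/- Let $\mathcal C=\{1,\dots,m\}$ be a set of candidates with weights $s_i\ge 0$, and for a committee $S\subseteq\mathcal C$ let $w(S)=\sum_{i\in S}s_i$. Each of $n$ voters $v$ has a complete and transitive weak preference $\succeq_v$ over all committees that is monotone: $S_1\subseteq S_2$ implies $S_2\succeq_v S_1$. Write $V(S,S')=|\{v : S'\succ_v S\}|$. For $c\ge 1$, $K>0$ and an integer $L\ge 1$, a committee $S$ with $w(S)\le K$ is $(c,L)$-approximately stable if there is no committee $S'$ with at most $L$ candidates such that $V(S,S')>0$ and $V(S,S')\ge c\cdot\frac{w(S')}{K}\cdot n$. There are a single deterministic algorithm and a polynomial $p$ such that the following holds for all $m,n$, all integers $L\ge 1$, all real $K\ge L$ and $\varepsilon>0$, all nonnegative real weights $s_1,\dots,s_m$ and all preferences as above: given $m,n,L,K,\varepsilon,s_1,\dots,s_m$, and given access to the preferences through queries "does $S\succeq_v T$ hold?" for a voter $v$ and committees $S,T$, the algorithm outputs a $(32+\varepsilon,L)$-approximately stable committee after at most $p\left(m^L,n,\frac1\varepsilon\right)$ steps. Here the algorithm is a program for a real RAM: it has memory for natural numbers (with addition, truncated subtraction,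 comparison and indirect addressing) and for real numbers (with $+,-,\times,/$ and comparison, but no rounding to integers), natural numbers can be converted to reals, the only constants in the program are natural numbers, each operation costs one step, and each query costs $2m+1$ steps. -/

import Mathlib

namespace CommitteeSelection

/-- Preferences of the voters `Fin n` over committees, i.e. sets of candidates from `Fin m`.
`weak v S T` means that voter `v` weakly prefers `S` to `T`. -/
structure MonotonePreferences (m n : ℕ) where
  weak : Fin n → Finset (Fin m) → Finset (Fin m) → Prop
  complete : ∀ v S T, weak v S T ∨ weak v T S
  transitive : ∀ v S T U, weak v S T → weak v T U → weak v S U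
  monotone : ∀ v S T, S ⊆ T → weak v T S

/-- Voter `v` strictly prefers `S` to `T`. -/
def MonotonePreferences.strict {m n : ℕ} (P : MonotonePreferences m n) (v : Fin n)
    (S T : Finset (Fin m)) : Prop :=
  P.weak v S T ∧ ¬ P.weak v T S

open Classical in
/-- The pairwise score `V(S, S')`: the number of voters who strictly prefer `S'` to `S`. -/
noncomputable def MonotonePreferences.score {m n : ℕ} (P : MonotonePreferences m n)
    (S S' : Finset (Fin m)) : ℕ :=
  (Finset.univ.filter fun v : Fin n => P.strict v S' S).card

/-- The weight `w(S)` of a committee when candidate `i` has weight `s i`. -/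
def committeeWeight {m : ℕ} (s : Fin m → ℝ) (S : Finset (Fin m)) : ℝ := ∑ i ∈ S, s i

/-- `S'` `c`-blocks `S`: the coalition of all voters who strictly prefer `S'` to `S` is nonempty
and has at least `c * (w(S') / K) * n` members. -/
def Blocks {m n : ℕ} (P : MonotonePreferences m n) (s : Fin m → ℝ) (K c : ℝ)
    (S S' : Finset (Fin m)) : Prop :=
  0 < P.score S S' ∧ c * (committeeWeight s S' / K) * n ≤ P.score S S'

/-- `S` has weight at most `K`, and no committee with at most `L` candidates `c`-blocks it. -/
def IsApproxStable {m n : ℕ} (P : MonotonePreferences m n) (s : Fin m → ℝ) (K c : ℝ) (L : ℕ)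
    (S : Finset (Fin m)) : Prop :=
  committeeWeight s S ≤ K ∧ ∀ S' : Finset (Fin m), S'.card ≤ L → ¬ Blocks P s K c S S'

end CommitteeSelection

/-! A real RAM with a comparison oracle. The memory consists of arrays of natural numbers and
arrays of real numbers; a program names finitely many of them, and a scalar variable is the cell
`0` of an array. Natural numbers serve for counting and addressing and have addition, truncated
subtraction and comparison; real numbers have the four field operations and comparison (division
by zero gives zero). There is no rounding from reals to naturals, and the only constants are
natural numbers. Every operation, memory access, test and assignment costs one step. -/

namespace RealRAM

open CommitteeSelection

structure State where
  nats : ℕ → ℕ → ℕ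
  reals : ℕ → ℕ → ℝ

/-- Expressions with values in the natural numbers; `get A e` is the cell `e` of the array `A`. -/
inductive NExp where
  | const (k : ℕ)
  | get (A : ℕ) (e : NExp)
  | add (e f : NExp)
  | sub (e f : NExp)

/-- Expressions with values in the real numbers. -/
inductive RExp where
  | ofNat (e : NExp)
  | get (A : ℕ) (e : NExp)
  | add (e f : RExp)
  | sub (e f : RExp)
  | mul (e f : RExp)
  | div (e f : RExp)

def NExp.eval (σ : State) : NExp → ℕ
  | .const k => k
  | .get A e => σ.nats A (e.eval σ)
  | .add e f => e.eval σ + f.eval σ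
  | .sub e f => e.eval σ - f.eval σ

def NExp.cost : NExp → ℕ
  | .const _ => 1
  | .get _ e => e.cost + 1
  | .add e f => e.cost + f.cost + 1
  | .sub e f => e.cost + f.cost + 1

noncomputable def RExp.eval (σ : State) : RExp → ℝ
  | .ofNat e => (e.eval σ : ℝ)
  | .get A e => σ.reals A (e.eval σ)
  | .add e f => e.eval σ + f.eval σ
  | .sub e f => e.eval σ - f.eval σ
  | .mul e f => e.eval σ * f.eval σ
  | .div e f => e.eval σ / f.eval σ

def RExp.cost : RExp → ℕ
  | .ofNat e => e.cost + 1
  | .get _ e => e.cost + 1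
  | .add e f => e.cost + f.cost + 1
  | .sub e f => e.cost + f.cost + 1
  | .mul e f => e.cost + f.cost + 1
  | .div e f => e.cost + f.cost + 1

/-- The committee stored in the cells `a, …, a + m - 1` of the natural-number array `A`:
candidate `i` belongs to it iff cell `a + i` is not zero. -/
def State.committee (σ : State) (m A a : ℕ) : Finset (Fin m) :=
  Finset.univ.filter fun i : Fin m => σ.nats A (a + i) ≠ 0

/-- Tests. `query v A a B b` asks the oracle whether voter `v` weakly prefers the committee stored
in array `A` from cell `a` on to the one stored in array `B` from cell `b` on. -/
inductive Test where
  | nle (e f : NExp)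
  | rle (e f : RExp)
  | neg (b : Test)
  | query (v : NExp) (A : ℕ) (a : NExp) (B : ℕ) (b : NExp)

def Test.Holds {m n : ℕ} (P : MonotonePreferences m n) (σ : State) : Test → Prop
  | .nle e f => e.eval σ ≤ f.eval σ
  | .rle e f => e.eval σ ≤ f.eval σ
  | .neg b => ¬ b.Holds P σ
  | .query v A a B b => ∃ h : v.eval σ < n,
      P.weak ⟨v.eval σ, h⟩ (σ.committee m A (a.eval σ)) (σ.committee m B (b.eval σ))

/-- A query is also charged for the `2 * m` cells that hold the two committees. -/
def Test.cost (m : ℕ) : Test → ℕ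
  | .nle e f => e.cost + f.cost + 1
  | .rle e f => e.cost + f.cost + 1
  | .neg b => b.cost m + 1
  | .query v _ a _ b => v.cost + a.cost + b.cost + 2 * m + 1

/-- Programs; `nset A e f` is the assignment `A[e] := f` of a natural number, `rset A e f` that of
a real number, and `loop b c` is the while loop with condition `b` and body `c`. -/
inductive Program where
  | skip
  | nset (A : ℕ) (e f : NExp)
  | rset (A : ℕ) (e : NExp) (f : RExp)
  | seq (c d : Program)
  | branch (b : Test) (c d : Program)
  | loop (b : Test) (c : Program)

def State.setNat (σ : State) (A i x : ℕ) : State :=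
  { σ with nats := Function.update σ.nats A (Function.update (σ.nats A) i x) }

noncomputable def State.setReal (σ : State) (A i : ℕ) (x : ℝ) : State :=
  { σ with reals := Function.update σ.reals A (Function.update (σ.reals A) i x) }

/-- `Exec P c σ t τ`: with an oracle for the preferences `P`, the program `c` started in state `σ`
halts after `t` steps in state `τ`. -/
inductive Exec {m n : ℕ} (P : MonotonePreferences m n) :
    Program → State → ℕ → State → Prop where
  | skip (σ : State) : Exec P .skip σ 1 σ
  | nset (A : ℕ) (e f : NExp) (σ : State) :
      Exec P (.nset A e f) σ (e.cost + f.cost + 1) (σ.setNat A (e.eval σ) (f.eval σ))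
  | rset (A : ℕ) (e : NExp) (f : RExp) (σ : State) :
      Exec P (.rset A e f) σ (e.cost + f.cost + 1) (σ.setReal A (e.eval σ) (f.eval σ))
  | seq {c d : Program} {σ τ υ : State} {t u : ℕ} :
      Exec P c σ t τ → Exec P d τ u υ → Exec P (.seq c d) σ (t + u) υ
  | branchTrue {b : Test} {c d : Program} {σ τ : State} {t : ℕ} :
      b.Holds P σ → Exec P c σ t τ → Exec P (.branch b c d) σ (b.cost m + t) τ
  | branchFalse {b : Test} {c d : Program} {σ τ : State} {t : ℕ} :
      ¬ b.Holds P σ → Exec P d σ t τ → Exec P (.branch b c d) σ (b.cost m + t) τ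
  | loopTrue {b : Test} {c : Program} {σ τ υ : State} {t u : ℕ} :
      b.Holds P σ → Exec P c σ t τ → Exec P (.loop b c) τ u υ →
        Exec P (.loop b c) σ (b.cost m + t + u) υ
  | loopFalse {b : Test} {c : Program} {σ : State} :
      ¬ b.Holds P σ → Exec P (.loop b c) σ (b.cost m) σ

/-- Executions are deterministic, in their result and in their number of steps. -/
theorem Exec.deterministic {m n : ℕ} {P : MonotonePreferences m n} {c : Program} {σ τ τ' : State}
    {t t' : ℕ} (h : Exec P c σ t τ) (h' : Exec P c σ t' τ') : t = t' ∧ τ = τ' := by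
  induction h generalizing t' τ' with
  | skip => cases h'; exact ⟨rfl, rfl⟩
  | nset => cases h'; exact ⟨rfl, rfl⟩
  | rset => cases h'; exact ⟨rfl, rfl⟩
  | seq _ _ ih₁ ih₂ =>
    cases h' with
    | seq h₁ h₂ =>
      obtain ⟨rfl, rfl⟩ := ih₁ h₁
      obtain ⟨rfl, rfl⟩ := ih₂ h₂
      exact ⟨rfl, rfl⟩
  | branchTrue hb _ ih =>
    cases h' with
    | branchTrue _ h₁ => obtain ⟨rfl, rfl⟩ := ih h₁; exact ⟨rfl, rfl⟩
    | branchFalse hb' _ => exact absurd hb hb'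
  | branchFalse hb _ ih =>
    cases h' with
    | branchTrue hb' _ => exact absurd hb' hb
    | branchFalse _ h₁ => obtain ⟨rfl, rfl⟩ := ih h₁; exact ⟨rfl, rfl⟩
  | loopTrue hb _ _ ih₁ ih₂ =>
    cases h' with
    | loopTrue _ h₁ h₂ =>
      obtain ⟨rfl, rfl⟩ := ih₁ h₁
      obtain ⟨rfl, rfl⟩ := ih₂ h₂
      exact ⟨rfl, rfl⟩
    | loopFalse hb' => exact absurd hb hb'
  | loopFalse hb =>
    cases h' with
    | loopTrue hb' _ _ => exact absurd hb' hb
    | loopFalse _ => exact ⟨rfl, rfl⟩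

/-- The initial state: natural-number arrays `0`, `1`, `2` hold `m`, `n`, `L` in cell `0`; real
array `0` holds the candidate weights in cells `0, …, m - 1`, and real arrays `1`, `2` hold `K`,
`ε` in cell `0`; all other cells are zero. The preferences are accessible only by queries. -/
noncomputable def inputState (m n L : ℕ) (s : Fin m → ℝ) (K ε : ℝ) : State where
  nats := fun A i => if i = 0 then
    (if A = 0 then m else if A = 1 then n else if A = 2 then L else 0) else 0
  reals := fun A i =>
    if A = 0 then (if h : i < m then s ⟨i, h⟩ else 0)
    else if A = 1 then (if i = 0 then K else 0)
    else if A = 2 then (if i = 0 then ε else 0) else 0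

/-- The output of a halted computation: the committee in natural-number array `3`. -/
def State.output (σ : State) (m : ℕ) : Finset (Fin m) := σ.committee m 3 0

end RealRAM

/-! Budget. All light candidates, of weight at most `θK/(m+1)`, go into the output at once. They
cost at most `θK`, and by monotonicity nobody strictly prefers a committee of light candidates to
the output. The remaining budget is `4B₀` with `B₀ = (1-θ)K/4`, and it is spent in stages. The items
are the committees with at most `min L m` candidates. Stage `k` works with `B = B₀/2^k` and a set
`V` of at most `n/4^k` active voters. It adds a set `D` of items of total weight at most `2B` and
retires at least three quarters of `V`, in such a way that for every item of weight `w` above the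
light threshold at most `4(1+η)(w/B)|V|` of the voters retired in this stage prefer that item to
everything in `D`. The stages cost at most `2B₀(1 + 1/2 + ⋯) = 4B₀`. Since `|V|/B` at least halves
from stage to stage, fewer than `8(1+η)(w/B₀)n = (32+ε)(w/K)n` voters object in the end
(`runs_stages`, `StagesInv.isApproxStable`).

Answering a weighting. Let `y ≥ 0` be a weighting of the items of weight at most `B`, and `μ = ∑
yᵢwᵢ`. Choosing item `i` with probability `min(1, yᵢB/μ)`, independently, costs at most `B` in
expectation, and for each voter the expected `y`-weight of the items ranked above all chosen ones is
at most `μ/B` (`sum_mul_prod_truncate_le`). Pipage rounding makes this deterministic: the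
expectation is concave when weight is exchanged between two items, so one end of the exchange is no
worse (`survival_shift_le`), and it has one fractional item fewer. Rounding up the last fractional
item costs at most `B` more. This gives `D` of weight at most `2B` with `∑ yᵢ(beats D i - wᵢ|V|/B) ≤
0` (`RoundingInv.result`).

From weightings to all items. Regret matching chooses `y` as the positive parts of the cumulative
regrets (`sum_sq_posPart_add_le`). After `T ≥ N/κ²` rounds, `N` being the number of items, each item
that is neither light nor heavier than `B` beats the chosen sets, on average over the rounds, for at
most `(w/B + κ)|V|` voters. By averaging, some round is among the worst quarter of the rounds for at
most a quarter of `V` (`exists_round`). Its set is bought and the other voters retire. A retiring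
voter who prefers an item to this set prefers it to the sets of at least a quarter of the rounds
(`card_satisfied_le`), which costs the factor 4.

Time. `Runs` couples total correctness with a bound read off from the program text: if no loop
exceeds `M` rounds, the time is at most `coef * (M + m + 1) ^ depth`. The program is fixed, so a
polynomial `M` suffices (`loopBound_le`). -/

namespace RealRAM
open CommitteeSelection

/-! ### Total correctness with a time bound read off from the program text -/

/-- Cost of a test, up to a factor that bounds the number of candidates. -/
def Test.coef : Test → ℕ
  | .nle e f => e.cost + f.cost + 1
  | .rle e f => e.cost + f.cost + 1
  | .neg b => b.coef + 1
  | .query v _ a _ b => v.cost + a.cost + b.cost + 3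

/-- Loop-nesting depth, plus one. -/
def Program.depth : Program → ℕ
  | .skip => 1
  | .nset _ _ _ => 1
  | .rset _ _ _ => 1
  | .seq c d => max c.depth d.depth
  | .branch _ c d => max c.depth d.depth
  | .loop _ c => c.depth + 1

/-- Coefficient in the time bound `coef * X ^ depth`, where no loop has more than `X` rounds. -/
def Program.coef : Program → ℕ
  | .skip => 1
  | .nset _ e f => e.cost + f.cost + 1
  | .rset _ e f => e.cost + f.cost + 1
  | .seq c d => c.coef + d.coef
  | .branch b c d => b.coef + (c.coef + d.coef)
  | .loop b c => 2 * b.coef + c.coef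

/-- The natural-number arrays that a program assigns to. -/
def Program.nwrites : Program → List ℕ
  | .skip => []
  | .nset A _ _ => [A]
  | .rset _ _ _ => []
  | .seq c d => c.nwrites ++ d.nwrites
  | .branch _ c d => c.nwrites ++ d.nwrites
  | .loop _ c => c.nwrites

/-- The real arrays that a program assigns to. -/
def Program.rwrites : Program → List ℕ
  | .skip => []
  | .nset _ _ _ => []
  | .rset A _ _ => [A]
  | .seq c d => c.rwrites ++ d.rwrites
  | .branch _ c d => c.rwrites ++ d.rwrites
  | .loop _ c => c.rwrites

/-- `σ` and `τ` agree on all arrays that `c` does not assign to. -/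
structure Frame (c : Program) (σ τ : State) : Prop where
  nats : ∀ A, A ∉ c.nwrites → τ.nats A = σ.nats A
  reals : ∀ A, A ∉ c.rwrites → τ.reals A = σ.reals A

theorem Frame.refl (c : Program) (σ : State) : Frame c σ σ :=
  ⟨fun _ _ => rfl, fun _ _ => rfl⟩

theorem Frame.trans {c : Program} {σ τ υ : State} (h : Frame c σ τ) (h' : Frame c τ υ) :
    Frame c σ υ :=
  ⟨fun A hA => (h'.nats A hA).trans (h.nats A hA),
    fun A hA => (h'.reals A hA).trans (h.reals A hA)⟩

theorem Frame.mono {c d : Program} {σ τ : State} (h : Frame c σ τ)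
    (hn : c.nwrites ⊆ d.nwrites) (hr : c.rwrites ⊆ d.rwrites) : Frame d σ τ :=
  ⟨fun A hA => h.nats A fun h' => hA (hn h'), fun A hA => h.reals A fun h' => hA (hr h')⟩

/-- All arrays that `c` assigns to are also assigned to by `d`. -/
def Program.Sub (c d : Program) : Prop := c.nwrites ⊆ d.nwrites ∧ c.rwrites ⊆ d.rwrites

/-- For concrete programs the lists of written arrays are closed terms, so `decide` settles the side
conditions of framing. -/
instance (c d : Program) : Decidable (c.Sub d) := by unfold Program.Sub; infer_instance

theorem Frame.then {c d : Program} {σ τ υ : State} (h : Frame d σ τ) (h' : Frame c τ υ)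
    (hs : c.Sub d) : Frame d σ υ := h.trans (h'.mono hs.1 hs.2)

attribute [simp] NExp.eval RExp.eval Test.Holds State.setNat State.setReal

variable {m n : ℕ} {P : MonotonePreferences m n} {M : ℕ}

theorem Exec.frame {c : Program} {σ τ : State} {t : ℕ} (h : Exec P c σ t τ) : Frame c σ τ := by
  induction h with
  | skip => exact Frame.refl _ _
  | nset A e f σ =>
    refine ⟨fun B hB => ?_, fun _ _ => rfl⟩
    have : B ≠ A := by simpa [Program.nwrites] using hB
    simp [State.setNat, this]
  | rset A e f σ =>
    refine ⟨fun _ _ => rfl, fun B hB => ?_⟩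
    have : B ≠ A := by simpa [Program.rwrites] using hB
    simp [State.setReal, this]
  | seq _ _ ih₁ ih₂ =>
    exact (ih₁.mono (by simp [Program.nwrites]) (by simp [Program.rwrites])).trans
      (ih₂.mono (by simp [Program.nwrites]) (by simp [Program.rwrites]))
  | branchTrue _ _ ih => exact ih.mono (by simp [Program.nwrites]) (by simp [Program.rwrites])
  | branchFalse _ _ ih => exact ih.mono (by simp [Program.nwrites]) (by simp [Program.rwrites])
  | loopTrue _ _ _ ih₁ ih₂ =>
    exact (ih₁.mono (by simp [Program.nwrites]) (by simp [Program.rwrites])).trans ih₂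
  | loopFalse => exact Frame.refl _ _

theorem Test.cost_le (b : Test) (X : ℕ) (hm : m + 1 ≤ X) : b.cost m ≤ b.coef * X := by
  induction b with
  | nle e f => simp only [Test.cost, Test.coef]; nlinarith
  | rle e f => simp only [Test.cost, Test.coef]; nlinarith
  | neg b ih => simp only [Test.cost, Test.coef]; nlinarith
  | query v A a B b =>
    simp only [Test.cost, Test.coef]
    nlinarith [Nat.zero_le (v.cost + a.cost + b.cost)]

theorem Program.depth_pos (c : Program) : 1 ≤ c.depth := by
  induction c <;> simp_all [Program.depth]

/-- Started in `σ`, the program `c` halts in a state satisfying `Q`, in a time that is as if none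
of its loops had more than `M` rounds. -/
def Runs (P : MonotonePreferences m n) (M : ℕ) (c : Program) (σ : State) (Q : State → Prop) :
    Prop :=
  ∃ t τ, Exec P c σ t τ ∧ t ≤ c.coef * (M + m + 1) ^ c.depth ∧ Q τ

/-- The frame condition holds for every execution and is therefore supplied for free; postconditions
need to mention only what changes. -/
theorem Runs.mono {c : Program} {σ : State} {Q Q' : State → Prop} (h : Runs P M c σ Q)
    (hQ : ∀ τ, Frame c σ τ → Q τ → Q' τ) : Runs P M c σ Q' := by
  obtain ⟨t, τ, he, ht, hq⟩ := h
  exact ⟨t, τ, he, ht, hQ τ he.frame hq⟩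

theorem Runs.skip {σ : State} {Q : State → Prop} (h : Q σ) : Runs P M .skip σ Q :=
  ⟨_, _, .skip σ, by simp [Program.coef, Program.depth], h⟩

theorem Runs.nset {A : ℕ} {e f : NExp} {σ : State} {Q : State → Prop}
    (h : Q (σ.setNat A (e.eval σ) (f.eval σ))) : Runs P M (.nset A e f) σ Q :=
  ⟨_, _, .nset A e f σ, Nat.le_mul_of_pos_right _ (by positivity), h⟩

theorem Runs.rset {A : ℕ} {e : NExp} {f : RExp} {σ : State} {Q : State → Prop}
    (h : Q (σ.setReal A (e.eval σ) (f.eval σ))) : Runs P M (.rset A e f) σ Q :=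
  ⟨_, _, .rset A e f σ, Nat.le_mul_of_pos_right _ (by positivity), h⟩

theorem Runs.seq {c d : Program} {σ : State} {Q R : State → Prop} (h : Runs P M c σ Q)
    (h' : ∀ τ, Frame c σ τ → Q τ → Runs P M d τ R) : Runs P M (.seq c d) σ R := by
  obtain ⟨t, τ, he, ht, hq⟩ := h
  obtain ⟨u, υ, he', hu, hr⟩ := h' τ he.frame hq
  refine ⟨_, _, .seq he he', ?_, hr⟩
  simp only [Program.coef, Program.depth, add_mul]
  refine Nat.add_le_add (ht.trans ?_) (hu.trans ?_) <;> gcongr <;> simp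

theorem Runs.branch {b : Test} {c d : Program} {σ : State} {Q : State → Prop}
    (h : b.Holds P σ → Runs P M c σ Q) (h' : ¬ b.Holds P σ → Runs P M d σ Q) :
    Runs P M (.branch b c d) σ Q := by
  have hb : b.cost m ≤ b.coef * (M + m + 1) ^ max c.depth d.depth := by
    refine (b.cost_le (M + m + 1) (by omega)).trans ?_
    gcongr
    exact Nat.le_self_pow (by have := c.depth_pos; omega) _
  by_cases hs : b.Holds P σ
  · obtain ⟨t, τ, he, ht, hq⟩ := h hs
    refine ⟨_, _, .branchTrue hs he, ?_, hq⟩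
    simp only [Program.coef, Program.depth, add_mul]
    refine Nat.add_le_add hb ((ht.trans ?_).trans (Nat.le_add_right _ _))
    gcongr <;> simp
  · obtain ⟨t, τ, he, ht, hq⟩ := h' hs
    refine ⟨_, _, .branchFalse hs he, ?_, hq⟩
    simp only [Program.coef, Program.depth, add_mul]
    refine Nat.add_le_add hb ((ht.trans ?_).trans (Nat.le_add_left _ _))
    gcongr <;> simp

/-- The invariant is indexed by the number of completed rounds. The demand `k < M` whenever the test
succeeds gives termination and the time bound together, by induction on the number `M - k` of rounds
still allowed. -/
theorem Runs.loop {b : Test} {c : Program} {σ : State} (Inv : ℕ → State → Prop)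
    (h0 : Inv 0 σ)
    (hstep : ∀ k τ, Frame c σ τ → Inv k τ → b.Holds P τ → k < M ∧ Runs P M c τ (Inv (k + 1))) :
    Runs P M (.loop b c) σ fun τ => (∃ k, Inv k τ) ∧ ¬ b.Holds P τ := by
  set X := M + m + 1 with hX
  have hbX : b.cost m ≤ b.coef * X := b.cost_le X (by omega)
  have key : ∀ r k τ, M = k + r → Frame c σ τ → Inv k τ → ∃ t υ, Exec P (.loop b c) τ t υ ∧
      t ≤ r * (b.coef * X + c.coef * X ^ c.depth) + b.coef * X ∧
      (∃ k, Inv k υ) ∧ ¬ b.Holds P υ := by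
    intro r
    induction r with
    | zero =>
      intro k τ hk hf hi
      have hb : ¬ b.Holds P τ := fun hb => by
        have := (hstep k τ hf hi hb).1
        omega
      exact ⟨_, _, .loopFalse hb, by omega, ⟨k, hi⟩, hb⟩
    | succ r ih =>
      intro k τ hk hf hi
      by_cases hb : b.Holds P τ
      · obtain ⟨t, υ, he, ht, hq⟩ := (hstep k τ hf hi hb).2
        obtain ⟨u, φ, he', hu, hr⟩ := ih (k + 1) υ (by omega) (hf.trans he.frame) hq
        refine ⟨_, _, .loopTrue hb he he', ?_, hr⟩
        rw [← hX] at ht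
        rw [add_mul, one_mul]
        omega
      · exact ⟨_, _, .loopFalse hb, by omega, ⟨k, hi⟩, hb⟩
  obtain ⟨t, τ, he, ht, hq⟩ := key M 0 σ (by omega) (Frame.refl _ _) h0
  refine ⟨t, τ, he, ht.trans ?_, hq⟩
  simp only [Program.coef, Program.depth]
  have h1 : X ≤ X ^ c.depth := Nat.le_self_pow (by have := c.depth_pos; omega) _
  have h2 : 1 ≤ X := by omega
  -- One copy of `b.coef` pays for the tests of the at most `M` rounds, the other for the last,
  -- failing test.
  calc M * (b.coef * X + c.coef * X ^ c.depth) + b.coef * X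
      ≤ X * (b.coef * X ^ c.depth + c.coef * X ^ c.depth) + b.coef * (X * X ^ c.depth) := by
        gcongr
        · omega
        · nlinarith
    _ = (2 * b.coef + c.coef) * X ^ (c.depth + 1) := by ring

/-- `for i < B[0] do c`, where cell `0` of the array `i` is the loop variable. -/
def Program.for (i B : ℕ) (c : Program) : Program :=
  .seq (.nset i (.const 0) (.const 0))
    (.loop (.neg (.nle (.get B (.const 0)) (.get i (.const 0))))
      (.seq c (.nset i (.const 0) (.add (.get i (.const 0)) (.const 1)))))

/-- The body writes neither the loop variable nor the bound, so the number of rounds is fixed on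
entry. The increment is built into `hstep`, which asks for the invariant after the loop variable has
been updated. -/
theorem Runs.for {i B : ℕ} {c : Program} {σ : State} (Inv : ℕ → State → Prop)
    (hi : i ∉ c.nwrites) (hB : B ∉ i :: c.nwrites) (hM : σ.nats B 0 ≤ M)
    (h0 : Inv 0 (σ.setNat i 0 0))
    (hstep : ∀ k < σ.nats B 0, ∀ τ, τ.nats i 0 = k → Frame (.for i B c) σ τ → Inv k τ →
      Runs P M c τ fun υ => Inv (k + 1) (υ.setNat i 0 (k + 1))) :
    Runs P M (.for i B c) σ (Inv (σ.nats B 0)) := by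
  have hBi : B ≠ i := fun h => hB (by simp [h])
  have hBc : B ∉ c.nwrites := fun h => hB (by simp [h])
  refine Runs.seq (Q := fun τ => τ = σ.setNat i 0 0) (Runs.nset rfl) ?_
  rintro _ hf0 rfl
  refine (Runs.loop (fun k τ => τ.nats i 0 = k ∧ k ≤ σ.nats B 0 ∧ Inv k τ) ?_ ?_).mono ?_
  · exact ⟨by simp [State.setNat], by simp, h0⟩
  · intro k τ hf ⟨hk, hk', hInv⟩ hb
    have hfB : τ.nats B = σ.nats B := by
      rw [hf.nats B (by simp [Program.nwrites, hBi, hBc])]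
      simp [State.setNat, hBi]
    simp only [Test.Holds, NExp.eval, hfB, hk, not_le] at hb
    refine ⟨by omega, Runs.seq (hstep k hb τ hk ?_ hInv) ?_⟩
    · exact (hf0.mono (by simp [Program.nwrites, Program.for])
        (by simp [Program.rwrites, Program.for])).trans
        (hf.mono (by simp [Program.nwrites, Program.for])
        (by simp [Program.rwrites, Program.for]))
    · intro υ hυ hI
      have : υ.nats i 0 = k := by rw [hυ.nats i hi, hk]
      refine Runs.nset ?_
      simp only [NExp.eval, this]
      exact ⟨by simp [State.setNat], by omega, hI⟩
  · intro τ hf ⟨⟨k, hk, hk', hInv⟩, hb⟩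
    have hfB : τ.nats B = σ.nats B := by
      rw [hf.nats B (by simp [Program.nwrites, hBi, hBc])]
      simp [State.setNat, hBi]
    simp only [Test.Holds, NExp.eval, hfB, hk, not_le, not_lt] at hb
    rwa [show σ.nats B 0 = k by omega]

end RealRAM

namespace CommitteeSelection
open Finset

/-! ### Rounding a fractional set of items -/

/-- The probability that item `i` is ranked above all chosen items by a voter with ranking `R`, when
the items below `N` are chosen independently with probabilities `x`. -/
noncomputable def surviveProd (N : ℕ) (R : ℕ → ℕ) (x : ℕ → ℝ) (i : ℕ) : ℝ :=
  ∏ j ∈ range N, if R i ≤ R j then 1 - x j else 1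

/-- The expected total `y`-weight of surviving items, summed over the voters in `V`. -/
noncomputable def survival (V : Finset ℕ) (N : ℕ) (R : ℕ → ℕ → ℕ) (y x : ℕ → ℝ) : ℝ :=
  ∑ v ∈ V, ∑ i ∈ range N, y i * surviveProd N (R v) x i

/-- For `z ≤ 1` this bounds a sum of probabilities of disjoint events, "`i` is the top chosen item".
In general, insert an item `a` of least rank: its product runs over everything, the other products
only shrink, and `z(1 - min 1 z) ≤ min 1 z` pays for the new term. -/
theorem sum_mul_prod_truncate_le (s : Finset ℕ) (R : ℕ → ℕ) (z : ℕ → ℝ) (hz : ∀ i ∈ s, 0 ≤ z i) :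
    ∑ i ∈ s, z i * ∏ j ∈ s, (if R i ≤ R j then 1 - min 1 (z j) else 1) ≤
      1 - ∏ j ∈ s, (1 - min 1 (z j)) := by
  induction s using Finset.induction_on_min_value R with
  | empty => simp
  | insert a s ha hmin ih =>
    have h1 : ∀ j, 0 ≤ 1 - min 1 (z j) := fun j => by simp
    have hza : 0 ≤ z a := hz a (mem_insert_self a s)
    have hzs : ∀ i ∈ s, 0 ≤ z i := fun i hi => hz i (mem_insert_of_mem hi)
    have h2 : 1 - min 1 (z a) ≤ 1 := by simp [hza]
    have hp : 0 ≤ ∏ j ∈ s, (1 - min 1 (z j)) := prod_nonneg fun j _ => h1 j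
    rw [sum_insert ha, prod_insert (f := fun j => 1 - min 1 (z j)) ha]
    have e1 : ∏ j ∈ insert a s, (if R a ≤ R j then 1 - min 1 (z j) else 1) =
        (1 - min 1 (z a)) * ∏ j ∈ s, (1 - min 1 (z j)) := by
      rw [prod_insert ha, if_pos le_rfl]
      congr 1
      exact prod_congr rfl fun j hj => if_pos (hmin j hj)
    have e2 : ∑ i ∈ s, z i * ∏ j ∈ insert a s, (if R i ≤ R j then 1 - min 1 (z j) else 1) ≤
        ∑ i ∈ s, z i * ∏ j ∈ s, (if R i ≤ R j then 1 - min 1 (z j) else 1) := by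
      refine sum_le_sum fun i hi => mul_le_mul_of_nonneg_left ?_ (hzs i hi)
      rw [prod_insert ha]
      refine mul_le_of_le_one_left (prod_nonneg fun j _ => ?_) ?_
      · split_ifs
        exacts [h1 j, zero_le_one]
      · split_ifs
        exacts [h2, le_rfl]
    have e3 : z a * (1 - min 1 (z a)) ≤ min 1 (z a) := by
      rcases le_total 1 (z a) with h | h
      · simp [h]
      · rw [min_eq_right h]
        nlinarith
    have ih := ih hzs
    rw [e1]
    nlinarith [mul_le_mul_of_nonneg_right e3 hp]

/-- Each voter contributes at most `1 - ∏ (1 - xⱼ) ≤ 1`. -/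
theorem survival_truncate_le (V : Finset ℕ) (N : ℕ) (R : ℕ → ℕ → ℕ) (y x : ℕ → ℝ) (c : ℝ)
    (hc : 0 ≤ c) (hy : ∀ i < N, 0 ≤ y i) (hx : ∀ i < N, x i = min 1 (y i * c)) :
    survival V N R y x * c ≤ V.card := by
  rw [survival, sum_mul, card_eq_sum_ones, Nat.cast_sum]
  refine sum_le_sum fun v _ => ?_
  have h := sum_mul_prod_truncate_le (range N) (R v) (fun i => y i * c)
    fun i hi => mul_nonneg (hy i (mem_range.1 hi)) hc
  have hp : 0 ≤ ∏ j ∈ range N, (1 - min 1 (y j * c)) := prod_nonneg fun j _ => by simp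
  calc (∑ i ∈ range N, y i * surviveProd N (R v) x i) * c
      = ∑ i ∈ range N, (y i * c) *
          ∏ j ∈ range N, (if R v i ≤ R v j then 1 - min 1 (y j * c) else 1) := by
        rw [sum_mul]
        refine sum_congr rfl fun i _ => ?_
        rw [surviveProd, prod_congr rfl fun j hj => by rw [hx j (mem_range.1 hj)]]
        ring
    _ ≤ 1 := by linarith
    _ = _ := by simp

theorem surviveProd_nonneg (N : ℕ) (R : ℕ → ℕ) (x : ℕ → ℝ) (hx : ∀ j < N, x j ≤ 1) (i : ℕ) :
    0 ≤ surviveProd N R x i := by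
  refine prod_nonneg fun j hj => ?_
  have := hx j (mem_range.1 hj)
  split_ifs <;> linarith

/-- Moving along a line in the coordinates `p` and `j`, in opposite directions, `surviveProd` is
concave. -/
theorem surviveProd_concave (N : ℕ) (R : ℕ → ℕ) (x x₁ x₂ : ℕ → ℝ) (i p j : ℕ) (hp : p < N)
    (hj : j < N) (hpj : p ≠ j) (hx : ∀ k < N, x k ≤ 1)
    (a b d₁ d₂ : ℝ) (ha : 0 ≤ a) (hb : 0 ≤ b) (h₁ : 0 ≤ d₁) (h₂ : 0 ≤ d₂)
    (e₁ : ∀ k, k ≠ p → k ≠ j → x₁ k = x k) (e₂ : ∀ k, k ≠ p → k ≠ j → x₂ k = x k)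
    (p₁ : x₁ p = x p + d₁ * a) (j₁ : x₁ j = x j - d₁ * b)
    (p₂ : x₂ p = x p - d₂ * a) (j₂ : x₂ j = x j + d₂ * b) :
    d₂ * surviveProd N R x₁ i + d₁ * surviveProd N R x₂ i ≤
      (d₁ + d₂) * surviveProd N R x i := by
  have split : ∀ z : ℕ → ℝ, surviveProd N R z i = (if R i ≤ R p then 1 - z p else 1) *
      ((if R i ≤ R j then 1 - z j else 1) *
        ∏ k ∈ ((range N).erase p).erase j, if R i ≤ R k then 1 - z k else 1) := fun z => by
    rw [surviveProd, ← mul_prod_erase _ _ (mem_range.2 hp),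
      ← mul_prod_erase _ _ (mem_erase.2 ⟨hpj.symm, mem_range.2 hj⟩)]
  have hc : ∀ z : ℕ → ℝ, (∀ k, k ≠ p → k ≠ j → z k = x k) →
      (∏ k ∈ ((range N).erase p).erase j, if R i ≤ R k then 1 - z k else 1) =
      ∏ k ∈ ((range N).erase p).erase j, if R i ≤ R k then 1 - x k else 1 := fun z hz =>
    prod_congr rfl fun k hk => by
      simp only [mem_erase] at hk
      rw [hz k hk.2.1 hk.1]
  have hC : 0 ≤ ∏ k ∈ ((range N).erase p).erase j, (if R i ≤ R k then 1 - x k else 1) :=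
    prod_nonneg fun k hk => by
      have := hx k (by simp at hk; exact hk.2.2)
      split_ifs <;> linarith
  rw [split, split x₂, split x, hc x₁ e₁, hc x₂ e₂, p₁, j₁, p₂, j₂]
  set C := ∏ k ∈ ((range N).erase p).erase j, (if R i ≤ R k then 1 - x k else 1)
  split_ifs
  -- If both factors are present, the product is quadratic along the line with leading coefficient
  -- `-abC`, and the weighted ends fall short by exactly this term. Otherwise it is affine and
  -- equality holds.
  · have : 0 ≤ (d₁ ^ 2 * d₂ + d₂ ^ 2 * d₁) * (a * b) * C := by positivity
    nlinarith
  all_goals exact le_of_eq (by ring)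

theorem survival_concave (V : Finset ℕ) (N : ℕ) (R : ℕ → ℕ → ℕ) (y x x₁ x₂ : ℕ → ℝ) (p j : ℕ)
    (hp : p < N) (hj : j < N) (hpj : p ≠ j) (hy : ∀ i < N, 0 ≤ y i) (hx : ∀ k < N, x k ≤ 1)
    (a b d₁ d₂ : ℝ) (ha : 0 ≤ a) (hb : 0 ≤ b) (h₁ : 0 ≤ d₁) (h₂ : 0 ≤ d₂)
    (e₁ : ∀ k, k ≠ p → k ≠ j → x₁ k = x k) (e₂ : ∀ k, k ≠ p → k ≠ j → x₂ k = x k)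
    (p₁ : x₁ p = x p + d₁ * a) (j₁ : x₁ j = x j - d₁ * b)
    (p₂ : x₂ p = x p - d₂ * a) (j₂ : x₂ j = x j + d₂ * b) :
    d₂ * survival V N R y x₁ + d₁ * survival V N R y x₂ ≤ (d₁ + d₂) * survival V N R y x := by
  simp only [survival, mul_sum, ← sum_add_distrib]
  refine sum_le_sum fun v _ => sum_le_sum fun i hi => ?_
  have := mul_le_mul_of_nonneg_left (surviveProd_concave N (R v) x x₁ x₂ i p j hp hj hpj hx a b d₁
    d₂ ha hb h₁ h₂ e₁ e₂ p₁ j₁ p₂ j₂)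
    (hy i (mem_range.1 hi))
  linarith

/-- The number of voters in `V` who rank item `i` above all items of `D`. -/
def beats (V : Finset ℕ) (R : ℕ → ℕ → ℕ) (D : Finset ℕ) (i : ℕ) : ℕ :=
  (V.filter fun v => ∀ j ∈ D, R v j < R v i).card

theorem beats_le_card (V : Finset ℕ) (R : ℕ → ℕ → ℕ) (D : Finset ℕ) (i : ℕ) :
    beats V R D i ≤ V.card := card_filter_le _ _

/-- If a voter ranks `i` above the whole support of `x`, every factor of the survival product is 1:
items in the support do not enter it, and the others have `xⱼ = 0`. Hence rounding up all positive
coordinates is covered by the survival bound. -/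
theorem sum_mul_beats_le_survival (V : Finset ℕ) (N : ℕ) (R : ℕ → ℕ → ℕ) (y x : ℕ → ℝ)
    (hy : ∀ i < N, 0 ≤ y i) (hx : ∀ i < N, 0 ≤ x i ∧ x i ≤ 1) :
    ∑ i ∈ range N, y i * beats V R ((range N).filter fun i => 0 < x i) i ≤
      survival V N R y x := by
  rw [survival, sum_comm]
  refine sum_le_sum fun i hi => ?_
  rw [← mul_sum]
  refine mul_le_mul_of_nonneg_left ?_ (hy i (mem_range.1 hi))
  rw [beats, card_filter, Nat.cast_sum]
  refine sum_le_sum fun v _ => ?_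
  split_ifs with h
  · rw [Nat.cast_one, surviveProd, prod_eq_one]
    intro j hj
    split_ifs with hij
    · have h0 : ¬ 0 < x j := fun h0 => by
        have := h j (mem_filter.2 ⟨hj, h0⟩)
        omega
      linarith [(hx j (mem_range.1 hj)).1]
    · rfl
  · simpa using surviveProd_nonneg N (R v) x (fun j hj => (hx j hj).2) i

/-- If all but one item are chosen integrally, rounding up the remaining one costs at most its
weight. -/
theorem sum_weight_support_le (N : ℕ) (w x : ℕ → ℝ) (p : ℕ) (B : ℝ) (hB : 0 ≤ B)
    (hx : ∀ i < N, 0 ≤ x i) (hw : ∀ i < N, 0 < x i → 0 ≤ w i ∧ w i ≤ B)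
    (hint : ∀ i < N, i ≠ p → x i ≤ 0 ∨ 1 ≤ x i) (hsum : ∑ i ∈ range N, x i * w i ≤ B) :
    ∑ i ∈ (range N).filter (fun i => 0 < x i), w i ≤ 2 * B := by
  have hterm : ∀ i < N, 0 ≤ x i * w i := fun i hi => by
    rcases (hx i hi).eq_or_lt with h | h
    · simp [← h]
    · exact mul_nonneg h.le (hw i hi h).1
  have key : ∑ i ∈ (range N).filter (fun i => 0 < x i), w i ≤
      ∑ i ∈ range N, (x i * w i + if i = p then B else 0) := by
    rw [sum_filter]
    refine sum_le_sum fun i hi => ?_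
    have hi := mem_range.1 hi
    have := hterm i hi
    split_ifs with h1 h2 h2
    · have := (hw i hi h1).2
      linarith
    · rcases hint i hi h2 with h | h
      · linarith
      · nlinarith [(hw i hi h1).1]
    · linarith
    · linarith
  rw [sum_add_distrib] at key
  have : ∑ i ∈ range N, (if i = p then B else 0) ≤ B := by
    rw [sum_ite_eq']
    split_ifs <;> linarith
  linarith

/-! ### Regret matching -/

/-- One step of regret matching: playing against the positive parts of the cumulative regrets `G`
keeps the sum of their squares under control. -/
theorem sum_sq_posPart_add_le (s : Finset ℕ) (G g : ℕ → ℝ) (b : ℝ) (hg : ∀ i ∈ s, |g i| ≤ b)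
    (h : ∑ i ∈ s, max (G i) 0 * g i ≤ 0) :
    ∑ i ∈ s, max (G i + g i) 0 ^ 2 ≤ ∑ i ∈ s, max (G i) 0 ^ 2 + s.card * b ^ 2 := by
  have key : ∀ i ∈ s, max (G i + g i) 0 ^ 2 ≤
      max (G i) 0 ^ 2 + 2 * (max (G i) 0 * g i) + b ^ 2 := fun i hi => by
    have h1 : g i ^ 2 ≤ b ^ 2 := sq_le_sq' (abs_le.1 (hg i hi)).1 (abs_le.1 (hg i hi)).2
    -- The square of `max (G i) 0 + g i` expands into the three terms on the right of `key`, up to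
    -- `g i ^ 2 ≤ b ^ 2`.
    have h2 : |max (G i + g i) 0| ≤ |max (G i) 0 + g i| := by
      rw [abs_of_nonneg (le_max_right _ _)]
      refine max_le ?_ (abs_nonneg _)
      exact (add_le_add_left (le_max_left _ _) _).trans (le_abs_self _)
    have h3 := sq_le_sq.2 h2
    nlinarith
  refine (sum_le_sum key).trans ?_
  rw [sum_add_distrib, sum_add_distrib, ← mul_sum, sum_const, nsmul_eq_mul]
  linarith

/-! ### Choosing a round that satisfies most voters -/

/-- The number of rounds in which the value for a voter is at most that in round `r`. -/
def roundRank (T : ℕ) (a : ℕ → ℕ) (r : ℕ) : ℕ := ((range T).filter fun q => a q ≤ a r).card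

/-- Among the rounds of small rank take one of largest value: all of them count towards its rank,
which is below `T/4`. -/
theorem card_roundRank_lt (T : ℕ) (a : ℕ → ℕ) :
    4 * ((range T).filter fun r => 4 * roundRank T a r < T).card ≤ T := by
  rcases ((range T).filter fun r => 4 * roundRank T a r < T).eq_empty_or_nonempty with h | h
  · simp [h]
  · obtain ⟨r, hr, hmax⟩ := exists_max_image _ a h
    have h1 : ((range T).filter fun r => 4 * roundRank T a r < T).card ≤ roundRank T a r :=
      card_le_card fun q hq => mem_filter.2 ⟨(mem_filter.1 hq).1, hmax q hq⟩
    have := (mem_filter.1 hr).2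
    omega

/-- Double counting of pairs of a voter and a round: every voter is dissatisfied with at most a
quarter of the rounds, so some round dissatisfies at most a quarter of the voters. -/
theorem exists_round (V : Finset ℕ) (T : ℕ) (hT : 0 < T) (a : ℕ → ℕ → ℕ) :
    ∃ r < T, 4 * (V.filter fun v => 4 * roundRank T (a v) r < T).card ≤ V.card := by
  by_contra! hcon
  have h1 : T * V.card < ∑ r ∈ range T, 4 * (V.filter fun v => 4 * roundRank T (a v) r < T).card := by
    have := sum_lt_sum_of_nonempty (s := range T) ⟨0, mem_range.2 hT⟩
      fun r hr => hcon r (mem_range.1 hr)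
    simpa using this
  have h2 : ∑ r ∈ range T, 4 * (V.filter fun v => 4 * roundRank T (a v) r < T).card =
      ∑ v ∈ V, 4 * ((range T).filter fun r => 4 * roundRank T (a v) r < T).card := by
    simp only [← mul_sum, card_filter]
    rw [sum_comm]
  have h3 : ∑ v ∈ V, 4 * ((range T).filter fun r => 4 * roundRank T (a v) r < T).card ≤
      ∑ v ∈ V, T := sum_le_sum fun v _ => card_roundRank_lt T (a v)
  rw [sum_const, smul_eq_mul, mul_comm] at h3
  omega

/-- A voter who is satisfied with round `r` and still ranks `i` above everything chosen in that
round does so in at least a quarter of the rounds. -/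
theorem card_satisfied_le (V : Finset ℕ) (T : ℕ) (a : ℕ → ℕ → ℕ) (R : ℕ → ℕ) (r : ℕ) :
    (V.filter fun v => T ≤ 4 * roundRank T (a v) r ∧ a v r ≤ R v).card * T ≤
      4 * ∑ q ∈ range T, (V.filter fun v => a v q ≤ R v).card := by
  simp only [card_filter]
  rw [sum_comm, sum_mul, mul_sum]
  refine sum_le_sum fun v _ => ?_
  split_ifs with h
  · rw [one_mul, ← card_filter]
    refine h.1.trans (Nat.mul_le_mul_left _ (card_le_card ?_))
    intro q hq
    have := (mem_filter.1 hq).2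
    exact mem_filter.2 ⟨(mem_filter.1 hq).1, by omega⟩
  · simp

/-! ### Pipage rounding -/

/-- Move the weight `d` from item `j` to item `p` in the fractional set `x`. -/
noncomputable def shiftMass (w x : ℕ → ℝ) (p j : ℕ) (d : ℝ) : ℕ → ℝ :=
  Function.update (Function.update x p (x p + d / w p)) j (x j - d / w j)

theorem shiftMass_left {w x : ℕ → ℝ} {p j : ℕ} (h : p ≠ j) (d : ℝ) :
    shiftMass w x p j d p = x p + d / w p := by simp [shiftMass, h]

theorem shiftMass_right (w x : ℕ → ℝ) (p j : ℕ) (d : ℝ) :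
    shiftMass w x p j d j = x j - d / w j := by simp [shiftMass]

theorem shiftMass_of_ne (w x : ℕ → ℝ) {p j k : ℕ} (d : ℝ) (hp : k ≠ p) (hj : k ≠ j) :
    shiftMass w x p j d k = x k := by simp [shiftMass, hp, hj]

/-- The largest weight that can be moved from `j` to `p`. -/
noncomputable def shiftUp (w x : ℕ → ℝ) (p j : ℕ) : ℝ := min ((1 - x p) * w p) (x j * w j)

/-- The negative of the largest weight that can be moved from `p` to `j`. -/
noncomputable def shiftDown (w x : ℕ → ℝ) (p j : ℕ) : ℝ := - min (x p * w p) ((1 - x j) * w j)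

/-- Since `x` lies strictly between the two ends of the exchange and survival is concave along it,
the ends cannot both exceed the value at `x`. -/
theorem survival_shift_le (V : Finset ℕ) (N : ℕ) (R : ℕ → ℕ → ℕ) (y w x : ℕ → ℝ) {p j : ℕ}
    (hp : p < N) (hj : j < N) (hpj : p ≠ j) (hy : ∀ i < N, 0 ≤ y i) (hx : ∀ k < N, x k ≤ 1)
    (hwp : 0 < w p) (hwj : 0 < w j) (xp0 : 0 < x p) (xp1 : x p < 1) (xj0 : 0 < x j) (xj1 : x j < 1) :
    survival V N R y (shiftMass w x p j (shiftUp w x p j)) ≤ survival V N R y x ∨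
    survival V N R y (shiftMass w x p j (shiftDown w x p j)) ≤ survival V N R y x := by
  have h1 : 0 < shiftUp w x p j :=
    lt_min (mul_pos (by linarith) hwp) (mul_pos xj0 hwj)
  have h2 : 0 < - shiftDown w x p j := by
    rw [shiftDown, neg_neg]
    exact lt_min (mul_pos xp0 hwp) (mul_pos (by linarith) hwj)
  have h := survival_concave V N R y x (shiftMass w x p j (shiftUp w x p j))
    (shiftMass w x p j (shiftDown w x p j)) p j hp hj hpj hy hx (w p)⁻¹ (w j)⁻¹
    (shiftUp w x p j) (- shiftDown w x p j) (by positivity) (by positivity) h1.le h2.le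
    (fun k hk hk' => shiftMass_of_ne _ _ _ hk hk') (fun k hk hk' => shiftMass_of_ne _ _ _ hk hk')
    (by rw [shiftMass_left hpj]; ring) (by rw [shiftMass_right]; ring)
    (by rw [shiftMass_left hpj]; ring) (by rw [shiftMass_right]; ring)
  by_contra! hcon
  nlinarith [mul_lt_mul_of_pos_left hcon.1 h2, mul_lt_mul_of_pos_left hcon.2 h1]

/-- The state of a rounding procedure that has treated the items below `k`, of which at most the
pivot `p` is still fractional. -/
structure RoundingInv (V : Finset ℕ) (N : ℕ) (R : ℕ → ℕ → ℕ) (y w : ℕ → ℝ) (B S : ℝ) (k p : ℕ)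
    (x : ℕ → ℝ) : Prop where
  bounds : ∀ i < N, 0 ≤ x i ∧ x i ≤ 1
  support : ∀ i < N, 0 < x i → 0 < w i ∧ w i ≤ B
  weight : ∑ i ∈ range N, x i * w i ≤ B
  surv : survival V N R y x ≤ S
  integral : ∀ i < k, i ≠ p → x i ≤ 0 ∨ 1 ≤ x i
  pivot : p < max k 1

variable {V : Finset ℕ} {N : ℕ} {R : ℕ → ℕ → ℕ} {y w : ℕ → ℝ} {B S : ℝ} {k p : ℕ} {x : ℕ → ℝ}

/-- If one of `p` and `k` is integral, then `k` can be regarded as treated. -/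
theorem RoundingInv.advance (h : RoundingInv V N R y w B S k p x)
    (hk : x k ≤ 0 ∨ 1 ≤ x k ∨ ¬ p < k) :
    RoundingInv V N R y w B S (k + 1) p x := by
  refine ⟨h.bounds, h.support, h.weight, h.surv, fun i hi hip => ?_, by have := h.pivot; omega⟩
  rcases Nat.lt_succ_iff_lt_or_eq.1 hi with hi | rfl
  · exact h.integral i hi hip
  · have := h.pivot
    rcases hk with hk | hk | hk
    · exact .inl hk
    · exact .inr hk
    · omega

/-- An integral pivot needs no exemption any more, so item `k` can take over this role whether it is
fractional or not. -/
theorem RoundingInv.advance_pivot (h : RoundingInv V N R y w B S k p x)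
    (hp : x p ≤ 0 ∨ 1 ≤ x p) : RoundingInv V N R y w B S (k + 1) k x := by
  refine ⟨h.bounds, h.support, h.weight, h.surv, fun i hi hip => ?_, by omega⟩
  by_cases hi' : i = p
  · exact hi' ▸ hp
  · exact h.integral i (by omega) hi'

/-- The total weight is conserved, because `d / w p` and `d / w k` are scaled back by `w p` and `w
k`. Each minimum in `shiftUp` and `shiftDown` is attained where one of the two coordinates reaches 0
or 1. -/
theorem RoundingInv.shift (h : RoundingInv V N R y w B S k p x) (hk : k < N) (hpk : p < k)
    (xp0 : 0 < x p) (xp1 : x p < 1) (xk0 : 0 < x k) (xk1 : x k < 1) {d : ℝ}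
    (hd : d = shiftUp w x p k ∨ d = shiftDown w x p k)
    (hs : survival V N R y (shiftMass w x p k d) ≤ survival V N R y x) :
    RoundingInv V N R y w B S k p (shiftMass w x p k d) ∧
      ((shiftMass w x p k d p ≤ 0 ∨ 1 ≤ shiftMass w x p k d p) ∨
        (shiftMass w x p k d k ≤ 0 ∨ 1 ≤ shiftMass w x p k d k)) := by
  have hpN : p < N := hpk.trans hk
  have hwp := (h.support p hpN xp0).1
  have hwk := (h.support k hk xk0).1
  have hne : p ≠ k := hpk.ne
  have key : (0 ≤ x p + d / w p ∧ x p + d / w p ≤ 1) ∧ (0 ≤ x k - d / w k ∧ x k - d / w k ≤ 1) ∧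
      ((x p + d / w p ≤ 0 ∨ 1 ≤ x p + d / w p) ∨ (x k - d / w k ≤ 0 ∨ 1 ≤ x k - d / w k)) := by
    have ep : x p + d / w p = (x p * w p + d) / w p := by field_simp
    have ek : x k - d / w k = (x k * w k - d) / w k := by field_simp
    rw [ep, ek]
    simp only [le_div_iff₀ hwp, div_le_iff₀ hwp, le_div_iff₀ hwk, div_le_iff₀ hwk]
    have a1 : 0 < x p * w p := mul_pos xp0 hwp
    have a2 : 0 < x k * w k := mul_pos xk0 hwk
    have a3 : 0 < (1 - x p) * w p := mul_pos (by linarith) hwp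
    have a4 : 0 < (1 - x k) * w k := mul_pos (by linarith) hwk
    rcases hd with rfl | rfl
    · rw [shiftUp]
      rcases le_total ((1 - x p) * w p) (x k * w k) with hle | hle
      · rw [min_eq_left hle]
        refine ⟨⟨?_, ?_⟩, ⟨?_, ?_⟩, .inl (.inr ?_)⟩ <;> linarith
      · rw [min_eq_right hle]
        refine ⟨⟨?_, ?_⟩, ⟨?_, ?_⟩, .inr (.inl ?_)⟩ <;> linarith
    · rw [shiftDown]
      rcases le_total (x p * w p) ((1 - x k) * w k) with hle | hle
      · rw [min_eq_left hle]
        refine ⟨⟨?_, ?_⟩, ⟨?_, ?_⟩, .inl (.inl ?_)⟩ <;> linarith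
      · rw [min_eq_right hle]
        refine ⟨⟨?_, ?_⟩, ⟨?_, ?_⟩, .inr (.inr ?_)⟩ <;> linarith
  have split : ∀ z : ℕ → ℝ, ∑ i ∈ range N, z i * w i =
      z p * w p + (z k * w k + ∑ i ∈ ((range N).erase p).erase k, z i * w i) := fun z => by
    rw [← add_sum_erase _ _ (mem_range.2 hpN),
      ← add_sum_erase _ _ (mem_erase.2 ⟨hne.symm, mem_range.2 hk⟩)]
  refine ⟨⟨fun i hi => ?_, fun i hi h0 => ?_, ?_, hs.trans h.surv, fun i hi hip => ?_, h.pivot⟩, ?_⟩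
  · by_cases hip : i = p
    · rw [hip, shiftMass_left hne]
      exact key.1
    · by_cases hik : i = k
      · rw [hik, shiftMass_right]
        exact key.2.1
      · rw [shiftMass_of_ne _ _ _ hip hik]
        exact h.bounds i hi
  · by_cases hip : i = p
    · exact h.support i hi (hip ▸ xp0)
    · by_cases hik : i = k
      · exact h.support i hi (hik ▸ xk0)
      · rw [shiftMass_of_ne _ _ _ hip hik] at h0
        exact h.support i hi h0
  · refine le_trans (le_of_eq ?_) h.weight
    rw [split, split x, shiftMass_left hne, shiftMass_right]
    have : ∑ i ∈ ((range N).erase p).erase k, shiftMass w x p k d i * w i =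
        ∑ i ∈ ((range N).erase p).erase k, x i * w i := sum_congr rfl fun i hi => by
      simp only [mem_erase] at hi
      rw [shiftMass_of_ne _ _ _ hi.2.1 hi.1]
    rw [this]
    field_simp
    ring
  · rw [shiftMass_of_ne _ _ _ hip (by omega)]
    exact h.integral i hi hip
  · rw [shiftMass_left hne, shiftMass_right]
    exact key.2.2

/-- What the rounding procedure achieves when it starts from the truncated multiple of `y` of total
weight at most `B`. -/
theorem RoundingInv.result (hB : 0 < B) (hy : ∀ i < N, 0 ≤ y i) (hw : ∀ i < N, 0 < y i → 0 < w i)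
    {μ : ℝ} (hμ : μ = ∑ i ∈ range N, y i * w i) {x₀ : ℕ → ℝ}
    (hx₀ : ∀ i < N, x₀ i = min 1 (y i * (B / μ)))
    (h : RoundingInv V N R y w B (survival V N R y x₀) N p x) :
    ∑ i ∈ (range N).filter (fun i => 0 < x i), w i ≤ 2 * B ∧
    ∑ i ∈ range N, y i * (beats V R ((range N).filter fun i => 0 < x i) i -
      w i * (V.card / B)) ≤ 0 := by
  refine ⟨sum_weight_support_le N w x p B hB.le (fun i hi => (h.bounds i hi).1)
    (fun i hi h0 => ⟨(h.support i hi h0).1.le, (h.support i hi h0).2⟩) h.integral h.weight, ?_⟩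
  have hterm : ∀ i ∈ range N, 0 ≤ y i * w i := fun i hi => by
    rcases (hy i (mem_range.1 hi)).eq_or_lt with h0 | h0
    · simp [← h0]
    · exact mul_nonneg h0.le (hw i (mem_range.1 hi) h0).le
  have hμ0 : 0 ≤ μ := hμ ▸ sum_nonneg hterm
  -- If `μ = 0`, then `y` vanishes, since `w` is positive wherever `y` is.
  rcases hμ0.eq_or_lt with h0 | h0
  · refine sum_nonpos fun i hi => ?_
    have hz := (sum_eq_zero_iff_of_nonneg hterm).1 (by rw [← hμ, h0]) i hi
    have : y i = 0 := by
      rcases (hy i (mem_range.1 hi)).eq_or_lt with h1 | h1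
      · exact h1.symm
      · have := mul_pos h1 (hw i (mem_range.1 hi) h1)
        linarith
    simp [this]
  -- The chain is `∑ y * beats ≤ survival x ≤ survival x₀ ≤ |V| μ / B = ∑ y w |V| / B`.
  · have h1 := sum_mul_beats_le_survival V N R y x hy h.bounds
    have h2 := survival_truncate_le V N R y x₀ (B / μ) (by positivity) hy hx₀
    have h3 : survival V N R y x₀ ≤ V.card * (μ / B) := by
      rw [mul_div_assoc', div_le_iff₀ h0] at h2
      rw [mul_div_assoc', le_div_iff₀ hB]
      exact h2
    have h4 : ∑ i ∈ range N, y i * (w i * (V.card / B)) = V.card * (μ / B) := by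
      rw [hμ, sum_div, mul_sum]
      exact sum_congr rfl fun i _ => by ring
    simp only [mul_sub, sum_sub_distrib]
    rw [h4]
    linarith [h.surv]

theorem RoundingInv.init (hB : 0 < B) (hy : ∀ i < N, 0 ≤ y i)
    (hw : ∀ i < N, 0 < y i → 0 < w i ∧ w i ≤ B) {μ : ℝ}
    (hμ : μ = ∑ i ∈ range N, y i * w i) {x₀ : ℕ → ℝ}
    (hx₀ : ∀ i < N, x₀ i = min 1 (y i * (B / μ))) :
    RoundingInv V N R y w B (survival V N R y x₀) 0 0 x₀ := by
  have hterm : ∀ i ∈ range N, 0 ≤ y i * w i := fun i hi => by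
    rcases (hy i (mem_range.1 hi)).eq_or_lt with h0 | h0
    · simp [← h0]
    · exact mul_nonneg h0.le (hw i (mem_range.1 hi) h0).1.le
  have hμ0 : 0 ≤ μ := hμ ▸ sum_nonneg hterm
  have hc : 0 ≤ B / μ := by positivity
  refine ⟨fun i hi => ?_, fun i hi h0 => ?_, ?_, le_rfl, fun i hi => by omega, by omega⟩
  · rw [hx₀ i hi]
    exact ⟨le_min zero_le_one (mul_nonneg (hy i hi) hc), min_le_left _ _⟩
  · refine hw i hi ((hy i hi).lt_of_ne fun h => ?_)
    rw [hx₀ i hi, ← h] at h0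
    simp at h0
  · calc ∑ i ∈ range N, x₀ i * w i ≤ ∑ i ∈ range N, (y i * w i) * (B / μ) := by
          refine sum_le_sum fun i hi => ?_
          have hi' := mem_range.1 hi
          rcases (hy i hi').eq_or_lt with h0 | h0
          · simp [hx₀ i hi', ← h0]
          · rw [hx₀ i hi', mul_right_comm]
            exact mul_le_mul_of_nonneg_right (min_le_right _ _) (hw i hi' h0).1.le
      _ = μ * (B / μ) := by rw [← sum_mul, hμ]
      _ ≤ B := by
          -- For `μ = 0` the quotient `B / μ` is 0 by convention, and nothing is chosen.
          rcases hμ0.eq_or_lt with h0 | h0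
          · simp [← h0, hB.le]
          · rw [mul_div_cancel₀ _ h0.ne']

end CommitteeSelection

namespace RealRAM
open CommitteeSelection Finset

/-! ### The algorithm

The names of the arrays; scalar variables occupy cell `0`. -/

notation "numCand" => (0 : ℕ)
notation "numVoter" => (1 : ℕ)
notation "maxSize" => (2 : ℕ)
notation "outArr" => (3 : ℕ)
notation "numItem" => (4 : ℕ)
notation "comArr" => (5 : ℕ)
notation "addrArr" => (6 : ℕ)
notation "rankArr" => (7 : ℕ)
notation "baseArr" => (8 : ℕ)
notation "numRound" => (9 : ℕ)
notation "actArr" => (10 : ℕ)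
notation "numAct" => (11 : ℕ)
notation "valArr" => (12 : ℕ)
notation "selArr" => (13 : ℕ)
notation "strideReg" => (14 : ℕ)
notation "limitReg" => (15 : ℕ)
notation "oldItem" => (16 : ℕ)
notation "pivotReg" => (17 : ℕ)
notation "bestRound" => (18 : ℕ)
notation "badReg" => (19 : ℕ)
notation "countReg" => (20 : ℕ)
notation "itemVar" => (21 : ℕ)
notation "itemVarB" => (22 : ℕ)
notation "itemVarC" => (23 : ℕ)
notation "candVar" => (24 : ℕ)
notation "cellVar" => (25 : ℕ)
notation "voterVar" => (26 : ℕ)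
notation "roundVar" => (27 : ℕ)
notation "roundVarB" => (28 : ℕ)

notation "scoreArr" => (0 : ℕ)
notation "totalReg" => (1 : ℕ)
notation "epsReg" => (2 : ℕ)
notation "thetaReg" => (3 : ℕ)
notation "lowReg" => (4 : ℕ)
notation "fineReg" => (5 : ℕ)
notation "weightArr" => (6 : ℕ)
notation "halfReg" => (7 : ℕ)
notation "regretArr" => (8 : ℕ)
notation "playArr" => (9 : ℕ)
notation "meanReg" => (10 : ℕ)
notation "fracArr" => (11 : ℕ)
notation "survReg" => (12 : ℕ)
notation "prodReg" => (13 : ℕ)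
notation "savePivot" => (14 : ℕ)
notation "saveItem" => (15 : ℕ)
notation "upReg" => (16 : ℕ)
notation "downReg" => (17 : ℕ)
notation "upSurv" => (18 : ℕ)

/-- The scalar variable stored in cell `0` of `A`. -/
abbrev NExp.var (A : ℕ) : NExp := .get A (.const 0)

abbrev RExp.var (A : ℕ) : RExp := .get A (.const 0)

abbrev RExp.const (k : ℕ) : RExp := .ofNat (.const k)

abbrev Test.rlt (e f : RExp) : Test := .neg (.rle f e)

/-- Run `c` if all the tests succeed. -/
def Program.guard (l : List Test) (c : Program) : Program :=
  l.foldr (fun b d => .branch b d .skip) c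

/-- The address of cell `v` of row `r` of a two-dimensional array. -/
abbrev NExp.addr (r v : ℕ) : NExp := .add (.get baseArr (.var r)) (.var v)

abbrev NExp.cell (A r v : ℕ) : NExp := .get A (.addr r v)

def computeSurvival : Program :=
  .seq (.rset survReg (.const 0) (.const 0)) <|
  .for voterVar numVoter <| .guard [.nle (.const 1) (.get actArr (.var voterVar))] <|
    .for itemVarB numItem <|
      .seq (.rset prodReg (.const 0) (.get playArr (.var itemVarB))) <|
      .seq (.for itemVarC numItem <|
        .guard [.nle (.cell rankArr voterVar itemVarB) (.cell rankArr voterVar itemVarC)] <|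
          .rset prodReg (.const 0)
            (.mul (.var prodReg) (.sub (.const 1) (.get fracArr (.var itemVarC))))) <|
      .rset survReg (.const 0) (.add (.var survReg) (.var prodReg))

/-- The shift starts from the saved coordinates, not from the current ones, so that it can overwrite
an earlier trial shift. -/
def applyShift (d : ℕ) : Program :=
  .seq (.rset fracArr (.var pivotReg)
    (.add (.var savePivot) (.div (.var d) (.get weightArr (.var pivotReg))))) <|
  .rset fracArr (.var itemVar)
    (.sub (.var saveItem) (.div (.var d) (.get weightArr (.var itemVar))))

/-- Set `d` to the smaller of two numbers. -/
def setMin (d : ℕ) (e f : RExp) : Program :=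
  .seq (.rset d (.const 0) e) (.guard [.rle f (.var d)] (.rset d (.const 0) f))

/-- Save the coordinates of the pivot and the current item, and compute how far they can move. -/
def prepareMove : Program :=
  .seq (.rset savePivot (.const 0) (.get fracArr (.var pivotReg))) <|
  .seq (.rset saveItem (.const 0) (.get fracArr (.var itemVar))) <|
  .seq (setMin upReg
    (.mul (.sub (.const 1) (.var savePivot)) (.get weightArr (.var pivotReg)))
    (.mul (.var saveItem) (.get weightArr (.var itemVar)))) <|
  .seq (setMin downReg
    (.mul (.var savePivot) (.get weightArr (.var pivotReg)))
    (.mul (.sub (.const 1) (.var saveItem)) (.get weightArr (.var itemVar)))) <|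
  .rset downReg (.const 0) (.sub (.const 0) (.var downReg))

/-- Both ends of the exchange are tried. The second trial overwrites the first, which is restored if
its survival is no larger. -/
def moveMass : Program :=
  .seq prepareMove <|
  .seq (applyShift upReg) <|
  .seq computeSurvival <|
  .seq (.rset upSurv (.const 0) (.var survReg)) <|
  .seq (applyShift downReg) <|
  .seq computeSurvival <|
  .guard [.rle (.var upSurv) (.var survReg)] (applyShift upReg)

/-- At most one treated item, the pivot, is fractional. If the current item is fractional too, a
move makes one of the two integral; an integral pivot then hands its role to the current item. -/
def roundingStep : Program :=
  .seq (.guard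
    [.neg (.nle (.var itemVar) (.var pivotReg)),
      .rlt (.const 0) (.get fracArr (.var pivotReg)),
      .rlt (.get fracArr (.var pivotReg)) (.const 1),
      .rlt (.const 0) (.get fracArr (.var itemVar)),
      .rlt (.get fracArr (.var itemVar)) (.const 1)] moveMass) <|
  .branch (.rle (.get fracArr (.var pivotReg)) (.const 0))
    (.nset pivotReg (.const 0) (.var itemVar)) <|
    .guard [.rle (.const 1) (.get fracArr (.var pivotReg))]
      (.nset pivotReg (.const 0) (.var itemVar))

/-- Play the positive regrets of the items of admissible weight. -/
def computePlay : Program :=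
  .seq (.rset meanReg (.const 0) (.const 0)) <|
  .for itemVar numItem <|
    .seq (.rset playArr (.var itemVar) (.const 0)) <|
    .seq (.guard [.rlt (.var lowReg) (.get weightArr (.var itemVar)),
        .rle (.get weightArr (.var itemVar)) (.var halfReg),
        .rlt (.const 0) (.get regretArr (.var itemVar))] <|
      .rset playArr (.var itemVar) (.get regretArr (.var itemVar))) <|
    .rset meanReg (.const 0) (.add (.var meanReg)
      (.mul (.get playArr (.var itemVar)) (.get weightArr (.var itemVar))))

def computeFrac : Program :=
  .for itemVar numItem <|
    .seq (.rset fracArr (.var itemVar)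
      (.mul (.get playArr (.var itemVar)) (.div (.var halfReg) (.var meanReg)))) <|
    .guard [.rle (.const 1) (.get fracArr (.var itemVar))] <|
      .rset fracArr (.var itemVar) (.const 1)

def roundItems : Program :=
  .seq (.nset pivotReg (.const 0) (.const 0)) <|
  .for itemVar numItem roundingStep

/-- For every voter, record one more than the best rank of an item with positive fraction. -/
def recordValues : Program :=
  .for voterVar numVoter <|
    .seq (.nset valArr (.addr roundVar voterVar) (.const 0)) <|
    .for itemVar numItem <|
      .guard [.rlt (.const 0) (.get fracArr (.var itemVar)),
        .nle (.cell valArr roundVar voterVar) (.cell rankArr voterVar itemVar)] <|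
        .nset valArr (.addr roundVar voterVar) (.add (.cell rankArr voterVar itemVar) (.const 1))

/-- Set `countReg` to the number of active voters who prefer the current item to the items chosen
in the current round. -/
def countBeats : Program :=
  .seq (.nset countReg (.const 0) (.const 0)) <|
  .for voterVar numVoter <|
    .guard [.nle (.const 1) (.get actArr (.var voterVar)),
      .nle (.cell valArr roundVar voterVar) (.cell rankArr voterVar itemVar)] <|
      .nset countReg (.const 0) (.add (.var countReg) (.const 1))

def recordItems : Program :=
  .for itemVar numItem <|
    .seq (.branch (.rle (.get fracArr (.var itemVar)) (.const 0))
      (.nset selArr (.addr roundVar itemVar) (.const 0))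
      (.nset selArr (.addr roundVar itemVar) (.const 1))) <|
    .seq countBeats <|
    .rset regretArr (.var itemVar) (.add (.get regretArr (.var itemVar))
      (.sub (.ofNat (.var countReg)) (.mul (.get weightArr (.var itemVar))
        (.div (.ofNat (.var numAct)) (.var halfReg)))))

def playRound : Program :=
  .seq computePlay <| .seq computeFrac <| .seq roundItems <| .seq recordValues recordItems

/-- All rounds of regret matching. -/
def playAll : Program :=
  .seq (.for itemVar numItem (.rset regretArr (.var itemVar) (.const 0))) <|
  .for roundVar numRound playRound

abbrev NExp.fourTimes (A : ℕ) : NExp :=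
  .add (.add (.var A) (.var A)) (.add (.var A) (.var A))

/-- Set `countReg` to the number of rounds that are not better than the current one for the current
voter. -/
def countRank : Program :=
  .seq (.nset countReg (.const 0) (.const 0)) <|
  .for roundVarB numRound <|
    .guard [.nle (.cell valArr roundVarB voterVar) (.cell valArr roundVar voterVar)] <|
      .nset countReg (.const 0) (.add (.var countReg) (.const 1))

/-- Set `badReg` to the number of active voters who find the current round among the worst
quarter. -/
def countBad : Program :=
  .seq (.nset badReg (.const 0) (.const 0)) <|
  .for voterVar numVoter <|
    .guard [.nle (.const 1) (.get actArr (.var voterVar))] <|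
      .seq countRank <|
      .guard [.neg (.nle (.var numRound) (.fourTimes countReg))] <|
        .nset badReg (.const 0) (.add (.var badReg) (.const 1))

def findBest : Program :=
  .for roundVar numRound <|
    .seq countBad <|
    .guard [.nle (.fourTimes badReg) (.var numAct)] <|
      .nset bestRound (.const 0) (.var roundVar)

/-- Deactivate the voters who do not find the current round among the worst quarter. -/
def retireVoters : Program :=
  .seq (.nset numAct (.const 0) (.const 0)) <|
  .for voterVar numVoter <|
    .guard [.nle (.const 1) (.get actArr (.var voterVar))] <|
      .seq countRank <|
      .branch (.nle (.var numRound) (.fourTimes countReg))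
        (.nset actArr (.var voterVar) (.const 0))
        (.nset numAct (.const 0) (.add (.var numAct) (.const 1)))

/-- Add the candidates of all items chosen in the current round to the output. -/
def addRound : Program :=
  .for itemVar numItem <|
    .guard [.nle (.const 1) (.cell selArr roundVar itemVar)] <|
      .for candVar numCand <|
        .guard [.nle (.const 1) (.get comArr (.add (.get addrArr (.var itemVar)) (.var candVar)))] <|
          .nset outArr (.var candVar) (.const 1)

def stage : Program :=
  .seq playAll <|
  .seq findBest <|
  .seq (.nset roundVar (.const 0) (.var bestRound)) <|
  .seq retireVoters <|
  .seq addRound <|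
  .rset halfReg (.const 0) (.div (.var halfReg) (.const 2))

/-- Compute the parameters of the algorithm. -/
def setParameters : Program :=
  .seq (.rset thetaReg (.const 0) (.div (.var epsReg)
    (.add (.const 64) (.mul (.const 2) (.var epsReg))))) <|
  .seq (.rset lowReg (.const 0) (.div (.mul (.var thetaReg) (.var totalReg))
    (.ofNat (.add (.var numCand) (.const 1))))) <|
  .seq (.rset halfReg (.const 0) (.div (.mul (.sub (.const 1) (.var thetaReg)) (.var totalReg))
    (.const 4))) <|
  .seq (.rset fineReg (.const 0) (.div (.mul (.div (.var epsReg) (.const 64)) (.var thetaReg))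
    (.ofNat (.add (.var numCand) (.const 1))))) <|
  .branch (.nle (.var maxSize) (.var numCand))
    (.nset limitReg (.const 0) (.var maxSize)) (.nset limitReg (.const 0) (.var numCand))

/-- Append to the list of items the current item together with the current candidate. -/
def appendItem : Program :=
  .seq (.for cellVar numCand <|
    .nset comArr (.add (.get addrArr (.var numItem)) (.var cellVar))
      (.get comArr (.add (.get addrArr (.var itemVar)) (.var cellVar)))) <|
  .seq (.nset comArr (.add (.get addrArr (.var numItem)) (.var candVar)) (.const 1)) <|
  .seq (.nset addrArr (.add (.var numItem) (.const 1))
    (.add (.get addrArr (.var numItem)) (.var numCand))) <|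
  .nset numItem (.const 0) (.add (.var numItem) (.const 1))

/-- List all committees with a bounded number of candidates, possibly with repetitions. -/
def listItems : Program :=
  .seq (.nset numItem (.const 0) (.const 1)) <|
  .seq (.nset addrArr (.const 1) (.var numCand)) <|
  .for roundVar limitReg <|
    .seq (.nset oldItem (.const 0) (.var numItem)) <|
    .for itemVar oldItem <| .for candVar numCand appendItem

def weighItems : Program :=
  .for itemVar numItem <|
    .seq (.rset weightArr (.var itemVar) (.const 0)) <|
    .for candVar numCand <|
      .guard [.nle (.const 1) (.get comArr (.add (.get addrArr (.var itemVar)) (.var candVar)))] <|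
        .rset weightArr (.var itemVar)
          (.add (.get weightArr (.var itemVar)) (.get scoreArr (.var candVar)))

/-- Find the number of rounds to play. -/
def setRounds : Program :=
  .loop (.rlt (.mul (.ofNat (.var numRound)) (.mul (.var fineReg) (.var fineReg)))
      (.ofNat (.var numItem))) <|
    .nset numRound (.const 0) (.add (.var numRound) (.const 1))

/-- Tabulate the addresses of the rows of two-dimensional arrays. -/
def setBases : Program :=
  .seq (.nset strideReg (.const 0) (.add (.var numVoter) (.var numItem))) <|
  .seq (.nset limitReg (.const 0) (.add (.var numVoter) (.var numRound))) <|
  .seq (.nset baseArr (.const 0) (.const 0)) <|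
  .for cellVar limitReg <|
    .nset baseArr (.add (.var cellVar) (.const 1))
      (.add (.get baseArr (.var cellVar)) (.var strideReg))

/-- The rank of an item is the number of items to which the voter weakly prefers it. -/
def rankItems : Program :=
  .for voterVar numVoter <|
    .for itemVar numItem <|
      .seq (.nset rankArr (.addr voterVar itemVar) (.const 0)) <|
      .for itemVarB numItem <|
        .guard [.query (.var voterVar) comArr (.get addrArr (.var itemVar))
          comArr (.get addrArr (.var itemVarB))] <|
          .nset rankArr (.addr voterVar itemVar)
            (.add (.cell rankArr voterVar itemVar) (.const 1))

/-- Put the light candidates into the output. -/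
def addLight : Program :=
  .for candVar numCand <|
    .guard [.rle (.get scoreArr (.var candVar)) (.var lowReg)] <|
      .nset outArr (.var candVar) (.const 1)

def activateVoters : Program :=
  .seq (.for voterVar numVoter <| .nset actArr (.var voterVar) (.const 1)) <|
  .nset numAct (.const 0) (.var numVoter)

/-! ### Correctness of the rounding programs -/

variable {m n : ℕ} {P : MonotonePreferences m n} {M : ℕ}

theorem Runs.guard {l : List Test} {c : Program} {σ : State} {Q : State → Prop}
    (h : (∀ b ∈ l, b.Holds P σ) → Runs P M c σ Q) (h' : ¬ (∀ b ∈ l, b.Holds P σ) → Q σ) :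
    Runs P M (.guard l c) σ Q := by
  induction l with
  | nil => exact h (by simp)
  | cons b l ih =>
    refine Runs.branch (fun hb => ih (fun hl => h ?_) fun hl => h' ?_) fun hb => Runs.skip (h' ?_)
    · simpa using ⟨hb, hl⟩
    · exact fun hall => hl fun b hb => hall b (by simp [hb])
    · exact fun hall => hb (hall b (by simp))

/-- The voters that are still active. -/
def State.active (σ : State) : Finset ℕ :=
  (range (σ.nats numVoter 0)).filter fun v => 1 ≤ σ.nats actArr v

/-- The rank table stored in `σ`. -/
def State.rank (σ : State) (v i : ℕ) : ℕ := σ.nats rankArr (σ.nats baseArr v + i)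

theorem Frame.active {c : Program} {σ τ : State} (F : Frame c σ τ)
    (h : numVoter ∉ c.nwrites ∧ actArr ∉ c.nwrites) : τ.active = σ.active := by
  rw [State.active, F.nats _ h.1, F.nats _ h.2, State.active]

theorem Frame.rank {c : Program} {σ τ : State} (F : Frame c σ τ)
    (h : rankArr ∉ c.nwrites ∧ baseArr ∉ c.nwrites) : τ.rank = σ.rank := by
  funext v i
  rw [State.rank, F.nats _ h.1, F.nats _ h.2, State.rank]

theorem runs_computeSurvival (σ : State) (hv : σ.nats numVoter 0 ≤ M) (hN : σ.nats numItem 0 ≤ M) :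
    Runs P M computeSurvival σ fun τ => τ.reals survReg 0 =
      survival σ.active (σ.nats numItem 0) σ.rank (σ.reals playArr) (σ.reals fracArr) := by
  have F := Frame.refl computeSurvival σ
  rw [State.active, survival, sum_filter]
  refine Runs.seq (Q := fun τ => τ.reals survReg 0 = 0) (Runs.rset (by simp)) fun σ₁ f₁ h₁ => ?_
  replace F := F.then f₁ (by decide)
  rw [← F.nats numVoter (by decide)]
  refine Runs.for (fun k τ => τ.reals survReg 0 = ∑ v ∈ range k, if 1 ≤ σ.nats actArr v then
      ∑ i ∈ range (σ.nats numItem 0), σ.reals playArr i * surviveProd (σ.nats numItem 0)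
        (σ.rank v) (σ.reals fracArr) i else 0)
    (by decide) (by decide) (by rwa [F.nats numVoter (by decide)])
    (by simpa using h₁) fun v hv τ hτv f h => ?_
  replace F := F.then f (by decide)
  simp only [State.setNat, sum_range_succ, ← h]
  refine Runs.guard (fun hb => ?_) fun hb => ?_
  swap
  · simp (disch := decide) only [F.nats, List.mem_singleton, Test.Holds, NExp.eval, forall_eq,
      hτv] at hb
    simp [hb]
  · simp (disch := decide) only [F.nats, List.mem_singleton, Test.Holds, NExp.eval, forall_eq,
      hτv] at hb
    rw [if_pos hb, ← F.nats numItem (by decide)]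
    refine Runs.for (fun k υ => υ.reals survReg 0 = τ.reals survReg 0 +
      ∑ i ∈ range k, σ.reals playArr i * surviveProd (τ.nats numItem 0)
        (σ.rank v) (σ.reals fracArr) i)
      (by decide) (by decide) (by rwa [F.nats numItem (by decide)])
      (by simp) fun i hi υ hυi f₂ h₂ => ?_
    replace F := F.then f₂ (by decide)
    have hυv : υ.nats voterVar 0 = v := by rw [f₂.nats voterVar (by decide), hτv]
    simp only [State.setNat, sum_range_succ, ← add_assoc, ← h₂]
    refine Runs.seq (Q := fun φ => φ.reals prodReg 0 = σ.reals playArr i) (Runs.rset ?_) ?_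
    · simp (disch := decide) [F.reals, hυi]
    intro φ f₃ h₃
    replace F := F.then f₃ (by decide)
    refine Runs.seq (Q := fun ψ => ψ.reals prodReg 0 = σ.reals playArr i *
      surviveProd (φ.nats numItem 0) (σ.rank v) (σ.reals fracArr) i) ?_ ?_
    · refine Runs.for (fun k ψ => ψ.reals prodReg 0 = σ.reals playArr i *
        ∏ j ∈ range k, if σ.rank v i ≤ σ.rank v j then 1 - σ.reals fracArr j else 1)
        (by decide) (by decide) (by rwa [F.nats numItem (by decide)])
        (by simpa using h₃) fun j hj ψ hψj f₄ h₄ => ?_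
      replace F := F.then f₄ (by decide)
      have hψv : ψ.nats voterVar 0 = v := by
        rw [f₄.nats voterVar (by decide), f₃.nats voterVar (by decide), hυv]
      have hψi : ψ.nats itemVarB 0 = i := by
        rw [f₄.nats itemVarB (by decide), f₃.nats itemVarB (by decide), hυi]
      have e : ∀ i, ψ.nats rankArr (ψ.nats baseArr v + i) = σ.rank v i := fun i => by
        rw [F.nats rankArr (by decide), F.nats baseArr (by decide), State.rank]
      simp only [State.setNat, prod_range_succ, ← mul_assoc, ← h₄]
      refine Runs.guard (fun hb => Runs.rset ?_) fun hb => ?_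
      · simp only [List.mem_singleton, Test.Holds, NExp.eval, forall_eq, hψv, hψi, hψj, e] at hb
        simp [hb, hψj, F.reals fracArr (by decide)]
      · simp only [List.mem_singleton, Test.Holds, NExp.eval, forall_eq, hψv, hψi, hψj, e] at hb
        simp [hb]
    · intro ψ f₅ h₅
      refine Runs.rset ?_
      simp [h₅, f₅.reals survReg (by decide), f₃.reals survReg (by decide),
        f₃.nats numItem (by decide), f₂.nats numItem (by decide)]

theorem runs_setMin (σ : State) (d : ℕ) (e f : RExp)
    (hf : f.eval (σ.setReal d 0 (e.eval σ)) = f.eval σ) :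
    Runs P M (setMin d e f) σ fun τ => τ.reals d 0 = min (e.eval σ) (f.eval σ) := by
  refine Runs.seq (Q := fun τ => τ = σ.setReal d 0 (e.eval σ)) (Runs.rset rfl) ?_
  rintro _ _ rfl
  refine Runs.guard (fun hb => Runs.rset ?_) fun hb => ?_
  · simp only [List.mem_singleton, Test.Holds, forall_eq, hf] at hb
    simp only [NExp.eval, hf]
    simpa using hb
  · simp only [List.mem_singleton, Test.Holds, forall_eq, hf] at hb
    simp only [RExp.eval, State.setReal, Function.update_self, NExp.eval, not_le] at hb ⊢
    rw [min_eq_left hb.le]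

/-- The stored array has to agree with `x` only away from `p` and `j`, as it may hold the result of
the other trial shift. -/
theorem runs_applyShift (σ : State) (d p j : ℕ) (x : ℕ → ℝ) (hd : d ≠ fracArr)
    (hp : σ.nats pivotReg 0 = p) (hj : σ.nats itemVar 0 = j) (hpj : p ≠ j)
    (hx : ∀ k, k ≠ p → k ≠ j → σ.reals fracArr k = x k) (hxp : σ.reals savePivot 0 = x p)
    (hxj : σ.reals saveItem 0 = x j) :
    Runs P M (applyShift d) σ fun τ =>
      τ.reals fracArr = shiftMass (σ.reals weightArr) x p j (σ.reals d 0) := by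
  refine Runs.seq (Q := fun τ => τ = σ.setReal fracArr p
    (x p + σ.reals d 0 / σ.reals weightArr p)) (Runs.rset (by simp [hp, hxp])) ?_
  rintro _ _ rfl
  refine Runs.rset ?_
  funext k
  by_cases hkj : k = j
  · simp [shiftMass, hkj, hj, hxj, hd]
  · by_cases hkp : k = p
    · subst hkp
      simp [shiftMass, hkj, hj]
    · simp [shiftMass, hkj, hkp, hj, hx k hkp hkj]

theorem runs_prepareMove (σ : State) :
    Runs P M prepareMove σ fun τ =>
      τ.reals savePivot 0 = σ.reals fracArr (σ.nats pivotReg 0) ∧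
      τ.reals saveItem 0 = σ.reals fracArr (σ.nats itemVar 0) ∧
      τ.reals upReg 0 = shiftUp (σ.reals weightArr) (σ.reals fracArr)
        (σ.nats pivotReg 0) (σ.nats itemVar 0) ∧
      τ.reals downReg 0 = shiftDown (σ.reals weightArr) (σ.reals fracArr)
        (σ.nats pivotReg 0) (σ.nats itemVar 0) := by
  refine Runs.seq (Q := fun τ => τ = σ.setReal savePivot 0 (σ.reals fracArr (σ.nats pivotReg 0)))
    (Runs.rset (by simp)) ?_
  rintro _ - rfl
  refine Runs.seq (Q := fun τ => τ = (σ.setReal savePivot 0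
    (σ.reals fracArr (σ.nats pivotReg 0))).setReal saveItem 0
    (σ.reals fracArr (σ.nats itemVar 0))) (Runs.rset (by simp)) ?_
  rintro _ - rfl
  refine Runs.seq (runs_setMin _ _ _ _ (by simp)) fun σ₂ f₂ h₂ => ?_
  refine Runs.seq (runs_setMin _ _ _ _ (by simp)) fun σ₃ f₃ h₃ => ?_
  refine Runs.rset ?_
  simp (disch := decide) [f₃.reals, f₂.reals, f₂.nats, h₃, h₂, shiftUp, shiftDown]

theorem runs_moveMass (σ : State) (hv : σ.nats numVoter 0 ≤ M) (hN : σ.nats numItem 0 ≤ M)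
    (w x : ℕ → ℝ) (p j : ℕ) (S : (ℕ → ℝ) → ℝ) (hw : σ.reals weightArr = w)
    (hx : σ.reals fracArr = x) (hp : σ.nats pivotReg 0 = p) (hj : σ.nats itemVar 0 = j)
    (hpj : p ≠ j)
    (hS : S = survival σ.active (σ.nats numItem 0) σ.rank (σ.reals playArr)) :
    Runs P M moveMass σ fun τ => ∃ d, (d = shiftUp w x p j ∨ d = shiftDown w x p j) ∧
      τ.reals fracArr = shiftMass w x p j d ∧
      S (shiftMass w x p j d) ≤ S (shiftMass w x p j (shiftUp w x p j)) ∧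
      S (shiftMass w x p j d) ≤ S (shiftMass w x p j (shiftDown w x p j)) := by
  have F := Frame.refl moveMass σ
  have hSF : ∀ {τ : State}, Frame moveMass σ τ → survival τ.active (τ.nats numItem 0) τ.rank
      (τ.reals playArr) (τ.reals fracArr) = S (τ.reals fracArr) := fun {τ} F => by
    rw [hS]
    rw [F.active (by decide), F.rank (by decide), F.nats numItem (by decide),
      F.reals playArr (by decide)]
  refine Runs.seq (runs_prepareMove σ) fun σ₁ f₁ ⟨a₁, a₂, a₃, a₄⟩ => ?_
  rw [hx, hp] at a₁
  rw [hx, hj] at a₂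
  rw [hw, hx, hp, hj] at a₃ a₄
  replace F := F.then f₁ (by decide)
  have b₁ : σ₁.reals fracArr = x := by rw [f₁.reals fracArr (by decide), hx]
  have hwF : ∀ {τ : State}, Frame moveMass σ τ → τ.reals weightArr = w := fun F => by
    rw [F.reals weightArr (by decide), hw]
  have hpF : ∀ {τ : State}, Frame moveMass σ τ → τ.nats pivotReg 0 = p := fun F => by
    rw [F.nats pivotReg (by decide), hp]
  have hjF : ∀ {τ : State}, Frame moveMass σ τ → τ.nats itemVar 0 = j := fun F => by
    rw [F.nats itemVar (by decide), hj]
  refine Runs.seq (runs_applyShift σ₁ _ p j x (by decide) (hpF F) (hjF F) hpj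
    (fun k _ _ => by rw [b₁]) a₁ a₂) fun σ₂ f₂ h₂ => ?_
  rw [hwF F, a₃] at h₂
  replace F := F.then f₂ (by decide)
  refine Runs.seq (runs_computeSurvival σ₂ (by rwa [F.nats numVoter (by decide)])
    (by rwa [F.nats numItem (by decide)])) fun σ₃ f₃ h₃ => ?_
  rw [hSF F, h₂] at h₃
  replace F := F.then f₃ (by decide)
  refine Runs.seq (Q := fun τ => τ.reals upSurv 0 = S (shiftMass w x p j (shiftUp w x p j)))
    (Runs.rset (by simp [h₃])) fun σ₄ f₄ h₄ => ?_
  replace F := F.then f₄ (by decide)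
  rw [← f₃.reals fracArr (by decide), ← f₄.reals fracArr (by decide)] at h₂
  refine Runs.seq (runs_applyShift σ₄ _ p j x (by decide) (hpF F) (hjF F) hpj
    (fun k hk hk' => by rw [h₂, shiftMass_of_ne _ _ _ hk hk'])
    (by simp (disch := decide) only [f₄.reals, f₃.reals, f₂.reals, a₁])
    (by simp (disch := decide) only [f₄.reals, f₃.reals, f₂.reals, a₂])) fun σ₅ f₅ h₅ => ?_
  rw [hwF F, show σ₄.reals downReg 0 = _ by
    simp (disch := decide) only [f₄.reals, f₃.reals, f₂.reals]; exact a₄] at h₅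
  replace F := F.then f₅ (by decide)
  refine Runs.seq (runs_computeSurvival σ₅ (by rwa [F.nats numVoter (by decide)])
    (by rwa [F.nats numItem (by decide)])) fun σ₆ f₆ h₆ => ?_
  rw [hSF F, h₅] at h₆
  replace F := F.then f₆ (by decide)
  rw [← f₆.reals fracArr (by decide)] at h₅
  rw [← f₅.reals upSurv (by decide), ← f₆.reals upSurv (by decide)] at h₄
  refine Runs.guard (fun hb => ?_) fun hb => ?_
  · simp only [List.mem_singleton, Test.Holds, forall_eq, RExp.eval, NExp.eval, h₄, h₆] at hb
    refine (runs_applyShift σ₆ _ p j x (by decide) (hpF F) (hjF F) hpj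
      (fun k hk hk' => by rw [h₅, shiftMass_of_ne _ _ _ hk hk'])
      (by simp (disch := decide) only [f₆.reals, f₅.reals, f₄.reals, f₃.reals, f₂.reals, a₁])
      (by simp (disch := decide) only [f₆.reals, f₅.reals, f₄.reals, f₃.reals, f₂.reals, a₂])).mono
      fun τ _ h => ⟨_, .inl rfl, ?_, le_rfl, hb⟩
    rw [h, hwF F, show σ₆.reals upReg 0 = _ by
      simp (disch := decide) only [f₆.reals, f₅.reals, f₄.reals, f₃.reals, f₂.reals]; exact a₃]
  · simp only [List.mem_singleton, Test.Holds, forall_eq, RExp.eval, NExp.eval, h₄, h₆,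
      not_le] at hb
    exact ⟨_, .inr rfl, h₅, hb.le, le_rfl⟩

theorem runs_roundingStep (σ : State) (hv : σ.nats numVoter 0 ≤ M) (hN : σ.nats numItem 0 ≤ M)
    (B S : ℝ) (hy : ∀ i < σ.nats numItem 0, 0 ≤ σ.reals playArr i)
    (hk : σ.nats itemVar 0 < σ.nats numItem 0)
    (h : RoundingInv σ.active (σ.nats numItem 0) σ.rank (σ.reals playArr) (σ.reals weightArr) B S
      (σ.nats itemVar 0) (σ.nats pivotReg 0) (σ.reals fracArr)) :
    Runs P M roundingStep σ fun τ =>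
      RoundingInv σ.active (σ.nats numItem 0) σ.rank (σ.reals playArr) (σ.reals weightArr) B S
        (σ.nats itemVar 0 + 1) (τ.nats pivotReg 0) (τ.reals fracArr) := by
  set k := σ.nats itemVar 0 with hk'
  set p := σ.nats pivotReg 0 with hp'
  -- After the guarded move, the pivot or the current item is integral, or the current item is
  -- itself the pivot. If the guard fails, this disjunction is the negation of its tests.
  refine Runs.seq (Q := fun τ => RoundingInv σ.active (σ.nats numItem 0) σ.rank (σ.reals playArr)
    (σ.reals weightArr) B S k p (τ.reals fracArr) ∧
    ((τ.reals fracArr p ≤ 0 ∨ 1 ≤ τ.reals fracArr p) ∨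
      (τ.reals fracArr k ≤ 0 ∨ 1 ≤ τ.reals fracArr k ∨ ¬ p < k))) ?_ fun τ f ⟨h₁, h₂⟩ => ?_
  · refine Runs.guard (fun hb => ?_) fun hb => ⟨h, ?_⟩
    · simp only [List.forall_mem_cons, List.not_mem_nil, false_imp_iff, implies_true, and_true,
        Test.Holds, RExp.eval, NExp.eval, ← hk', ← hp', not_le, Nat.cast_zero, Nat.cast_one] at hb
      obtain ⟨b₁, b₂, b₃, b₄, b₅⟩ := hb
      have hsh := survival_shift_le σ.active (σ.nats numItem 0) σ.rank (σ.reals playArr)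
        (σ.reals weightArr) (σ.reals fracArr) (b₁.trans hk) hk b₁.ne hy
        (fun i hi => (h.bounds i hi).2) (h.support p (b₁.trans hk) b₂).1 (h.support k hk b₄).1
        b₂ b₃ b₄ b₅
      refine (runs_moveMass σ hv hN _ _ p k _ rfl rfl rfl rfl b₁.ne rfl).mono ?_
      rintro τ - ⟨d, hd, hτ, hs₁, hs₂⟩
      rw [hτ]
      have := h.shift hk b₁ b₂ b₃ b₄ b₅ hd (hsh.elim hs₁.trans hs₂.trans)
      exact ⟨this.1, this.2.imp_right fun h => h.imp_right .inl⟩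
    · simp only [List.forall_mem_cons, List.not_mem_nil, false_imp_iff, implies_true, and_true,
        Test.Holds, RExp.eval, NExp.eval, ← hk', ← hp', not_le, Nat.cast_zero, Nat.cast_one] at hb
      by_contra! hcon
      exact hb ⟨hcon.2.2.2, hcon.1.1, hcon.1.2, hcon.2.1, hcon.2.2.1⟩
  · have hτp : τ.nats pivotReg 0 = p := by rw [f.nats pivotReg (by decide)]
    have hτk : τ.nats itemVar 0 = k := by rw [f.nats itemVar (by decide)]
    refine Runs.branch (fun hb => Runs.nset ?_) fun hb => Runs.guard (fun hb' => Runs.nset ?_)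
      fun hb' => ?_
    · simp only [Test.Holds, RExp.eval, NExp.eval, hτp, Nat.cast_zero] at hb
      simpa [hτk] using h₁.advance_pivot (.inl hb)
    · simp only [Test.Holds, RExp.eval, NExp.eval, hτp, List.mem_singleton, forall_eq,
        Nat.cast_one] at hb'
      simpa [hτk] using h₁.advance_pivot (.inr hb')
    · simp only [Test.Holds, RExp.eval, NExp.eval, hτp, List.mem_singleton, forall_eq,
        Nat.cast_one, Nat.cast_zero] at hb hb'
      rw [hτp]
      exact h₁.advance (h₂.resolve_left fun h => h.elim hb hb')

/-! ### Correctness of regret matching -/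

/-- The play of regret matching for item `i`. -/
noncomputable def regretPlay (low half : ℝ) (w G : ℕ → ℝ) (i : ℕ) : ℝ :=
  if low < w i ∧ w i ≤ half then max (G i) 0 else 0

theorem runs_computePlay (σ : State) (hN : σ.nats numItem 0 ≤ M) (y w : ℕ → ℝ)
    (hw : σ.reals weightArr = w)
    (hy : y = regretPlay (σ.reals lowReg 0) (σ.reals halfReg 0) w (σ.reals regretArr)) :
    Runs P M computePlay σ fun τ => (∀ i < σ.nats numItem 0, τ.reals playArr i = y i) ∧
      τ.reals meanReg 0 = ∑ i ∈ range (σ.nats numItem 0), y i * w i := by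
  have F := Frame.refl computePlay σ
  refine Runs.seq (Q := fun τ => τ.reals meanReg 0 = 0) (Runs.rset (by simp)) fun σ₁ f₁ h₁ => ?_
  replace F := F.then f₁ (by decide)
  rw [← F.nats numItem (by decide)]
  refine Runs.for (fun k τ => (∀ i < k, τ.reals playArr i = y i) ∧
    τ.reals meanReg 0 = ∑ i ∈ range k, y i * w i) (by decide) (by decide)
    (by rwa [F.nats numItem (by decide)]) (by simp [h₁]) fun i hi τ hτi f ⟨h₂, h₃⟩ => ?_
  replace F := F.then f (by decide)
  refine Runs.seq (Q := fun υ => υ.reals playArr = Function.update (τ.reals playArr) i 0)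
    (Runs.rset (by simp [hτi])) fun υ f₄ h₄ => ?_
  replace F := F.then f₄ (by decide)
  have hυi : υ.nats itemVar 0 = i := by rw [f₄.nats itemVar (by decide), hτi]
  refine Runs.seq (Q := fun φ => φ.reals playArr = Function.update (τ.reals playArr) i (y i))
    (Runs.guard (fun hb => Runs.rset ?_) fun hb => ?_) fun φ f₅ h₅ => Runs.rset ?_
  · simp (disch := decide) only [List.forall_mem_cons, List.not_mem_nil, false_imp_iff,
      implies_true, and_true, Test.Holds, RExp.eval, NExp.eval, not_le, Nat.cast_zero, hυi,
      F.reals, hw] at hb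
    simp (disch := decide) only [RExp.eval, NExp.eval, hυi, F.reals, State.setReal, h₄,
      Function.update_self, Function.update_idem]
    rw [hy, regretPlay, if_pos ⟨hb.1, hb.2.1⟩, max_eq_left hb.2.2.le]
  · simp (disch := decide) only [List.forall_mem_cons, List.not_mem_nil, false_imp_iff,
      implies_true, and_true, Test.Holds, RExp.eval, NExp.eval, not_le, Nat.cast_zero, hυi,
      F.reals, hw] at hb
    rw [h₄, hy, regretPlay]
    split_ifs with h
    · rw [max_eq_right (le_of_not_gt fun h0 => hb ⟨h.1, h.2, h0⟩)]
    · rfl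
  · replace F := F.then f₅ (by decide)
    have hφi : φ.nats itemVar 0 = i := by rw [f₅.nats itemVar (by decide), hυi]
    refine ⟨fun a ha => ?_, ?_⟩
    · by_cases hai : a = i
      · simp [h₅, hai]
      · simp [h₅, hai, h₂ a (by omega)]
    · simp (disch := decide) [h₅, hφi, F.reals, hw, sum_range_succ, ← h₃, f₅.reals, f₄.reals]

theorem runs_computeFrac (σ : State) (hN : σ.nats numItem 0 ≤ M) :
    Runs P M computeFrac σ fun τ => ∀ i < σ.nats numItem 0, τ.reals fracArr i =
      min 1 (σ.reals playArr i * (σ.reals halfReg 0 / σ.reals meanReg 0)) := by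
  refine Runs.for (fun k τ => ∀ i < k, τ.reals fracArr i =
      min 1 (σ.reals playArr i * (σ.reals halfReg 0 / σ.reals meanReg 0))) (by decide) (by decide)
    hN (by simp) fun i hi τ hτi f h => ?_
  refine Runs.seq (Q := fun υ => υ.reals fracArr = Function.update (τ.reals fracArr) i
      (σ.reals playArr i * (σ.reals halfReg 0 / σ.reals meanReg 0)))
    (Runs.rset (by simp (disch := decide) [hτi, f.reals])) fun υ f₁ h₁ => ?_
  have hυi : υ.nats itemVar 0 = i := by rw [f₁.nats itemVar (by decide), hτi]
  refine Runs.guard (fun hb => Runs.rset ?_) fun hb => ?_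
  all_goals
    simp only [List.mem_singleton, Test.Holds, forall_eq, RExp.eval, NExp.eval, hυi, h₁,
      Function.update_self, Nat.cast_one] at hb
    intro a ha
    by_cases hai : a = i
  · simp [hυi, hai, hb]
  · simp [hυi, hai, h₁, h a (by omega)]
  · simp [hai, h₁, le_of_not_ge hb]
  · simp [hai, h₁, h a (by omega)]

theorem runs_roundItems (σ : State) (hv : σ.nats numVoter 0 ≤ M) (hN : σ.nats numItem 0 ≤ M)
    (B S : ℝ) (hy : ∀ i < σ.nats numItem 0, 0 ≤ σ.reals playArr i)
    (h : RoundingInv σ.active (σ.nats numItem 0) σ.rank (σ.reals playArr) (σ.reals weightArr) B S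
      0 0 (σ.reals fracArr)) :
    Runs P M roundItems σ fun τ => ∃ p,
      RoundingInv σ.active (σ.nats numItem 0) σ.rank (σ.reals playArr) (σ.reals weightArr) B S
        (σ.nats numItem 0) p (τ.reals fracArr) := by
  have F := Frame.refl roundItems σ
  refine Runs.seq (Q := fun τ => τ.nats pivotReg 0 = 0) (Runs.nset (by simp)) fun σ₁ f₁ h₁ => ?_
  replace F := F.then f₁ (by decide)
  refine (Runs.for (fun k τ => RoundingInv σ.active (σ.nats numItem 0) σ.rank (σ.reals playArr)
    (σ.reals weightArr) B S k (τ.nats pivotReg 0) (τ.reals fracArr)) (by decide) (by decide)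
    (by rwa [F.nats numItem (by decide)]) ?_ fun k hk τ hτk f h₂ => ?_).mono ?_
  · simpa [h₁, f₁.reals fracArr (by decide)] using h
  · replace F := F.then f (by decide)
    have e1 := F.active (by decide)
    have e2 := F.rank (by decide)
    have e3 := F.nats numItem (by decide)
    have e4 := F.reals playArr (by decide)
    have e5 := F.reals weightArr (by decide)
    have e6 := f₁.nats numItem (by decide)
    have := runs_roundingStep (P := P) (M := M) τ (by rwa [F.nats numVoter (by decide)])
      (by rwa [e3]) B S (by rwa [e3, e4]) (by rwa [hτk, e3, ← e6])
      (by rwa [e1, e2, e3, e4, e5, hτk])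
    rw [e1, e2, e3, e4, e5, hτk] at this
    exact this.mono fun υ _ h => by simpa using h
  · intro τ _ h
    rw [f₁.nats numItem (by decide)] at h
    exact ⟨_, h⟩

/-- The value of a round is one more than the best rank, and 0 if nothing was chosen. A voter thus
ranks `i` above everything chosen iff the value is at most the rank of `i`. Rows of earlier rounds
lie at smaller addresses and survive. -/
theorem runs_recordValues (σ : State) (hv : σ.nats numVoter 0 ≤ M) (hN : σ.nats numItem 0 ≤ M)
    (r : ℕ) (hr : σ.nats roundVar 0 = r) (D : Finset ℕ)
    (hD : D = (range (σ.nats numItem 0)).filter fun i => 0 < σ.reals fracArr i) :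
    Runs P M recordValues σ fun τ =>
      (∀ v < σ.nats numVoter 0,
        τ.nats valArr (σ.nats baseArr r + v) = D.sup fun i => σ.rank v i + 1) ∧
      ∀ a < σ.nats baseArr r, τ.nats valArr a = σ.nats valArr a := by
  refine Runs.for (fun k τ => (∀ v < k,
        τ.nats valArr (σ.nats baseArr r + v) = D.sup fun i => σ.rank v i + 1) ∧
      ∀ a < σ.nats baseArr r, τ.nats valArr a = σ.nats valArr a) (by decide) (by decide)
    hv (by simp) fun v hv τ hτv f ⟨h₁, h₂⟩ => ?_
  refine Runs.seq (Q := fun υ => υ.nats valArr =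
    Function.update (τ.nats valArr) (σ.nats baseArr r + v) 0)
    (Runs.nset (by simp (disch := decide) [hτv, f.nats, hr])) fun υ f₁ h₃ => ?_
  have F := f.then f₁ (by decide)
  refine (Runs.for (fun k φ => φ.nats valArr = Function.update (τ.nats valArr)
    (σ.nats baseArr r + v) (((range k).filter fun i => 0 < σ.reals fracArr i).sup
      fun i => σ.rank v i + 1)) (by decide) (by decide) (by rwa [F.nats numItem (by decide)])
      (by simpa using h₃) fun i hi φ hφi f₂ h₄ => ?_).mono fun φ f₂ h₄ => ?_
  · replace F := F.then f₂ (by decide)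
    have hφv : φ.nats voterVar 0 = v := by
      rw [f₂.nats voterVar (by decide), f₁.nats voterVar (by decide), hτv]
    have eb := F.nats baseArr (by decide)
    have e : φ.nats rankArr (σ.nats baseArr v + i) = σ.rank v i := by
      rw [F.nats rankArr (by decide), State.rank]
    have hr' : φ.nats roundVar 0 = r := by rw [F.nats roundVar (by decide), hr]
    rw [range_add_one, filter_insert]
    refine Runs.guard (fun hb => Runs.nset ?_) fun hb => ?_
    all_goals
      simp (disch := decide) only [List.forall_mem_cons, List.not_mem_nil, false_imp_iff,
        implies_true, and_true, Test.Holds, RExp.eval, NExp.eval, not_le, Nat.cast_zero, hφi, hφv,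
        F.reals, eb, e, h₄, hr', Function.update_self] at hb
    · rw [if_pos hb.1, sup_insert, sup_eq_left.2 (by omega)]
      simp [hr', hφv, hφi, e, h₄, eb]
    · simp only [State.setNat]
      rw [Function.update_of_ne (by decide), h₄]
      split_ifs with h
      · rw [sup_insert, sup_eq_right.2 (Nat.succ_le_of_lt (not_le.1 fun h' => hb ⟨h, h'⟩))]
      · rfl
  · rw [F.nats numItem (by decide), ← hD] at h₄
    refine ⟨fun a ha => ?_, fun a ha => ?_⟩
    · by_cases hav : a = v
      · simp [h₄, hav]
      · simp [h₄, hav, h₁ a (by omega)]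
    · have : a ≠ σ.nats baseArr r + v := by omega
      simp [h₄, this, h₂ a ha]

theorem runs_countBeats (σ : State) (hv : σ.nats numVoter 0 ≤ M) (D : Finset ℕ)
    (hD : ∀ v < σ.nats numVoter 0, σ.nats valArr (σ.nats baseArr (σ.nats roundVar 0) + v) =
      D.sup fun i => σ.rank v i + 1) :
    Runs P M countBeats σ fun τ => τ.nats countReg 0 =
      beats σ.active σ.rank D (σ.nats itemVar 0) := by
  have F := Frame.refl countBeats σ
  refine Runs.seq (Q := fun τ => τ.nats countReg 0 = 0) (Runs.nset (by simp)) fun σ₁ f₁ h₁ => ?_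
  replace F := F.then f₁ (by decide)
  have hb : beats σ.active σ.rank D (σ.nats itemVar 0) = ((range (σ₁.nats numVoter 0)).filter
      fun v => 1 ≤ σ.nats actArr v ∧ σ.nats valArr (σ.nats baseArr (σ.nats roundVar 0) + v) ≤
        σ.rank v (σ.nats itemVar 0)).card := by
    rw [beats, State.active, filter_filter, F.nats numVoter (by decide)]
    congr 1
    refine filter_congr fun v hv => ?_
    rw [hD v (mem_range.1 hv), Finset.sup_le_iff]
    rfl
  rw [hb]
  refine Runs.for (fun k τ => τ.nats countReg 0 = ((range k).filter
      fun v => 1 ≤ σ.nats actArr v ∧ σ.nats valArr (σ.nats baseArr (σ.nats roundVar 0) + v) ≤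
        σ.rank v (σ.nats itemVar 0)).card) (by decide) (by decide)
    (by rwa [F.nats numVoter (by decide)]) (by simp [h₁]) fun v hv τ hτv f h => ?_
  replace F := F.then f (by decide)
  rw [range_add_one, filter_insert]
  refine Runs.guard (fun hb => Runs.nset ?_) fun hb => ?_
  all_goals
    simp (disch := decide) only [List.forall_mem_cons, List.not_mem_nil, false_imp_iff,
      implies_true, and_true, Test.Holds, NExp.eval, F.nats] at hb
    rw [hτv, ← State.rank] at hb
  · rw [if_pos hb, card_insert_of_notMem (by simp)]
    simp [h]
  · rw [if_neg hb]
    simpa using h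

theorem runs_recordItems (σ : State) (hv : σ.nats numVoter 0 ≤ M) (hN : σ.nats numItem 0 ≤ M)
    (r : ℕ) (hr : σ.nats roundVar 0 = r) (D : Finset ℕ)
    (hD : D = (range (σ.nats numItem 0)).filter fun i => 0 < σ.reals fracArr i)
    (hval : ∀ v < σ.nats numVoter 0, σ.nats valArr (σ.nats baseArr r + v) =
      D.sup fun i => σ.rank v i + 1) :
    Runs P M recordItems σ fun τ =>
      (∀ i < σ.nats numItem 0, 1 ≤ τ.nats selArr (σ.nats baseArr r + i) ↔ i ∈ D) ∧
      (∀ a < σ.nats baseArr r, τ.nats selArr a = σ.nats selArr a) ∧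
      ∀ i < σ.nats numItem 0, τ.reals regretArr i = σ.reals regretArr i +
        (beats σ.active σ.rank D i -
          σ.reals weightArr i * (σ.nats numAct 0 / σ.reals halfReg 0)) := by
  refine (Runs.for (fun k τ =>
      (∀ i < k, 1 ≤ τ.nats selArr (σ.nats baseArr r + i) ↔ i ∈ D) ∧
      (∀ a < σ.nats baseArr r, τ.nats selArr a = σ.nats selArr a) ∧
      ∀ i, τ.reals regretArr i = if i < k then σ.reals regretArr i +
        (beats σ.active σ.rank D i -
          σ.reals weightArr i * (σ.nats numAct 0 / σ.reals halfReg 0)) else σ.reals regretArr i)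
      (by decide) (by decide) hN (by simp) fun i hi τ hτi F ⟨h₁, h₂, h₃⟩ => ?_).mono ?_
  · have eb := F.nats baseArr (by decide)
    have er : τ.nats roundVar 0 = r := by rw [F.nats roundVar (by decide), hr]
    refine Runs.seq (Q := fun υ => υ.nats selArr = Function.update (τ.nats selArr)
      (σ.nats baseArr r + i) (if i ∈ D then 1 else 0)) (Runs.branch
      (fun hb => Runs.nset ?_) fun hb => Runs.nset ?_) fun υ f₄ h₄ => ?_
    · simp only [Test.Holds, RExp.eval, NExp.eval, hτi, F.reals fracArr (by decide),
        Nat.cast_zero] at hb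
      have : i ∉ D := fun h => by
        rw [hD] at h
        exact absurd (mem_filter.1 h).2 (not_lt.2 hb)
      simp [this, eb, er, hτi]
    · simp only [Test.Holds, RExp.eval, NExp.eval, hτi, F.reals fracArr (by decide),
        Nat.cast_zero, not_le] at hb
      have : i ∈ D := hD ▸ mem_filter.2 ⟨mem_range.2 hi, hb⟩
      simp [this, eb, er, hτi]
    have F₁ := F.then f₄ (by decide)
    have e₁ := F₁.active (by decide)
    have e₂ := F₁.rank (by decide)
    have e₃ := F₁.nats numVoter (by decide)
    have er₁ : υ.nats roundVar 0 = r := by rw [F₁.nats roundVar (by decide), hr]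
    have ei₁ : υ.nats itemVar 0 = i := by rw [f₄.nats itemVar (by decide), hτi]
    have hc := runs_countBeats (P := P) (M := M) υ (by rwa [e₃]) D (by
      rw [e₂, e₃, er₁, F₁.nats valArr (by decide), F₁.nats baseArr (by decide)]
      exact hval)
    rw [e₁, e₂, ei₁] at hc
    refine Runs.seq hc fun φ f₅ h₅ => Runs.rset ?_
    have F₂ := F₁.then f₅ (by decide)
    have ei₂ : φ.nats itemVar 0 = i := by rw [f₅.nats itemVar (by decide), ei₁]
    refine ⟨fun a ha => ?_, fun a ha => ?_, fun a => ?_⟩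
    · by_cases hai : a = i
      · by_cases hiD : i ∈ D <;> simp [f₅.nats selArr (by decide), h₄, hai, hiD]
      · simpa [f₅.nats selArr (by decide), h₄, hai] using h₁ a (by omega)
    · have : a ≠ σ.nats baseArr r + i := by omega
      simp [f₅.nats selArr (by decide), h₄, this, h₂ a ha]
    · by_cases hai : a = i
      · simp (disch := decide) [hai, ei₂, h₅, f₅.reals regretArr, f₄.reals regretArr, h₃,
          F₂.reals weightArr, F₂.reals halfReg, F₂.nats numAct]
      · have : a < i + 1 ↔ a < i := by omega
        simp (disch := decide) [Function.update_of_ne hai, ei₂, f₅.reals regretArr,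
          f₄.reals regretArr, h₃, this]
  · rintro τ - ⟨h₁, h₂, h₃⟩
    exact ⟨h₁, h₂, fun i hi => by rw [h₃, if_pos hi]⟩

/-- The facts that a stage relies on: loop bounds and register contents. -/
structure State.Ready (σ : State) (M : ℕ) : Prop where
  voters : σ.nats numVoter 0 ≤ M
  items : σ.nats numItem 0 ≤ M
  rounds : σ.nats numRound 0 ≤ M
  cands : σ.nats numCand 0 ≤ M
  low : 0 ≤ σ.reals lowReg 0
  half : 0 < σ.reals halfReg 0
  act : σ.nats numAct 0 = σ.active.card
  base : ∀ q r, q < r → r < σ.nats numRound 0 →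
    σ.nats baseArr q + σ.nats numVoter 0 ≤ σ.nats baseArr r ∧
    σ.nats baseArr q + σ.nats numItem 0 ≤ σ.nats baseArr r

/-- The second property of `D` is the condition under which regret matching works: weighted with the
positive regrets, the new regrets sum to at most 0. The other clauses say what is recorded and that
earlier rounds stay untouched. -/
theorem runs_playRound (σ : State) (hσ : σ.Ready M) (r : ℕ) (hr : σ.nats roundVar 0 = r) :
    Runs P M playRound σ fun τ => ∃ D ⊆ range (σ.nats numItem 0),
      ∑ i ∈ D, σ.reals weightArr i ≤ 2 * σ.reals halfReg 0 ∧
      ∑ i ∈ range (σ.nats numItem 0), regretPlay (σ.reals lowReg 0) (σ.reals halfReg 0)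
        (σ.reals weightArr) (σ.reals regretArr) i * (beats σ.active σ.rank D i -
          σ.reals weightArr i * (σ.active.card / σ.reals halfReg 0)) ≤ 0 ∧
      (∀ v < σ.nats numVoter 0,
        τ.nats valArr (σ.nats baseArr r + v) = D.sup fun i => σ.rank v i + 1) ∧
      (∀ a < σ.nats baseArr r, τ.nats valArr a = σ.nats valArr a) ∧
      (∀ i < σ.nats numItem 0, 1 ≤ τ.nats selArr (σ.nats baseArr r + i) ↔ i ∈ D) ∧
      (∀ a < σ.nats baseArr r, τ.nats selArr a = σ.nats selArr a) ∧
      ∀ i < σ.nats numItem 0, τ.reals regretArr i = σ.reals regretArr i +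
        (beats σ.active σ.rank D i -
          σ.reals weightArr i * (σ.active.card / σ.reals halfReg 0)) := by
  have hv := hσ.voters
  have hN := hσ.items
  set N := σ.nats numItem 0 with eN
  set w := σ.reals weightArr with ew
  set B := σ.reals halfReg 0 with eB
  set y := regretPlay (σ.reals lowReg 0) B w (σ.reals regretArr) with ey
  have hy0 : ∀ i, 0 ≤ y i := fun i => by
    rw [ey, regretPlay]
    split_ifs
    exacts [le_max_right _ _, le_rfl]
  have hyw : ∀ i, 0 < y i → 0 < w i ∧ w i ≤ B := fun i hi => by
    rw [ey, regretPlay] at hi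
    split_ifs at hi with h
    · exact ⟨hσ.low.trans_lt h.1, h.2⟩
    · exact absurd hi (lt_irrefl _)
  have F := Frame.refl playRound σ
  refine Runs.seq (runs_computePlay σ hN y w rfl rfl) fun σ₁ f₁ ⟨h₁, h₁'⟩ => ?_
  rw [← eN] at h₁ h₁'
  replace F := F.then f₁ (by decide)
  refine Runs.seq (runs_computeFrac σ₁ (by rwa [F.nats numItem (by decide)])) fun σ₂ f₂ h₂ => ?_
  rw [F.nats numItem (by decide), F.reals halfReg (by decide), ← eN, ← eB] at h₂
  replace F := F.then f₂ (by decide)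
  have hμ : σ₁.reals meanReg 0 = ∑ i ∈ range N, σ₁.reals playArr i * w i := by
    rw [h₁']
    exact sum_congr rfl fun i hi => by rw [h₁ i (mem_range.1 hi)]
  have hp0 : ∀ i < N, 0 ≤ σ₁.reals playArr i := fun i hi => (h₁ i hi).symm ▸ hy0 i
  have hpw : ∀ i < N, 0 < σ₁.reals playArr i → 0 < w i ∧ w i ≤ B := fun i hi h => by
    rw [h₁ i hi] at h
    exact hyw i h
  have hinit := RoundingInv.init (V := σ.active) (R := σ.rank) hσ.half hp0 hpw hμ h₂
  have e₁ := F.active (by decide)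
  have e₂ := F.rank (by decide)
  have e₃ := F.nats numItem (by decide)
  have e₄ := F.nats numVoter (by decide)
  have e₅ := F.reals weightArr (by decide)
  have e₆ := f₂.reals playArr (by decide)
  have hround := runs_roundItems (P := P) (M := M) σ₂ (by rwa [e₄]) (by rwa [e₃]) B
    (survival σ.active N σ.rank (σ₁.reals playArr) (σ₂.reals fracArr)) (by rwa [e₃, e₆])
    (by rwa [e₁, e₂, e₃, e₅, e₆])
  rw [e₁, e₂, e₃, e₅, e₆] at hround
  refine Runs.seq hround fun σ₃ f₃ ⟨p, h₃⟩ => ?_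
  replace F := F.then f₃ (by decide)
  obtain ⟨hwt, hpl⟩ := RoundingInv.result hσ.half hp0 (fun i hi h => (hpw i hi h).1) hμ h₂ h₃
  clear hinit hround
  set D := (range N).filter fun i => 0 < σ₃.reals fracArr i with eD
  have hval := runs_recordValues (P := P) (M := M) σ₃ (by rwa [F.nats numVoter (by decide)])
    (by rwa [F.nats numItem (by decide)]) r (by rw [F.nats roundVar (by decide), hr]) D
    (by rw [F.nats numItem (by decide)])
  rw [F.nats numVoter (by decide), F.nats baseArr (by decide), F.rank (by decide)] at hval
  refine Runs.seq hval fun σ₄ f₄ ⟨h₄, h₄'⟩ => ?_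
  rw [f₃.nats valArr (by decide), f₂.nats valArr (by decide), f₁.nats valArr (by decide)] at h₄'
  replace F := F.then f₄ (by decide)
  have hrec := runs_recordItems (P := P) (M := M) σ₄ (by rwa [F.nats numVoter (by decide)])
    (by rwa [F.nats numItem (by decide)]) r (by rw [F.nats roundVar (by decide), hr]) D
    (by rw [F.nats numItem (by decide), f₄.reals fracArr (by decide)])
    (by rwa [F.nats numVoter (by decide), F.nats baseArr (by decide), F.rank (by decide)])
  simp (disch := decide) only [F.nats numItem, F.nats baseArr, F.rank, F.active, F.nats numAct,
    F.reals weightArr, F.reals halfReg, f₄.nats selArr, f₃.nats selArr, f₂.nats selArr,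
    f₁.nats selArr, f₄.reals regretArr, f₃.reals regretArr, f₂.reals regretArr,
    f₁.reals regretArr] at hrec
  refine hrec.mono fun τ f₅ ⟨h₅, h₆, h₇⟩ => ?_
  rw [← f₅.nats valArr (by decide)] at h₄ h₄'
  refine ⟨D, filter_subset _ _, hwt, le_trans (le_of_eq ?_) hpl, h₄, h₄', h₅, h₆, ?_⟩
  · exact sum_congr rfl fun i hi => by rw [h₁ i (mem_range.1 hi)]
  · rw [← hσ.act]
    exact h₇

/-- What is recorded about round `q`, in which the items in `D` were chosen. -/
structure RoundRecord (σ τ : State) (q : ℕ) (D : Finset ℕ) : Prop where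
  subset : D ⊆ range (σ.nats numItem 0)
  weight : ∑ i ∈ D, σ.reals weightArr i ≤ 2 * σ.reals halfReg 0
  val : ∀ v < σ.nats numVoter 0,
    τ.nats valArr (σ.nats baseArr q + v) = D.sup fun i => σ.rank v i + 1
  sel : ∀ i < σ.nats numItem 0, 1 ≤ τ.nats selArr (σ.nats baseArr q + i) ↔ i ∈ D

/-- The potential is the sum of the squared positive regrets over the admissible items, those of
`E`. It grows by at most `N|V|²` per round and dominates each of its terms. -/
theorem runs_playAll (σ : State) (hσ : σ.Ready M) (g : Finset ℕ → ℕ → ℝ)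
    (hg : g = fun D i => beats σ.active σ.rank D i -
      σ.reals weightArr i * (σ.active.card / σ.reals halfReg 0)) :
    Runs P M playAll σ fun τ => ∃ D : ℕ → Finset ℕ,
      (∀ q < σ.nats numRound 0, RoundRecord σ τ q (D q)) ∧
      ∀ i < σ.nats numItem 0, σ.reals lowReg 0 < σ.reals weightArr i →
        σ.reals weightArr i ≤ σ.reals halfReg 0 →
        max (∑ q ∈ range (σ.nats numRound 0), g (D q) i) 0 ^ 2 ≤
          σ.nats numRound 0 * (σ.nats numItem 0 * σ.active.card ^ 2) := by
  set N := σ.nats numItem 0 with hN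
  set T := σ.nats numRound 0 with hT
  set E := (range N).filter fun i =>
    σ.reals lowReg 0 < σ.reals weightArr i ∧ σ.reals weightArr i ≤ σ.reals halfReg 0 with hE
  have F := Frame.refl playAll σ
  refine Runs.seq (Runs.for (fun k τ => ∀ i < k, τ.reals regretArr i = 0) (by decide) (by decide)
    hσ.items (by simp) fun k hk τ hτk _ h => Runs.rset fun i hi => ?_) fun σ₁ f₁ h₁ => ?_
  · by_cases hik : i = k
    · simp [hτk, hik]
    · simp [hτk, hik, h i (by omega)]
  replace F := F.then f₁ (by decide)
  rw [hT, ← F.nats numRound (by decide)]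
  refine (Runs.for (fun k τ => ∃ D : ℕ → Finset ℕ, (∀ q < k, RoundRecord σ τ q (D q)) ∧
    (∀ i < N, τ.reals regretArr i = ∑ q ∈ range k, g (D q) i) ∧
    ∑ i ∈ E, max (∑ q ∈ range k, g (D q) i) 0 ^ 2 ≤ k * (N * (σ.active.card : ℝ) ^ 2))
    (by decide) (by decide) (by rw [F.nats numRound (by decide)]; exact hσ.rounds)
    ⟨fun _ => ∅, by simp, by simpa using h₁, by simp⟩
    fun k hk τ hτk f ⟨D, h₂, h₃, h₄⟩ => ?_).mono ?_
  · replace F := F.then f (by decide)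
    rw [f₁.nats numRound (by decide), ← hT] at hk
    have hτ : τ.Ready M := by
      refine ⟨?_, ?_, ?_, ?_, ?_, ?_, ?_, ?_⟩
      · rw [F.nats numVoter (by decide)]; exact hσ.voters
      · rw [F.nats numItem (by decide)]; exact hσ.items
      · rw [F.nats numRound (by decide)]; exact hσ.rounds
      · rw [F.nats numCand (by decide)]; exact hσ.cands
      · rw [F.reals lowReg (by decide)]; exact hσ.low
      · rw [F.reals halfReg (by decide)]; exact hσ.half
      · rw [F.nats numAct (by decide), F.active (by decide)]; exact hσ.act
      · simp (disch := decide) only [F.nats]; exact hσ.base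
    have hround := runs_playRound (P := P) τ hτ k hτk
    simp (disch := decide) only [F.nats numItem, F.nats numVoter, F.nats baseArr,
      F.reals weightArr, F.reals halfReg, F.reals lowReg, F.active, F.rank] at hround
    refine hround.mono fun υ f₅ ⟨D', a₁, a₂, a₃, a₄, a₅, a₆, a₇, a₈⟩ => ?_
    have hD : ∀ q < k, Function.update D k D' q = D q := fun q hq =>
      Function.update_of_ne hq.ne _ _
    have hgsum : ∀ i, ∑ q ∈ range (k + 1), g (Function.update D k D' q) i =
        ∑ q ∈ range k, g (D q) i + g D' i := fun i => by
      rw [sum_range_succ, Function.update_self]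
      congr 1
      exact sum_congr rfl fun q hq => by rw [hD q (mem_range.1 hq)]
    refine ⟨Function.update D k D', fun q hq => ?_, fun i hi => ?_, ?_⟩
    · rcases Nat.lt_succ_iff_lt_or_eq.1 hq with hq | rfl
      · rw [hD q hq]
        obtain ⟨b₁, b₂, b₃, b₄⟩ := h₂ q hq
        -- Rows do not overlap, so round `k` leaves the records of round `q` intact.
        have hb := hσ.base q k hq hk
        refine ⟨b₁, b₂, fun v hv => ?_, fun i hi => ?_⟩
        · have : υ.nats valArr (σ.nats baseArr q + v) = τ.nats valArr (σ.nats baseArr q + v) :=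
            a₅ _ (by omega)
          simpa [this] using b₃ v hv
        · have : υ.nats selArr (σ.nats baseArr q + i) = τ.nats selArr (σ.nats baseArr q + i) :=
            a₇ _ (by omega)
          simpa [this] using b₄ i hi
      · rw [Function.update_self]
        exact ⟨a₁, a₂, by simpa using a₄, by simpa using a₆⟩
    · rw [hgsum, ← h₃ i hi, hg]
      simpa using a₈ i hi
    · simp only [hgsum]
      have hcard : (E.card : ℝ) ≤ N := by
        have := card_filter_le (range N) fun i =>
          σ.reals lowReg 0 < σ.reals weightArr i ∧ σ.reals weightArr i ≤ σ.reals halfReg 0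
        rw [card_range] at this
        exact_mod_cast this
      refine (sum_sq_posPart_add_le E _ (g D') σ.active.card (fun i hi => ?_) ?_).trans ?_
      -- Both `beats` and `w|V|/B` lie between 0 and `|V|`, the latter because `w ≤ B`; so one round
      -- changes a regret by at most `|V|`.
      · obtain ⟨-, hi₁, hi₂⟩ := mem_filter.1 hi
        have hb : (beats σ.active σ.rank D' i : ℝ) ≤ σ.active.card := by
          exact_mod_cast beats_le_card _ _ _ _
        have hw0 : 0 ≤ σ.reals weightArr i := hσ.low.trans hi₁.le
        have hh := hσ.half
        have h5 : 0 ≤ σ.reals weightArr i * (σ.active.card / σ.reals halfReg 0) := by positivity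
        have h6 : σ.reals weightArr i * (σ.active.card / σ.reals halfReg 0) ≤ σ.active.card := by
          rw [mul_div_left_comm]
          exact mul_le_of_le_one_right (by positivity) ((div_le_one hh).2 hi₂)
        rw [hg, abs_le]
        constructor
        · have : (0 : ℝ) ≤ beats σ.active σ.rank D' i := by positivity
          linarith
        · linarith
      -- Items outside `E` are not played, so the sum over `E` equals the sum over all items.
      · refine le_trans (le_of_eq ?_) a₃
        rw [hE, sum_filter]
        refine sum_congr rfl fun i hi => ?_
        rw [regretPlay, h₃ i (mem_range.1 hi), hg]
        split_ifs
        · rfl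
        · simp
      · push_cast
        have := mul_le_mul_of_nonneg_right hcard (sq_nonneg (σ.active.card : ℝ))
        linarith
  · rintro τ - ⟨D, h₂, h₃, h₄⟩
    rw [f₁.nats numRound (by decide)] at h₂ h₄ ⊢
    refine ⟨D, h₂, fun i hi hl hh => ?_⟩
    exact (single_le_sum (f := fun i => max (∑ q ∈ range (σ.nats numRound 0), g (D q) i) 0 ^ 2)
      (fun i _ => sq_nonneg _) (mem_filter.2 ⟨mem_range.2 hi, hl, hh⟩)).trans h₄

/-! ### Choosing a round, retiring voters and buying items -/

/-- The value of round `q` for voter `v`. -/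
def State.value (σ : State) (v q : ℕ) : ℕ := σ.nats valArr (σ.nats baseArr q + v)

theorem Frame.value {c : Program} {σ τ : State} (F : Frame c σ τ)
    (h : valArr ∉ c.nwrites ∧ baseArr ∉ c.nwrites) : τ.value = σ.value := by
  funext v q
  rw [State.value, F.nats _ h.1, F.nats _ h.2, State.value]

theorem runs_countRank (σ : State) (hT : σ.nats numRound 0 ≤ M) :
    Runs P M countRank σ fun τ => τ.nats countReg 0 =
      roundRank (σ.nats numRound 0) (σ.value (σ.nats voterVar 0)) (σ.nats roundVar 0) := by
  have F := Frame.refl countRank σ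
  refine Runs.seq (Q := fun τ => τ.nats countReg 0 = 0) (Runs.nset (by simp)) fun σ₁ f₁ h₁ => ?_
  replace F := F.then f₁ (by decide)
  rw [roundRank, ← F.nats numRound (by decide)]
  refine Runs.for (fun k τ => τ.nats countReg 0 = ((range k).filter fun q =>
    σ.value (σ.nats voterVar 0) q ≤ σ.value (σ.nats voterVar 0) (σ.nats roundVar 0)).card)
    (by decide) (by decide) (by rwa [F.nats numRound (by decide)]) (by simp [h₁])
    fun q hq τ hτq f h => ?_
  replace F := F.then f (by decide)
  rw [range_add_one, filter_insert]
  refine Runs.guard (fun hb => Runs.nset ?_) fun hb => ?_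
  all_goals
    simp (disch := decide) only [List.mem_singleton, forall_eq, Test.Holds, NExp.eval,
      F.nats] at hb
    rw [hτq, ← State.value, ← State.value] at hb
  · rw [if_pos hb, card_insert_of_notMem (by simp)]
    simp [h]
  · rw [if_neg hb]
    simpa using h

/-- The active voters who find round `r` among the worst quarter. -/
def State.bad (σ : State) (r : ℕ) : Finset ℕ :=
  σ.active.filter fun v => 4 * roundRank (σ.nats numRound 0) (σ.value v) r < σ.nats numRound 0

theorem Frame.bad {c : Program} {σ τ : State} (F : Frame c σ τ)
    (h : (valArr ∉ c.nwrites ∧ baseArr ∉ c.nwrites) ∧ (numVoter ∉ c.nwrites ∧ actArr ∉ c.nwrites) ∧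
      numRound ∉ c.nwrites) : τ.bad = σ.bad := by
  funext r
  rw [State.bad, F.value h.1, F.active h.2.1, F.nats _ h.2.2, State.bad]

theorem State.bad_eq (σ : State) (r : ℕ) : σ.bad r = (range (σ.nats numVoter 0)).filter fun v =>
    1 ≤ σ.nats actArr v ∧
      4 * roundRank (σ.nats numRound 0) (σ.value v) r < σ.nats numRound 0 := by
  rw [State.bad, State.active, filter_filter]

theorem runs_countBad (σ : State) (hv : σ.nats numVoter 0 ≤ M) (hT : σ.nats numRound 0 ≤ M) :
    Runs P M countBad σ fun τ => τ.nats badReg 0 = (σ.bad (σ.nats roundVar 0)).card := by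
  have F := Frame.refl countBad σ
  refine Runs.seq (Q := fun τ => τ.nats badReg 0 = 0) (Runs.nset (by simp)) fun σ₁ f₁ h₁ => ?_
  replace F := F.then f₁ (by decide)
  rw [State.bad_eq, ← F.nats numVoter (by decide)]
  refine Runs.for (fun k τ => τ.nats badReg 0 = ((range k).filter fun v =>
    1 ≤ σ.nats actArr v ∧ 4 * roundRank (σ.nats numRound 0) (σ.value v) (σ.nats roundVar 0) <
      σ.nats numRound 0).card)
    (by decide) (by decide) (by rwa [F.nats numVoter (by decide)]) (by simp [h₁])
    fun v hv τ hτv f h => ?_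
  replace F := F.then f (by decide)
  rw [range_add_one, filter_insert]
  refine Runs.guard (fun hb => ?_) fun hb => ?_
  all_goals
    simp (disch := decide) only [List.mem_singleton, forall_eq, Test.Holds, NExp.eval,
      F.nats, hτv] at hb
  · have hc := runs_countRank (P := P) (M := M) τ (by rwa [F.nats numRound (by decide)])
    rw [F.nats numRound (by decide), F.value (by decide), F.nats roundVar (by decide), hτv] at hc
    refine Runs.seq hc fun υ f₂ h₂ => ?_
    have e₁ : υ.nats numRound = σ.nats numRound := by
      rw [f₂.nats numRound (by decide), F.nats numRound (by decide)]
    have e₂ : υ.nats badReg 0 = τ.nats badReg 0 := by rw [f₂.nats badReg (by decide)]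
    refine Runs.guard (fun hb' => Runs.nset ?_) fun hb' => ?_
    all_goals
      simp only [List.mem_singleton, forall_eq, Test.Holds, NExp.eval, e₁, h₂] at hb'
    · rw [if_pos ⟨hb, by omega⟩, card_insert_of_notMem (by simp)]
      simp [e₂, h]
    · rw [if_neg fun h' => hb' (by omega)]
      simpa [e₂] using h
  · rw [if_neg fun h' => hb h'.1]
    simpa using h

theorem runs_findBest (σ : State) (hv : σ.nats numVoter 0 ≤ M) (hT : σ.nats numRound 0 ≤ M)
    (h : ∃ r < σ.nats numRound 0, 4 * (σ.bad r).card ≤ σ.nats numAct 0) :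
    Runs P M findBest σ fun τ => τ.nats bestRound 0 < σ.nats numRound 0 ∧
      4 * (σ.bad (τ.nats bestRound 0)).card ≤ σ.nats numAct 0 := by
  -- The invariant is conditional on a good round having been seen, so that it holds vacuously at
  -- the start, when `bestRound` is meaningless.
  refine (Runs.for (fun k τ => (∃ r < k, 4 * (σ.bad r).card ≤ σ.nats numAct 0) →
    τ.nats bestRound 0 < k ∧ 4 * (σ.bad (τ.nats bestRound 0)).card ≤ σ.nats numAct 0)
    (by decide) (by decide) hT (by simp) fun r hr τ hτr F h₁ => ?_).mono fun τ _ h₁ => h₁ h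
  have hc := runs_countBad (P := P) (M := M) τ (by rwa [F.nats numVoter (by decide)])
    (by rwa [F.nats numRound (by decide)])
  rw [F.bad (by decide), hτr] at hc
  refine Runs.seq hc fun υ f₂ h₂ => ?_
  have F₂ := F.then f₂ (by decide)
  have e₁ : υ.nats roundVar 0 = r := by rw [f₂.nats roundVar (by decide), hτr]
  have e₂ : υ.nats bestRound 0 = τ.nats bestRound 0 := by rw [f₂.nats bestRound (by decide)]
  refine Runs.guard (fun hb => Runs.nset fun _ => ?_) fun hb => ?_
  all_goals
    simp only [List.mem_singleton, forall_eq, Test.Holds, NExp.eval, h₂,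
      F₂.nats numAct (by decide)] at hb
  · simp only [NExp.eval, e₁, State.setNat]
    rw [Function.update_of_ne (by decide), Function.update_self, Function.update_self]
    exact ⟨by omega, by omega⟩
  · simp only [State.setNat]
    rw [Function.update_of_ne (by decide), e₂]
    rintro ⟨q, hq, hq'⟩
    rcases Nat.lt_succ_iff_lt_or_eq.1 hq with hq | rfl
    · have := h₁ ⟨q, hq, hq'⟩
      exact ⟨by omega, this.2⟩
    · omega

theorem runs_retireVoters (σ : State) (hv : σ.nats numVoter 0 ≤ M) (hT : σ.nats numRound 0 ≤ M) :
    Runs P M retireVoters σ fun τ => τ.active = σ.bad (σ.nats roundVar 0) ∧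
      τ.nats numAct 0 = (σ.bad (σ.nats roundVar 0)).card := by
  have F := Frame.refl retireVoters σ
  refine Runs.seq (Q := fun τ => τ.nats numAct 0 = 0) (Runs.nset (by simp)) fun σ₁ f₁ h₁ => ?_
  replace F := F.then f₁ (by decide)
  set b := fun v => 4 * roundRank (σ.nats numRound 0) (σ.value v) (σ.nats roundVar 0) <
      σ.nats numRound 0 with hb
  rw [State.bad_eq, ← F.nats numVoter (by decide)]
  refine (Runs.for (fun k τ => (∀ v, τ.nats actArr v =
      if v < k ∧ ¬ b v then 0 else σ.nats actArr v) ∧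
      τ.nats numAct 0 = ((range k).filter fun v => 1 ≤ σ.nats actArr v ∧ b v).card)
    (by decide) (by decide) (by rwa [F.nats numVoter (by decide)])
    (by simp [h₁, f₁.nats actArr (by decide)])
    fun v hv τ hτv f ⟨h₂, h₃⟩ => ?_).mono ?_
  · replace F := F.then f (by decide)
    rw [range_add_one, filter_insert]
    have hv0 : τ.nats actArr v = σ.nats actArr v := by rw [h₂, if_neg (by omega)]
    refine Runs.guard (fun hb => ?_) fun hb => ?_
    all_goals
      simp only [List.mem_singleton, forall_eq, Test.Holds, NExp.eval, hτv, hv0] at hb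
    · have hc := runs_countRank (P := P) (M := M) τ (by rwa [F.nats numRound (by decide)])
      rw [F.nats numRound (by decide), F.value (by decide), F.nats roundVar (by decide), hτv] at hc
      refine Runs.seq hc fun υ f₂ h₄ => ?_
      have e₁ : υ.nats numRound = σ.nats numRound := by
        rw [f₂.nats numRound (by decide), F.nats numRound (by decide)]
      have e₂ : υ.nats numAct 0 = τ.nats numAct 0 := by rw [f₂.nats numAct (by decide)]
      have e₃ : υ.nats voterVar 0 = v := by rw [f₂.nats voterVar (by decide), hτv]
      have e₄ := f₂.nats actArr (by decide)
      refine Runs.branch (fun hb' => Runs.nset ?_) fun hb' => Runs.nset ?_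
      all_goals simp only [Test.Holds, NExp.eval, e₁, h₄] at hb'
      · have hbv : ¬ b v := by simp only [b]; omega
        rw [if_neg fun h' => hbv h'.2]
        refine ⟨fun a => ?_, by simpa [e₂] using h₃⟩
        by_cases hav : a = v
        · simp [e₃, hav, hbv]
        · have : a < v + 1 ↔ a < v := by omega
          simp [e₃, hav, e₄, h₂ a, this]
      · have hbv : b v := by simp only [b]; omega
        rw [if_pos ⟨hb, hbv⟩, card_insert_of_notMem (by simp)]
        refine ⟨fun a => ?_, by simp [e₂, h₃]⟩
        by_cases hav : a = v
        · simp [hav, hbv, e₄, hv0]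
        · have : a < v + 1 ↔ a < v := by omega
          simp [e₄, h₂ a, this]
    · rw [if_neg fun h' => hb h'.1]
      refine ⟨fun a => ?_, by simpa using h₃⟩
      by_cases hav : a = v
      · have : σ.nats actArr v = 0 := by omega
        simp [hav, hv0, this]
      · have : a < v + 1 ↔ a < v := by omega
        simp [h₂ a, this]
  · rintro τ f ⟨h₂, h₃⟩
    refine ⟨?_, h₃⟩
    rw [State.active, f.nats numVoter (by decide)]
    refine filter_congr fun v hv => ?_
    rw [h₂]
    by_cases hbv : b v
    · simp only [hbv, not_true, and_false, if_false]
      exact ⟨fun h => ⟨h, hbv⟩, And.left⟩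
    · simp only [hbv, mem_range.1 hv, not_false_iff, and_self, if_true]
      exact ⟨fun h => by omega, fun h => absurd h.2 hbv⟩

/-- The committee of item `i`. -/
def State.item (σ : State) (m i : ℕ) : Finset (Fin m) := σ.committee m comArr (σ.nats addrArr i)

theorem runs_addRound (σ : State) (hm : σ.nats numCand 0 = m) (hM : m ≤ M)
    (hN : σ.nats numItem 0 ≤ M) :
    Runs P M addRound σ fun τ => τ.output m = σ.output m ∪ ((range (σ.nats numItem 0)).filter
      fun i => 1 ≤ σ.nats selArr (σ.nats baseArr (σ.nats roundVar 0) + i)).biUnion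
        (σ.item m) := by
  refine Runs.for (fun k τ => τ.output m = σ.output m ∪ ((range k).filter
      fun i => 1 ≤ σ.nats selArr (σ.nats baseArr (σ.nats roundVar 0) + i)).biUnion
        (σ.item m)) (by decide) (by decide) hN (by simp [State.output, State.committee])
    fun i hi τ hτi F h => ?_
  rw [range_add_one, filter_insert]
  refine Runs.guard (fun hb => ?_) fun hb => ?_
  all_goals
    simp (disch := decide) only [List.mem_singleton, forall_eq, Test.Holds, NExp.eval, hτi,
      F.nats] at hb
  swap
  · rw [if_neg hb]
    simpa [State.output, State.committee] using h
  rw [if_pos hb, biUnion_insert, union_left_comm, ← h]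
  refine (Runs.for (fun k υ => ∀ c, υ.nats outArr c ≠ 0 ↔ (τ.nats outArr c ≠ 0 ∨
    c < k ∧ σ.nats comArr (σ.nats addrArr i + c) ≠ 0)) (by decide) (by decide)
    (by rwa [F.nats numCand (by decide), hm]) (by simp) fun c hc υ hυc f₂ h₂ => ?_).mono ?_
  · have F₂ := F.then f₂ (by decide)
    have e₁ : υ.nats itemVar 0 = i := by rw [f₂.nats itemVar (by decide), hτi]
    refine Runs.guard (fun hb => Runs.nset ?_) fun hb => ?_
    all_goals
      simp (disch := decide) only [List.mem_singleton, forall_eq, Test.Holds, NExp.eval, hυc, e₁,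
        F₂.nats addrArr, F₂.nats comArr] at hb
      intro a
      by_cases hac : a = c
    · have : σ.nats comArr (σ.nats addrArr i + c) ≠ 0 := by omega
      simp [hυc, hac, this]
    · have : a < c + 1 ↔ a < c := by omega
      simpa [hυc, hac, this] using h₂ a
    · have : σ.nats comArr (σ.nats addrArr i + c) = 0 := by omega
      simpa [hac, this] using h₂ c
    · have : a < c + 1 ↔ a < c := by omega
      simpa [this] using h₂ a
  · intro υ f₂ h₂
    rw [F.nats numCand (by decide), hm] at h₂
    ext c
    have := h₂ c
    simp only [State.output, State.committee, State.item, mem_filter, mem_union, mem_univ,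
      true_and, zero_add]
    rw [or_comm, ← and_iff_right (a := (c : ℕ) < m)
      (b := σ.nats comArr (σ.nats addrArr i + c) ≠ 0) c.2, ← this]
    simp

end RealRAM

/-! ### Guarantee of a single stage -/

namespace CommitteeSelection
open Finset

theorem beats_eq_card_sup (V : Finset ℕ) (R : ℕ → ℕ → ℕ) (D : Finset ℕ) (i : ℕ) :
    beats V R D i = (V.filter fun v => (D.sup fun j => R v j + 1) ≤ R v i).card := by
  rw [beats]
  congr 1
  exact filter_congr fun v _ => by rw [Finset.sup_le_iff]; rfl

/-- Only few of the voters who are satisfied with round `r` prefer item `i` to what was chosen in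
that round, if the average regret for item `i` is small. -/
theorem card_satisfied_beats_le (V : Finset ℕ) (N T : ℕ) (hT : 0 < T) (R : ℕ → ℕ → ℕ)
    (D : ℕ → Finset ℕ) (a : ℕ → ℕ → ℕ)
    (ha : ∀ v ∈ V, ∀ q < T, a v q = (D q).sup fun j => R v j + 1) (r : ℕ) (hr : r < T) (i : ℕ)
    (w B η κ : ℝ) (hB : 0 < B) (hη : 0 ≤ η) (hκ : 0 ≤ κ) (hNT : (N : ℝ) ≤ T * κ ^ 2)
    (hw : κ * B ≤ η * w)
    (hreg : w ≤ B → max (∑ q ∈ range T, ((beats V R (D q) i : ℝ) - w * (V.card / B))) 0 ^ 2 ≤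
      T * (N * (V.card : ℝ) ^ 2)) :
    ((V.filter fun v => T ≤ 4 * roundRank T (a v) r ∧ ∀ j ∈ D r, R v j < R v i).card : ℝ) ≤
      4 * (1 + η) * (w / B) * V.card := by
  rcases le_or_gt w B with hwB | hwB
  · set S := ∑ q ∈ range T, ((beats V R (D q) i : ℝ) - w * (V.card / B)) with hS
    have hT' : (0 : ℝ) < T := by exact_mod_cast hT
    -- The regret bound `√(TN)|V|` is at most `Tκ|V|` because `N ≤ Tκ²`.
    have h1 : S ≤ T * κ * V.card := by
      refine (le_max_left S 0).trans (le_of_sq_le_sq ((hreg hwB).trans ?_) (by positivity))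
      calc (T : ℝ) * (N * (V.card : ℝ) ^ 2) ≤ T * ((T * κ ^ 2) * (V.card : ℝ) ^ 2) := by gcongr
        _ = (T * κ * V.card) ^ 2 := by ring
    have h2 : ((V.filter fun v => T ≤ 4 * roundRank T (a v) r ∧
        ∀ j ∈ D r, R v j < R v i).card : ℝ) * T ≤ 4 * ∑ q ∈ range T, (beats V R (D q) i : ℝ) := by
      have := card_satisfied_le V T a (fun v => R v i) r
      have e1 : (V.filter fun v => T ≤ 4 * roundRank T (a v) r ∧ a v r ≤ R v i) =
          V.filter fun v => T ≤ 4 * roundRank T (a v) r ∧ ∀ j ∈ D r, R v j < R v i :=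
        filter_congr fun v hv => by rw [ha v hv r hr, Finset.sup_le_iff]; rfl
      have e2 : ∑ q ∈ range T, (V.filter fun v => a v q ≤ R v i).card =
          ∑ q ∈ range T, beats V R (D q) i := sum_congr rfl fun q hq => by
        rw [beats_eq_card_sup]
        congr 1
        exact filter_congr fun v hv => by rw [ha v hv q (mem_range.1 hq)]
      rw [e1, e2] at this
      exact_mod_cast this
    have h3 : ∑ q ∈ range T, (beats V R (D q) i : ℝ) = S + T * (w * (V.card / B)) := by
      rw [hS, sum_sub_distrib]
      simp
    -- The regret `κ` per round and voter is absorbed as a relative error `η`; this is possible only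
    -- for items that are not too light.
    have h4 : κ ≤ η * (w / B) := by
      rw [mul_div_assoc', le_div_iff₀ hB]
      exact hw
    have h5 : (T : ℝ) * κ * V.card ≤ T * (η * (w / B)) * V.card := by gcongr
    refine le_of_mul_le_mul_right (h2.trans ?_) hT'
    rw [h3]
    have : w * (V.card / B) = w / B * V.card := by ring
    rw [this]
    linarith
  -- Items heavier than `B` are never played, but for them the claimed bound already exceeds `|V|`.
  · have h1 : ((V.filter fun v => T ≤ 4 * roundRank T (a v) r ∧
        ∀ j ∈ D r, R v j < R v i).card : ℝ) ≤ V.card := by exact_mod_cast card_filter_le _ _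
    have h2 : 1 ≤ w / B := (one_le_div hB).2 hwB.le
    have h3 : (0 : ℝ) ≤ V.card := by positivity
    nlinarith [mul_nonneg hη (zero_le_one.trans h2), mul_le_mul_of_nonneg_right h2 h3,
      mul_nonneg (mul_nonneg hη (zero_le_one.trans h2)) h3]

end CommitteeSelection

namespace RealRAM
open CommitteeSelection Finset
variable {m n : ℕ} {P : MonotonePreferences m n} {M : ℕ}

/-- The voters who retire are those satisfied with the best round `r`, and `D` is the set chosen in
that round; `card_satisfied_beats_le` then applies to `σ.active \ τ.active`. -/
theorem runs_stage (σ : State) (hσ : σ.Ready M) (hm : σ.nats numCand 0 = m)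
    (hT : 0 < σ.nats numRound 0) (η κ : ℝ) (hη : 0 ≤ η) (hκ : 0 ≤ κ)
    (hNT : (σ.nats numItem 0 : ℝ) ≤ σ.nats numRound 0 * κ ^ 2)
    (hκB : κ * σ.reals halfReg 0 ≤ η * σ.reals lowReg 0) :
    Runs P M stage σ fun τ => τ.reals halfReg 0 = σ.reals halfReg 0 / 2 ∧
      τ.active ⊆ σ.active ∧ τ.nats numAct 0 = τ.active.card ∧
      4 * τ.active.card ≤ σ.active.card ∧ ∃ D ⊆ range (σ.nats numItem 0),
      ∑ i ∈ D, σ.reals weightArr i ≤ 2 * σ.reals halfReg 0 ∧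
      τ.output m = σ.output m ∪ D.biUnion (σ.item m) ∧
      ∀ i < σ.nats numItem 0, σ.reals lowReg 0 < σ.reals weightArr i →
        (((σ.active \ τ.active).filter fun v => ∀ j ∈ D, σ.rank v j < σ.rank v i).card : ℝ) ≤
          4 * (1 + η) * (σ.reals weightArr i / σ.reals halfReg 0) * σ.active.card := by
  have F := Frame.refl stage σ
  refine Runs.seq (runs_playAll σ hσ _ rfl) fun σ₁ f₁ ⟨D, h₁, h₁'⟩ => ?_
  replace F := F.then f₁ (by decide)
  have hval : ∀ v ∈ σ.active, ∀ q < σ.nats numRound 0,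
      σ₁.value v q = (D q).sup fun j => σ.rank v j + 1 := fun v hv q hq => by
    rw [State.value, F.nats baseArr (by decide)]
    exact (h₁ q hq).val v (mem_range.1 (mem_filter.1 hv).1)
  have hbad : ∀ r, σ₁.bad r = σ.active.filter fun v =>
      4 * roundRank (σ.nats numRound 0) (σ₁.value v) r < σ.nats numRound 0 := fun r => by
    rw [State.bad, f₁.active (by decide), F.nats numRound (by decide)]
  have hex : ∃ r < σ₁.nats numRound 0, 4 * (σ₁.bad r).card ≤ σ₁.nats numAct 0 := by
    rw [F.nats numRound (by decide), f₁.nats numAct (by decide), hσ.act]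
    simp only [hbad]
    exact exists_round _ _ hT _
  refine Runs.seq (runs_findBest σ₁ (by rw [F.nats numVoter (by decide)]; exact hσ.voters)
    (by rw [F.nats numRound (by decide)]; exact hσ.rounds) hex) fun σ₂ f₂ ⟨h₂, h₂'⟩ => ?_
  rw [F.nats numRound (by decide)] at h₂
  rw [f₁.nats numAct (by decide), hσ.act] at h₂'
  replace F := F.then f₂ (by decide)
  set r := σ₂.nats bestRound 0 with hr
  refine Runs.seq (Q := fun τ => τ.nats roundVar 0 = r) (Runs.nset (by simp [hr]))
    fun σ₃ f₃ h₃ => ?_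
  replace F := F.then f₃ (by decide)
  refine Runs.seq (runs_retireVoters σ₃ (by rw [F.nats numVoter (by decide)]; exact hσ.voters)
    (by rw [F.nats numRound (by decide)]; exact hσ.rounds)) fun σ₄ f₄ ⟨h₄, h₄'⟩ => ?_
  rw [h₃, f₃.bad (by decide), f₂.bad (by decide)] at h₄ h₄'
  replace F := F.then f₄ (by decide)
  refine Runs.seq (runs_addRound (m := m) σ₄ (by rw [F.nats numCand (by decide), hm])
    (by rw [← hm]; exact hσ.cands) (by rw [F.nats numItem (by decide)]; exact hσ.items))
    fun σ₅ f₅ h₅ => Runs.rset ?_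
  replace F := F.then f₅ (by decide)
  have hD : ((range (σ₄.nats numItem 0)).filter fun i => 1 ≤ σ₄.nats selArr
      (σ₄.nats baseArr (σ₄.nats roundVar 0) + i)) = D r := by
    simp (disch := decide) only [f₄.nats selArr, f₃.nats selArr, f₂.nats selArr,
      f₄.nats baseArr, f₃.nats baseArr, f₂.nats baseArr, f₁.nats baseArr, f₄.nats roundVar, h₃,
      f₄.nats numItem, f₃.nats numItem, f₂.nats numItem, f₁.nats numItem]
    ext i
    rw [mem_filter, mem_range]
    constructor
    · rintro ⟨hi, hi'⟩
      exact ((h₁ r h₂).sel i hi).1 hi'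
    · intro hi
      have hi' := mem_range.1 ((h₁ r h₂).subset hi)
      exact ⟨hi', ((h₁ r h₂).sel i hi').2 hi⟩
  have hitem : σ₄.item m = σ.item m := by
    funext i
    simp (disch := decide) only [State.item, State.committee, f₄.nats comArr, f₃.nats comArr,
      f₂.nats comArr, f₁.nats comArr, f₄.nats addrArr, f₃.nats addrArr, f₂.nats addrArr,
      f₁.nats addrArr]
  have hout : σ₄.output m = σ.output m := by
    simp (disch := decide) only [State.output, State.committee, f₄.nats outArr, f₃.nats outArr,
      f₂.nats outArr, f₁.nats outArr]
  rw [hD, hitem, hout] at h₅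
  have hact : σ₅.active = σ₁.bad r := by rw [f₅.active (by decide), h₄]
  have hact' : (σ₅.setReal halfReg (NExp.eval σ₅ (.const 0)) (RExp.eval σ₅
      (.div (.var halfReg) (.const 2)))).active = σ₁.bad r := by rw [← hact]; rfl
  rw [hact']
  refine ⟨by simp (disch := decide) [f₅.reals halfReg, f₄.reals halfReg, f₃.reals halfReg,
    f₂.reals halfReg, f₁.reals halfReg], ?_, ?_, h₂', D r, (h₁ r h₂).subset,
    (h₁ r h₂).weight, h₅, fun i hi hl => ?_⟩
  · rw [hbad]
    exact filter_subset _ _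
  · simp [f₅.nats numAct (by decide), h₄']
  · have key := card_satisfied_beats_le σ.active (σ.nats numItem 0) (σ.nats numRound 0) hT σ.rank D
      σ₁.value hval r h₂ i (σ.reals weightArr i) (σ.reals halfReg 0) η κ hσ.half hη hκ hNT
      (hκB.trans (mul_le_mul_of_nonneg_left hl.le hη)) (h₁' i hi hl)
    refine le_trans (le_of_eq ?_) key
    congr 2
    rw [hbad]
    ext v
    simp only [mem_filter, mem_sdiff, not_and, not_lt]
    tauto

end RealRAM

/-! ### Weights of unions and monotone preferences -/

namespace CommitteeSelection
open Finset

theorem committeeWeight_nonneg {m : ℕ} {s : Fin m → ℝ} (hs : ∀ i, 0 ≤ s i) (S : Finset (Fin m)) :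
    0 ≤ committeeWeight s S := sum_nonneg fun i _ => hs i

theorem committeeWeight_union_le {m : ℕ} {s : Fin m → ℝ} (hs : ∀ i, 0 ≤ s i)
    (S T : Finset (Fin m)) :
    committeeWeight s (S ∪ T) ≤ committeeWeight s S + committeeWeight s T := by
  have := sum_union_inter (f := s) (s₁ := S) (s₂ := T)
  have h := committeeWeight_nonneg hs (S ∩ T)
  simp only [committeeWeight] at *
  linarith

theorem committeeWeight_biUnion_le {m : ℕ} {s : Fin m → ℝ} (hs : ∀ i, 0 ≤ s i) (D : Finset ℕ)
    (f : ℕ → Finset (Fin m)) :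
    committeeWeight s (D.biUnion f) ≤ ∑ i ∈ D, committeeWeight s (f i) := by
  induction D using Finset.induction_on with
  | empty => simp [committeeWeight]
  | insert a D ha ih =>
    rw [biUnion_insert, sum_insert ha]
    exact (committeeWeight_union_le hs _ _).trans (by linarith)

/-- By monotonicity, a voter who objects to the final output objects to every part of it, in
particular to whatever was bought when this voter retired. -/
theorem MonotonePreferences.strict.anti {m n : ℕ} {P : MonotonePreferences m n} {v : Fin n}
    {S T U : Finset (Fin m)} (h : P.strict v S T) (hU : U ⊆ T) : P.strict v S U :=
  have hTU := P.monotone v U T hU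
  ⟨P.transitive v S T U h.1 hTU, fun h' => h.2 (P.transitive v T U S hTU h')⟩

end CommitteeSelection

/-! ### The main loop -/

namespace RealRAM
open CommitteeSelection Finset
variable {m n : ℕ} {P : MonotonePreferences m n} {M : ℕ}

/-- Repeat `stage` as long as there are active voters. -/
def stages : Program := .loop (.nle (.const 1) (.var numAct)) stage

open Classical in
/-- The voters in `V` who strictly prefer `S` to `T`. -/
noncomputable def objectors (P : MonotonePreferences m n) (V : Finset ℕ) (S T : Finset (Fin m)) :
    Finset ℕ :=
  V.filter fun v => ∃ h : v < n, P.strict ⟨v, h⟩ S T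

theorem mem_objectors {V : Finset ℕ} {S T : Finset (Fin m)} {v : ℕ} :
    v ∈ objectors P V S T ↔ v ∈ V ∧ ∃ h : v < n, P.strict ⟨v, h⟩ S T := by
  simp [objectors]

/-- The tables in `σ` describe the items for the weights `s` and the preferences `P`. -/
structure State.Describes (σ : State) (s : Fin m → ℝ) (P : MonotonePreferences m n) : Prop where
  cands : σ.nats numCand 0 = m
  weight : ∀ i < σ.nats numItem 0, σ.reals weightArr i = committeeWeight s (σ.item m i)
  rank : ∀ v (hv : v < n), ∀ i < σ.nats numItem 0, ∀ j < σ.nats numItem 0,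
    P.strict ⟨v, hv⟩ (σ.item m i) (σ.item m j) → σ.rank v j < σ.rank v i

/-- The invariant of the main loop, which was entered in state `σ`. -/
structure StagesInv (P : MonotonePreferences m n) (s : Fin m → ℝ) (M : ℕ) (K η : ℝ)
    (σ τ : State) : Prop where
  ready : τ.Ready M
  half : τ.reals halfReg 0 ≤ σ.reals halfReg 0
  active : τ.active ⊆ σ.active
  card : (τ.active.card : ℝ) ≤ σ.active.card * (τ.reals halfReg 0 / σ.reals halfReg 0) ^ 2
  output : σ.output m ⊆ τ.output m
  weight : committeeWeight s (τ.output m) ≤ K - 4 * τ.reals halfReg 0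
  objectors : ∀ i < σ.nats numItem 0, σ.reals lowReg 0 < σ.reals weightArr i →
    ((objectors P (σ.active \ τ.active) (σ.item m i) (τ.output m)).card : ℝ) ≤
      8 * (1 + η) * (σ.reals weightArr i / σ.reals halfReg 0) * σ.active.card *
        (1 - τ.reals halfReg 0 / σ.reals halfReg 0)

/-- Let `q` be the ratio of the current `halfReg` to its initial value `B₀`, so `q = 2⁻ᵏ` after `k`
stages. At most `|V|q²` voters are active, the unspent budget is at least `4B₀q`, twice the sum of
all `halfReg` values to come, and the factor `1 - q` in the bound on objectors is the partial
geometric sum. -/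
theorem runs_stages (s : Fin m → ℝ) (hs : ∀ i, 0 ≤ s i) (σ : State) (hσ : σ.Ready M)
    (hd : σ.Describes s P) (hT : 0 < σ.nats numRound 0) (K η κ : ℝ) (hη : 0 ≤ η) (hκ : 0 ≤ κ)
    (hNT : (σ.nats numItem 0 : ℝ) ≤ σ.nats numRound 0 * κ ^ 2)
    (hκB : κ * σ.reals halfReg 0 ≤ η * σ.reals lowReg 0)
    (hK : committeeWeight s (σ.output m) ≤ K - 4 * σ.reals halfReg 0) :
    Runs P M stages σ fun τ => StagesInv P s M K η σ τ ∧ τ.active = ∅ := by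
  have hB₀ := hσ.half
  -- Every stage retires at least one voter, since it leaves at most a quarter of a nonempty set.
  -- Hence there are at most as many stages as voters.
  refine (Runs.loop (fun k τ => k + τ.active.card ≤ σ.active.card ∧ StagesInv P s M K η σ τ)
    ⟨by simp, ?_⟩ ?_).mono ?_
  · refine ⟨hσ, le_rfl, subset_rfl, ?_, subset_rfl, hK, fun i hi hl => ?_⟩
    · rw [div_self hB₀.ne']
      simp
    · rw [div_self hB₀.ne']
      simp [objectors]
  · intro k τ F ⟨hk, hI⟩ hb
    have hcard : σ.active.card ≤ M := by
      refine le_trans ?_ hσ.voters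
      have := card_filter_le (range (σ.nats numVoter 0)) fun v => 1 ≤ σ.nats actArr v
      rwa [card_range] at this
    simp only [Test.Holds, NExp.eval, hI.ready.act] at hb
    refine ⟨by omega, ?_⟩
    have hτB := hI.ready.half
    have hitem : τ.item m = σ.item m := by
      funext i
      rw [State.item, State.committee, F.nats comArr (by decide), F.nats addrArr (by decide)]
      rfl
    have hst := runs_stage (P := P) τ hI.ready (m := m)
      (by rw [F.nats numCand (by decide), hd.cands]) (by rwa [F.nats numRound (by decide)]) η κ hη hκ
      (by rwa [F.nats numItem (by decide), F.nats numRound (by decide)])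
      (by
        rw [F.reals lowReg (by decide)]
        exact (mul_le_mul_of_nonneg_left hI.half hκ).trans hκB)
    simp (disch := decide) only [F.nats numItem, F.reals weightArr, F.reals lowReg, F.rank,
      hitem] at hst
    refine hst.mono fun υ F₂ ⟨h₁, h₂, h₃, h₄, D, h₅, h₆, h₇, h₈⟩ => ?_
    have F' := F.trans F₂
    refine ⟨by omega, ⟨?_, ?_, h₂.trans hI.active, ?_, ?_, ?_, ?_⟩⟩
    · refine ⟨?_, ?_, ?_, ?_, ?_, ?_, h₃, ?_⟩
      · rw [F'.nats numVoter (by decide)]; exact hσ.voters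
      · rw [F'.nats numItem (by decide)]; exact hσ.items
      · rw [F'.nats numRound (by decide)]; exact hσ.rounds
      · rw [F'.nats numCand (by decide)]; exact hσ.cands
      · rw [F'.reals lowReg (by decide)]; exact hσ.low
      · rw [h₁]; positivity
      · simp (disch := decide) only [F'.nats]; exact hσ.base
    · rw [h₁]; linarith [hI.half]
    · have h4 : (4 : ℝ) * υ.active.card ≤ τ.active.card := by exact_mod_cast h₄
      rw [h₁]
      have := hI.card
      have e : (τ.reals halfReg 0 / 2 / σ.reals halfReg 0) ^ 2 =
          (τ.reals halfReg 0 / σ.reals halfReg 0) ^ 2 / 4 := by ring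
      rw [e]
      linarith
    · rw [h₇]
      exact hI.output.trans subset_union_left
    · rw [h₇, h₁]
      have := committeeWeight_union_le hs (τ.output m) (D.biUnion (σ.item m))
      have h9 := committeeWeight_biUnion_le hs D (σ.item m)
      have h10 : ∑ i ∈ D, committeeWeight s (σ.item m i) = ∑ i ∈ D, σ.reals weightArr i :=
        sum_congr rfl fun i hi => (hd.weight i (mem_range.1 (h₅ hi))).symm
      linarith [hI.weight]
    · intro i hi hl
      -- A retired voter who objects to the new output either retired earlier and objected to the
      -- earlier output, or retires now and ranks `i` above all of `D`.
      have hsub : objectors P (σ.active \ υ.active) (σ.item m i) (υ.output m) ⊆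
          objectors P (σ.active \ τ.active) (σ.item m i) (τ.output m) ∪
            (τ.active \ υ.active).filter fun v => ∀ j ∈ D, σ.rank v j < σ.rank v i := by
        intro v hv
        obtain ⟨hv₁, hv₂, hv₃⟩ := mem_objectors.1 hv
        rw [h₇] at hv₃
        rw [mem_union]
        by_cases hvτ : v ∈ τ.active
        · refine .inr (mem_filter.2 ⟨mem_sdiff.2 ⟨hvτ, (mem_sdiff.1 hv₁).2⟩, fun j hj => ?_⟩)
          refine hd.rank v hv₂ i hi j (mem_range.1 (h₅ hj)) (hv₃.anti ?_)
          exact (subset_biUnion_of_mem (σ.item m) hj).trans subset_union_right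
        · refine .inl (mem_objectors.2 ⟨mem_sdiff.2 ⟨(mem_sdiff.1 hv₁).1, hvτ⟩, hv₂, ?_⟩)
          exact hv₃.anti subset_union_left
      have h9 : ((objectors P (σ.active \ υ.active) (σ.item m i) (υ.output m)).card : ℝ) ≤
          (objectors P (σ.active \ τ.active) (σ.item m i) (τ.output m)).card +
            ((τ.active \ υ.active).filter fun v => ∀ j ∈ D, σ.rank v j < σ.rank v i).card := by
        exact_mod_cast (card_le_card hsub).trans (card_union_le _ _)
      have hw : 0 ≤ σ.reals weightArr i := hσ.low.trans hl.le
      have h10 : 4 * (1 + η) * (σ.reals weightArr i / τ.reals halfReg 0) * τ.active.card ≤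
          4 * (1 + η) * (σ.reals weightArr i / τ.reals halfReg 0) *
            (σ.active.card * (τ.reals halfReg 0 / σ.reals halfReg 0) ^ 2) := by
        gcongr
        exact hI.card
      refine h9.trans ((add_le_add (hI.objectors i hi hl) ((h₈ i hi hl).trans h10)).trans
        (le_of_eq ?_))
      -- The new objectors number at most `4(1+η)(w/B₀)|V|q`, and `8(1 - q) + 4q = 8(1 - q/2)`.
      rw [h₁]
      field_simp
      ring
  · rintro τ - ⟨⟨k, -, hI⟩, hb⟩
    refine ⟨hI, ?_⟩
    simp only [Test.Holds, NExp.eval, hI.ready.act] at hb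
    exact card_eq_zero.1 (by omega)

/-! ### Correctness of the preprocessing -/

/-- The items are stored one after the other. -/
def State.Packed (σ : State) (m : ℕ) : Prop :=
  σ.nats numCand 0 = m ∧ ∀ k ≤ σ.nats numItem 0, σ.nats addrArr k = k * m

theorem runs_appendItem (σ : State) (hσ : σ.Packed m) (hm : m ≤ M) (i : ℕ) (c : Fin m)
    (hi : σ.nats itemVar 0 = i) (hiN : i < σ.nats numItem 0) (hc : σ.nats candVar 0 = c) :
    Runs P M appendItem σ fun τ => τ.Packed m ∧ τ.nats numItem 0 = σ.nats numItem 0 + 1 ∧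
      (∀ j < σ.nats numItem 0, τ.item m j = σ.item m j) ∧
      τ.item m (σ.nats numItem 0) = insert c (σ.item m i) := by
  obtain ⟨hcand, haddr⟩ := hσ
  set N := σ.nats numItem 0 with hN
  -- Item `j < N` ends before address `N * m`, so writing the new item does not disturb it.
  have hjN : ∀ j < N, ∀ d < m, j * m + d < N * m := fun j hj d hd => by
    have : (j + 1) * m ≤ N * m := Nat.mul_le_mul_right m hj
    rw [add_mul, one_mul] at this
    omega
  refine Runs.seq (Runs.for (fun k τ => ∀ a, τ.nats comArr a =
    if N * m ≤ a ∧ a < N * m + k then σ.nats comArr (i * m + (a - N * m)) else σ.nats comArr a)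
    (by decide) (by decide) (by rwa [hcand]) (fun a => ?_) fun k hk τ hτk f h => ?_) ?_
  · simp
  · refine Runs.nset fun a => ?_
    have e₁ : τ.nats numItem 0 = N := by rw [f.nats numItem (by decide)]
    have e₂ : τ.nats itemVar 0 = i := by rw [f.nats itemVar (by decide), hi]
    have e₃ := f.nats addrArr (by decide)
    rw [hcand] at hk
    by_cases hak : a = N * m + k
    · have := hjN i hiN k hk
      have hlt : ¬ N * m ≤ i * m + k := by omega
      simp [hak, e₁, e₂, e₃, hτk, haddr N le_rfl, haddr i hiN.le, h, hlt]
    · have : (N * m ≤ a ∧ a < N * m + (k + 1)) ↔ (N * m ≤ a ∧ a < N * m + k) := by omega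
      simp [hak, e₁, e₂, e₃, hτk, haddr N le_rfl, haddr i hiN.le, h, this]
  · intro τ f h
    rw [hcand] at h
    have e₁ : τ.nats numItem 0 = N := by rw [f.nats numItem (by decide)]
    have e₂ : τ.nats candVar 0 = c := by rw [f.nats candVar (by decide), hc]
    have e₃ := f.nats addrArr (by decide)
    have e₄ : τ.nats numCand 0 = m := by rw [f.nats numCand (by decide), hcand]
    refine Runs.seq (Q := fun υ => υ = τ.setNat comArr (N * m + c) 1)
      (Runs.nset (by simp [e₁, e₂, e₃, haddr N le_rfl])) ?_
    rintro _ - rfl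
    refine Runs.seq (Q := fun υ => υ = (τ.setNat comArr (N * m + c) 1).setNat addrArr (N + 1)
      ((N + 1) * m)) (Runs.nset ?_) ?_
    · simp [e₁, e₄, e₃, haddr N le_rfl, add_mul]
    rintro _ - rfl
    refine Runs.nset ⟨⟨by simp [e₄], fun k hk => ?_⟩, by simp [e₁], fun j hj => ?_, ?_⟩
    · simp [e₁] at hk
      by_cases hkN : k = N + 1
      · simp [hkN]
      · simp [hkN, e₃, haddr k (by omega)]
    · ext d
      have h1 := hjN j hj d d.2
      have h2 : ¬ (j * m + d = N * m + c) := by omega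
      have h3 : j ≠ N + 1 := by omega
      have h4 : ¬ (N * m ≤ j * m + d) := by omega
      simp [State.item, State.committee, h2, h3, e₃, haddr j hj.le, h, h4]
    · ext d
      have h1 : N * m + (d : ℕ) < N * m + m := by omega
      by_cases hdc : d = c
      · simp [State.item, State.committee, e₃, haddr N le_rfl, hdc]
      · have h2 : (d : ℕ) ≠ c := fun h => hdc (Fin.ext h)
        simp [State.item, State.committee, e₃, haddr N le_rfl, hdc, haddr i hiN.le, h, h2]

/-- The committee `S` is one of the items. -/
def State.Lists (σ : State) (S : Finset (Fin m)) : Prop :=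
  ∃ j < σ.nats numItem 0, σ.item m j = S

/-- A pass keeps the old items and appends every old item enlarged by every candidate, which
multiplies their number by `m + 1`. A set of size `k + 1` arises from any of its subsets of size
`k`, so pass `k + 1` completes the sets of that size. -/
theorem runs_listItems (σ : State) (hm : σ.nats numCand 0 = m) (hM : m ≤ M)
    (hlim : σ.nats limitReg 0 ≤ M) (hcount : (m + 1) ^ σ.nats limitReg 0 ≤ M)
    (ha : σ.nats addrArr 0 = 0) (hcom : ∀ a, σ.nats comArr a = 0) :
    Runs P M listItems σ fun τ => τ.nats numItem 0 = (m + 1) ^ σ.nats limitReg 0 ∧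
      ∀ S : Finset (Fin m), S.card ≤ σ.nats limitReg 0 → τ.Lists S := by
  have F := Frame.refl listItems σ
  refine Runs.seq (Q := fun τ => τ.nats numItem 0 = 1) (Runs.nset (by simp)) fun σ₁ f₁ h₁ => ?_
  replace F := F.then f₁ (by decide)
  refine Runs.seq (Q := fun τ => τ.nats addrArr 0 = 0 ∧ τ.nats addrArr 1 = m)
    (Runs.nset (by simp [f₁.nats addrArr (by decide), f₁.nats numCand (by decide), hm, ha]))
    fun σ₂ f₂ ⟨h₂, h₂'⟩ => ?_
  replace F := F.then f₂ (by decide)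
  rw [← f₂.nats numItem (by decide)] at h₁
  have hP₂ : σ₂.Packed m := by
    refine ⟨by rw [F.nats numCand (by decide), hm], fun k hk => ?_⟩
    rw [h₁] at hk
    interval_cases k
    · simpa using h₂
    · simpa using h₂'
  have hcom₂ : ∀ a, σ₂.nats comArr a = 0 := fun a => by
    rw [f₂.nats comArr (by decide), f₁.nats comArr (by decide), hcom]
  rw [← F.nats limitReg (by decide)] at hcount hlim ⊢
  refine (Runs.for (fun k τ => τ.Packed m ∧ τ.nats numItem 0 = (m + 1) ^ k ∧
    ∀ S : Finset (Fin m), S.card ≤ k → τ.Lists S) (by decide) (by decide) hlim ?_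
    fun k hk τ hτk f ⟨h₃, h₄, h₅⟩ => ?_).mono fun τ _ h => h.2
  -- Cells never written are zero, so item 0 is the empty committee.
  · refine ⟨hP₂, by simp [h₁], fun S hS => ⟨0, by simp [h₁], ?_⟩⟩
    rw [card_eq_zero.1 (Nat.le_zero.1 hS)]
    simp [State.item, State.committee, hcom₂]
  -- The number of old items is frozen in `oldItem`, since `numItem` grows during the pass.
  refine Runs.seq (Q := fun υ => υ = τ.setNat oldItem 0 ((m + 1) ^ k))
    (Runs.nset (by simp [h₄])) ?_
  rintro ρ - hρ
  have r₁ : ρ.nats oldItem 0 = (m + 1) ^ k := by simp [hρ]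
  have r₂ : ρ.Packed m := by
    rw [hρ]
    simpa [State.Packed] using h₃
  have r₃ : ρ.nats numItem 0 = (m + 1) ^ k := by simp [hρ, h₄]
  have r₄ : ∀ S : Finset (Fin m), S.card ≤ k → ρ.Lists S := by
    rw [hρ]
    simpa [State.Lists, State.item, State.committee] using h₅
  clear hρ h₃ h₄ h₅
  have hkM : (m + 1) ^ k ≤ M :=
    (Nat.pow_le_pow_right (by omega) hk.le).trans hcount
  set N := (m + 1) ^ k with hN
  refine (Runs.for (fun i υ => υ.Packed m ∧ υ.nats numItem 0 = N + i * m ∧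
    (∀ j < N, υ.item m j = ρ.item m j) ∧ ∀ j < i, ∀ c, υ.Lists (insert c (ρ.item m j)))
    (by decide) (by decide) (by rwa [r₁]) ?_ fun i hi υ hυi f' ⟨h₃, h₄, h₅, h₆⟩ => ?_).mono ?_
  · exact ⟨by simpa [State.Packed] using r₂, by simp [r₃], fun _ _ => rfl, by simp⟩
  · rw [r₁] at hi
    refine (Runs.for (fun d φ => φ.Packed m ∧ φ.nats numItem 0 = N + i * m + d ∧
      (∀ j < N, φ.item m j = ρ.item m j) ∧ (∀ j < i, ∀ c, φ.Lists (insert c (ρ.item m j))) ∧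
      ∀ c : Fin m, c < d → φ.Lists (insert c (ρ.item m i)))
      (by decide) (by decide) (by rwa [h₃.1]) ?_
      fun d hd φ hφd f'' ⟨h₇, h₈, h₉, h₁₀, h₁₁⟩ => ?_).mono ?_
    · exact ⟨by simpa [State.Packed] using h₃, by simp [h₄], h₅, h₆, by simp⟩
    · rw [h₃.1] at hd
      refine (runs_appendItem φ h₇ hM i ⟨d, hd⟩ (by rw [f''.nats itemVar (by decide), hυi])
        (by omega) hφd).mono ?_
      rintro ψ - ⟨a₁, a₂, a₃, a₄⟩
      have hL : ∀ S : Finset (Fin m), φ.Lists S → ψ.Lists S := fun S ⟨j, hj, hjS⟩ =>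
        ⟨j, by omega, by rw [a₃ j hj, hjS]⟩
      refine ⟨by simpa [State.Packed] using a₁, by simp [a₂, h₈]; omega, fun j hj => ?_,
        fun j hj c => hL _ (h₁₀ j hj c), fun c hc => ?_⟩
      · exact (a₃ j (by omega)).trans (h₉ j hj)
      · by_cases hcd : (c : ℕ) < d
        · exact hL _ (h₁₁ c hcd)
        · have : c = ⟨d, hd⟩ := Fin.ext (by simp; omega)
          rw [this, ← h₉ i hi]
          exact ⟨φ.nats numItem 0, by simp [a₂], a₄⟩
    · rintro φ - ⟨h₇, h₈, h₉, h₁₀, h₁₁⟩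
      rw [h₃.1] at h₈ h₁₁
      refine ⟨by simpa [State.Packed] using h₇, by simp [h₈, add_mul]; omega, h₉,
        fun j hj c => ?_⟩
      rcases Nat.lt_succ_iff_lt_or_eq.1 hj with hj | rfl
      · exact h₁₀ j hj c
      · exact h₁₁ c c.2
  · rintro υ - ⟨h₃, h₄, h₅, h₆⟩
    rw [r₁] at h₄ h₆
    refine ⟨by simpa [State.Packed] using h₃, by simp [h₄, hN, pow_succ]; ring, fun S hS => ?_⟩
    rcases Nat.lt_or_ge k S.card with hk' | hk'
    · obtain ⟨c, hc⟩ : S.Nonempty := card_pos.1 (by omega)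
      obtain ⟨j, hj, hjS⟩ := r₄ (S.erase c) (by rw [card_erase_of_mem hc]; omega)
      have := h₆ j (by omega) c
      rw [hjS, insert_erase hc] at this
      exact this
    · obtain ⟨j, hj, hjS⟩ := r₄ S hk'
      exact ⟨j, by simp; omega, (h₅ j (by omega)).trans hjS⟩

theorem committeeWeight_item (s : Fin m → ℝ) (σ : State)
    (hs : ∀ c : Fin m, σ.reals scoreArr c = s c) (i : ℕ) :
    committeeWeight s (σ.item m i) = ∑ c ∈ range m,
      if 1 ≤ σ.nats comArr (σ.nats addrArr i + c) then σ.reals scoreArr c else 0 := by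
  rw [committeeWeight, State.item, State.committee, sum_filter,
    sum_range fun c => if 1 ≤ σ.nats comArr (σ.nats addrArr i + c) then σ.reals scoreArr c else 0]
  refine sum_congr rfl fun c _ => ?_
  rw [hs]
  simp only [Nat.one_le_iff_ne_zero]

theorem runs_weighItems (σ : State) (s : Fin m → ℝ) (hm : σ.nats numCand 0 = m) (hM : m ≤ M)
    (hN : σ.nats numItem 0 ≤ M) (hs : ∀ c : Fin m, σ.reals scoreArr c = s c) :
    Runs P M weighItems σ fun τ => ∀ i < σ.nats numItem 0,
      τ.reals weightArr i = committeeWeight s (σ.item m i) := by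
  refine Runs.for (fun k τ => ∀ i < k, τ.reals weightArr i = committeeWeight s (σ.item m i))
    (by decide) (by decide) hN (by simp) fun i hi τ hτi F h => ?_
  refine Runs.seq (Q := fun υ => υ = τ.setReal weightArr i 0) (Runs.rset (by simp [hτi])) ?_
  intro υ f₁ hυ
  have F₁ := F.then f₁ (by decide)
  have hcand : υ.nats numCand 0 = m := by rw [F₁.nats numCand (by decide), hm]
  have hυi : υ.nats itemVar 0 = i := by rw [f₁.nats itemVar (by decide), hτi]
  refine (Runs.for (fun k φ => φ.reals weightArr = Function.update (τ.reals weightArr) i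
    (∑ c ∈ range k, if 1 ≤ σ.nats comArr (σ.nats addrArr i + c) then σ.reals scoreArr c else 0))
    (by decide) (by decide) (by rwa [hcand]) (by simp [hυ]) fun c hc φ hφc f₂ h₂ => ?_).mono ?_
  · have F₂ := F₁.then f₂ (by decide)
    have e₁ : φ.nats itemVar 0 = i := by rw [f₂.nats itemVar (by decide), hυi]
    rw [sum_range_succ]
    refine Runs.guard (fun hb => Runs.rset ?_) fun hb => ?_
    all_goals
      simp (disch := decide) only [List.mem_singleton, forall_eq, Test.Holds, NExp.eval, hφc, e₁,
        F₂.nats addrArr, F₂.nats comArr] at hb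
    · rw [if_pos hb]
      simp [e₁, hφc, h₂, F₂.reals scoreArr (by decide)]
    · rw [if_neg hb]
      simpa using h₂
  · rintro φ - h₂ a ha
    rw [hcand, ← committeeWeight_item s σ hs] at h₂
    by_cases hai : a = i
    · simp [h₂, hai]
    · simp [h₂, hai, h a (by omega)]

/-- Reals cannot be rounded to naturals on this machine, so the least `T` with `N ≤ Tκ²` is found by
counting. It is at most `b` because `N/κ² ≤ b`, and positive because `N` is. -/
theorem runs_setRounds (σ : State) (hκ : 0 < σ.reals fineReg 0) (hN : 0 < σ.nats numItem 0)
    (h0 : σ.nats numRound 0 = 0) (b : ℕ) (hbM : b ≤ M)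
    (hM : (σ.nats numItem 0 : ℝ) / σ.reals fineReg 0 ^ 2 ≤ b) :
    Runs P M setRounds σ fun τ => 0 < τ.nats numRound 0 ∧ τ.nats numRound 0 ≤ b ∧
      (σ.nats numItem 0 : ℝ) ≤ τ.nats numRound 0 * σ.reals fineReg 0 ^ 2 := by
  refine (Runs.loop (fun k τ => τ.nats numRound 0 = k ∧ k ≤ b) ⟨h0, by simp⟩
    fun k τ F ⟨hk, hk'⟩ hb => ?_).mono ?_
  · simp only [Test.Holds, RExp.eval, NExp.eval, F.reals fineReg (by decide),
      F.nats numItem (by decide), hk, not_le] at hb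
    have hlt : k < b := by
      have : (k : ℝ) < b := by
        refine lt_of_lt_of_le ?_ hM
        rw [lt_div_iff₀ (by positivity)]
        linarith [pow_two (σ.reals fineReg 0)]
      exact_mod_cast this
    exact ⟨hlt.trans_le hbM, Runs.nset ⟨by simp [hk], hlt⟩⟩
  · rintro τ F ⟨⟨k, hk, hk'⟩, hb⟩
    simp only [Test.Holds, RExp.eval, NExp.eval, F.reals fineReg (by decide),
      F.nats numItem (by decide), hk, not_le, not_lt] at hb
    rw [← pow_two] at hb
    refine ⟨?_, hk.trans_le hk', by rwa [hk]⟩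
    rw [hk]
    rcases Nat.eq_zero_or_pos k with rfl | h
    · have : (0 : ℝ) < σ.nats numItem 0 := by exact_mod_cast hN
      rw [Nat.cast_zero, zero_mul] at hb
      linarith
    · exact h

/-- Naturals cannot be multiplied, so multiples of the stride are tabulated by addition. The stride
`numVoter + numItem` has room for a row indexed by voters as well as for one indexed by items. -/
theorem runs_setBases (σ : State) (hM : σ.nats numVoter 0 + σ.nats numRound 0 ≤ M) :
    Runs P M setBases σ fun τ => ∀ k ≤ σ.nats numVoter 0 + σ.nats numRound 0,
      τ.nats baseArr k = k * (σ.nats numVoter 0 + σ.nats numItem 0) := by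
  refine Runs.seq (Q := fun τ => τ = σ.setNat strideReg 0
    (σ.nats numVoter 0 + σ.nats numItem 0)) (Runs.nset (by simp)) ?_
  rintro _ - rfl
  refine Runs.seq (Q := fun τ => τ.nats strideReg 0 = σ.nats numVoter 0 + σ.nats numItem 0 ∧
    τ.nats limitReg 0 = σ.nats numVoter 0 + σ.nats numRound 0) (Runs.nset (by simp)) ?_
  rintro σ₁ - ⟨h₁, h₁'⟩
  refine Runs.seq (Q := fun τ => τ.nats baseArr 0 = 0) (Runs.nset (by simp)) fun σ₂ f₂ h₂ => ?_
  rw [← f₂.nats strideReg (by decide)] at h₁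
  rw [← f₂.nats limitReg (by decide)] at h₁'
  rw [← h₁'] at hM ⊢
  refine Runs.for (fun k τ => ∀ a ≤ k,
    τ.nats baseArr a = a * (σ.nats numVoter 0 + σ.nats numItem 0)) (by decide) (by decide) hM
    (by simpa using h₂) fun k hk τ hτk F h => Runs.nset fun a ha => ?_
  by_cases hak : a = k + 1
  · simp [hτk, hak, h k le_rfl, F.nats strideReg (by decide), h₁]
    ring
  · simp [hτk, hak, h a (by omega)]

open Classical in
theorem runs_rankItems (σ : State) (hv : σ.nats numVoter 0 = n) (hvM : n ≤ M)
    (hN : σ.nats numItem 0 ≤ M) (H : ℕ) (hH : σ.nats numItem 0 ≤ H)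
    (hbase : ∀ v < n, σ.nats baseArr v = v * H) :
    Runs P M rankItems σ fun τ => ∀ v (hv : v < n), ∀ i < σ.nats numItem 0,
      τ.nats rankArr (v * H + i) = ((range (σ.nats numItem 0)).filter fun j =>
        P.weak ⟨v, hv⟩ (σ.item m i) (σ.item m j)).card := by
  set N := σ.nats numItem 0 with hNdef
  have hlt : ∀ v w i : ℕ, v < w → i < N → v * H + i < w * H := fun v w i hvw hi => by
    have : (v + 1) * H ≤ w * H := Nat.mul_le_mul_right H hvw
    rw [add_mul, one_mul] at this
    omega
  refine (Runs.for (fun k τ => ∀ v (hv : v < n), v < k → ∀ i < N,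
    τ.nats rankArr (v * H + i) = ((range N).filter fun j =>
      P.weak ⟨v, hv⟩ (σ.item m i) (σ.item m j)).card) (by decide) (by decide) (by rwa [hv])
    (by simp) fun v hv' τ hτv F h => ?_).mono fun τ _ h v hv' i hi => h v hv' (by omega) i hi
  have hvn : v < n := by omega
  have e₁ : τ.nats numItem 0 = N := by rw [F.nats numItem (by decide)]
  refine (Runs.for (fun k υ => (∀ a < v * H, υ.nats rankArr a = τ.nats rankArr a) ∧ ∀ i < k,
    υ.nats rankArr (v * H + i) = ((range N).filter fun j =>
      P.weak ⟨v, hvn⟩ (σ.item m i) (σ.item m j)).card) (by decide) (by decide) (by rwa [e₁])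
    (by simp) fun i hi υ hυi f₁ ⟨h₁, h₂⟩ => ?_).mono ?_
  · replace F := F.then f₁ (by decide)
    have e₂ : υ.nats voterVar 0 = v := by rw [f₁.nats voterVar (by decide), hτv]
    have e₃ : υ.nats baseArr v = v * H := by rw [F.nats baseArr (by decide), hbase v hvn]
    refine Runs.seq (Q := fun φ => φ.nats rankArr = Function.update (υ.nats rankArr) (v * H + i) 0)
      (Runs.nset (by simp [e₂, e₃, hυi])) fun φ f₂ h₃ => ?_
    replace F := F.then f₂ (by decide)
    refine (Runs.for (fun k ψ => ψ.nats rankArr = Function.update (υ.nats rankArr) (v * H + i)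
      ((range k).filter fun j => P.weak ⟨v, hvn⟩ (σ.item m i) (σ.item m j)).card)
      (by decide) (by decide) (by rwa [F.nats numItem (by decide)]) (by simpa using h₃)
      fun j hj ψ hψj f₃ h₄ => ?_).mono fun ψ f₃ h₄ => ?_
    · replace F := F.then f₃ (by decide)
      have e₄ : ψ.nats voterVar 0 = v := by
        rw [f₃.nats voterVar (by decide), f₂.nats voterVar (by decide), e₂]
      have e₅ : ψ.nats itemVar 0 = i := by
        rw [f₃.nats itemVar (by decide), f₂.nats itemVar (by decide), hυi]
      have e₆ : ψ.nats baseArr v = v * H := by rw [F.nats baseArr (by decide), hbase v hvn]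
      have e₇ : ∀ i, ψ.committee m comArr (ψ.nats addrArr i) = σ.item m i := fun i => by
        rw [State.item, F.nats addrArr (by decide), State.committee, F.nats comArr (by decide)]
        rfl
      rw [range_add_one, filter_insert]
      refine Runs.guard (fun hb => Runs.nset ?_) fun hb => ?_
      all_goals
        simp only [List.mem_singleton, forall_eq, Test.Holds, NExp.eval, e₄, e₅, hψj, e₇, hvn,
          exists_true_left] at hb
      · rw [if_pos hb, card_insert_of_notMem (by simp)]
        simp [e₄, e₅, e₆, h₄]
      · rw [if_neg hb]
        simpa using h₄
    · rw [f₂.nats numItem (by decide), f₁.nats numItem (by decide), e₁] at h₄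
      refine ⟨fun a ha => ?_, fun a ha => ?_⟩
      · have : a ≠ v * H + i := by omega
        simp [h₄, this, h₁ a ha]
      · by_cases hai : a = i
        · simp [h₄, hai]
        · simp [h₄, hai, h₂ a (by omega)]
  · rintro υ - ⟨h₁, h₂⟩ w hw hwv i hi
    rw [e₁] at h₂
    rcases Nat.lt_succ_iff_lt_or_eq.1 hwv with hwv | rfl
    · have := h₁ (w * H + i) (hlt w v i hwv hi)
      simpa [this] using h w hw hwv i hi
    · simpa using h₂ i hi

theorem runs_addLight (σ : State) (s : Fin m → ℝ) (hm : σ.nats numCand 0 = m) (hM : m ≤ M)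
    (hs : ∀ c : Fin m, σ.reals scoreArr c = s c) (h0 : ∀ a, σ.nats outArr a = 0) :
    Runs P M addLight σ fun τ => τ.output m = univ.filter fun c => s c ≤ σ.reals lowReg 0 := by
  refine (Runs.for (fun k τ => ∀ c : Fin m, τ.nats outArr c ≠ 0 ↔
    (c : ℕ) < k ∧ s c ≤ σ.reals lowReg 0) (by decide) (by decide) (by rwa [hm]) (by simp [h0])
    fun k hk τ hτk F h => ?_).mono fun τ _ h => ?_
  · rw [hm] at hk
    refine Runs.guard (fun hb => Runs.nset fun c => ?_) fun hb c => ?_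
    all_goals
      simp (disch := decide) only [List.mem_singleton, forall_eq, Test.Holds, RExp.eval, NExp.eval,
        hτk, F.reals scoreArr, F.reals lowReg] at hb
      rw [show k = ((⟨k, hk⟩ : Fin m) : ℕ) from rfl, hs] at hb
      by_cases hck : (c : ℕ) = k
    · have : c = ⟨k, hk⟩ := Fin.ext hck
      simp [this, hτk, hb]
    · have : (c : ℕ) < k + 1 ↔ (c : ℕ) < k := by omega
      simpa [hτk, hck, this] using h c
    · have : c = ⟨k, hk⟩ := Fin.ext hck
      subst this
      simpa [hb] using h ⟨k, hk⟩
    · have : (c : ℕ) < k + 1 ↔ (c : ℕ) < k := by omega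
      simpa [this] using h c
  · ext c
    rw [hm] at h
    simp only [State.output, State.committee, mem_filter, mem_univ, true_and, zero_add]
    rw [h c]
    simp

theorem runs_activateVoters (σ : State) (hM : σ.nats numVoter 0 ≤ M) :
    Runs P M activateVoters σ fun τ => τ.active = range (σ.nats numVoter 0) ∧
      τ.nats numAct 0 = σ.nats numVoter 0 := by
  refine Runs.seq (Runs.for (fun k τ => ∀ v < k, τ.nats actArr v = 1) (by decide) (by decide) hM
    (by simp) fun v hv τ hτv F h => Runs.nset fun a ha => ?_) fun τ f h => Runs.nset ⟨?_, ?_⟩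
  · by_cases hav : a = v
    · simp [hτv, hav]
    · simp [hτv, hav, h a (by omega)]
  · have e := f.nats numVoter (by decide)
    ext v
    rw [State.active, mem_filter, mem_range, mem_range]
    simp only [State.setNat]
    rw [Function.update_of_ne (by decide), Function.update_of_ne (by decide), e]
    exact ⟨And.left, fun hv => ⟨hv, by rw [h v hv]⟩⟩
  · simp [f.nats numVoter (by decide)]

theorem runs_setParameters (σ : State) :
    Runs P M setParameters σ fun τ =>
      (let θ := σ.reals epsReg 0 / (64 + 2 * σ.reals epsReg 0)
      τ.reals lowReg 0 = θ * σ.reals totalReg 0 / (σ.nats numCand 0 + 1) ∧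
      τ.reals halfReg 0 = (1 - θ) * σ.reals totalReg 0 / 4 ∧
      τ.reals fineReg 0 = σ.reals epsReg 0 / 64 * θ / (σ.nats numCand 0 + 1) ∧
      τ.nats limitReg 0 = min (σ.nats maxSize 0) (σ.nats numCand 0)) := by
  refine Runs.seq (Q := fun τ => τ.reals thetaReg 0 =
    σ.reals epsReg 0 / (64 + 2 * σ.reals epsReg 0)) (Runs.rset (by simp)) fun σ₁ f₁ h₁ => ?_
  refine Runs.seq (Q := fun τ => τ.reals lowReg 0 =
    σ₁.reals thetaReg 0 * σ.reals totalReg 0 / (σ.nats numCand 0 + 1)) (Runs.rset ?_)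
    fun σ₂ f₂ h₂ => ?_
  · simp (disch := decide) [f₁.reals totalReg, f₁.nats]
  refine Runs.seq (Q := fun τ => τ.reals halfReg 0 =
    (1 - σ₁.reals thetaReg 0) * σ.reals totalReg 0 / 4) (Runs.rset ?_) fun σ₃ f₃ h₃ => ?_
  · simp (disch := decide) [f₂.reals, f₁.reals totalReg]
  refine Runs.seq (Q := fun τ => τ.reals fineReg 0 =
    σ.reals epsReg 0 / 64 * σ₁.reals thetaReg 0 / (σ.nats numCand 0 + 1)) (Runs.rset ?_)
    fun σ₄ f₄ h₄ => ?_
  · simp (disch := decide) [f₃.reals thetaReg, f₂.reals thetaReg, f₃.reals epsReg,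
      f₂.reals epsReg, f₁.reals epsReg, f₃.nats, f₂.nats, f₁.nats]
  rw [h₁] at h₂ h₃ h₄
  rw [← f₃.reals lowReg (by decide), ← f₄.reals lowReg (by decide)] at h₂
  rw [← f₄.reals halfReg (by decide)] at h₃
  have e : ∀ A, σ₄.nats A = σ.nats A := fun A => by
    rw [f₄.nats A (by simp [Program.nwrites]), f₃.nats A (by simp [Program.nwrites]),
      f₂.nats A (by simp [Program.nwrites]), f₁.nats A (by simp [Program.nwrites])]
  refine Runs.branch (fun hb => Runs.nset ⟨h₂, h₃, h₄, ?_⟩) fun hb => Runs.nset ⟨h₂, h₃, h₄, ?_⟩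
  all_goals simp only [Test.Holds, NExp.eval, e] at hb
  · simp [e, hb]
  · simp [e, le_of_not_ge hb]

/-! ### The whole program -/

def committeeProgram : Program :=
  .seq setParameters <| .seq listItems <| .seq weighItems <| .seq setRounds <| .seq setBases <|
  .seq rankItems <| .seq addLight <| .seq activateVoters stages

theorem score_eq_card_objectors (P : MonotonePreferences m n) (S T : Finset (Fin m)) :
    P.score T S = (objectors P (range n) S T).card := by
  rw [MonotonePreferences.score, ← card_map Fin.valEmbedding]
  congr 1
  ext v
  simp only [mem_map, mem_filter, mem_univ, true_and, Fin.valEmbedding_apply, mem_objectors,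
    mem_range]
  constructor
  · rintro ⟨a, ha, rfl⟩
    exact ⟨a.2, a.2, ha⟩
  · rintro ⟨-, h, h'⟩
    exact ⟨⟨v, h⟩, h', rfl⟩

/-- The state reached by the main loop contains an approximately stable committee. -/
theorem StagesInv.isApproxStable {s : Fin m → ℝ} (hs : ∀ i, 0 ≤ s i) {K η c : ℝ} {L : ℕ}
    (hη : 0 ≤ η) {σ τ : State} (hσ : σ.Ready M) (hd : σ.Describes s P)
    (hact : σ.active = range n) (hlist : ∀ S : Finset (Fin m), S.card ≤ L → σ.Lists S)
    (hlight : ∀ i, s i ≤ σ.reals lowReg 0 → i ∈ σ.output m)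
    (hc : 8 * (1 + η) / σ.reals halfReg 0 = c / K)
    (h : StagesInv P s M K η σ τ) (hτ : τ.active = ∅) :
    IsApproxStable P s K c L (τ.output m) := by
  have hB := h.ready.half
  refine ⟨h.weight.trans (by linarith), fun S hS ⟨hpos, hblock⟩ => ?_⟩
  obtain ⟨i, hi, rfl⟩ := hlist S hS
  obtain ⟨v, hv⟩ := card_pos.1 (score_eq_card_objectors P _ _ ▸ hpos)
  obtain ⟨-, hvn, hst⟩ := mem_objectors.1 hv
  rw [← hd.weight i hi] at hblock
  rcases le_or_gt (σ.reals weightArr i) (σ.reals lowReg 0) with hl | hl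
  -- Every member of a light item is a light candidate and hence in the output, so by monotonicity
  -- no voter objects.
  · have hsub : σ.item m i ⊆ τ.output m := fun a ha => h.output (hlight a (by
      rw [hd.weight i hi] at hl
      exact (single_le_sum (fun b _ => hs b) ha).trans hl))
    exact hst.2 (P.monotone _ _ _ hsub)
  · have hobj := h.objectors i hi hl
    rw [hτ, sdiff_empty, hact, ← score_eq_card_objectors, card_range] at hobj
    have hn : 0 < n := by omega
    have hw : 0 < σ.reals weightArr i := hσ.low.trans_lt hl
    have hn' : (0 : ℝ) < n := by exact_mod_cast hn
    have hB₀ := hσ.half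
    have e : 8 * (1 + η) * (σ.reals weightArr i / σ.reals halfReg 0) * n =
        c * (σ.reals weightArr i / K) * n := by
      calc _ = 8 * (1 + η) / σ.reals halfReg 0 * σ.reals weightArr i * n := by ring
        _ = _ := by rw [hc]; ring
    have hA : 0 < 8 * (1 + η) * (σ.reals weightArr i / σ.reals halfReg 0) * n := by positivity
    have hq : 0 < τ.reals halfReg 0 / σ.reals halfReg 0 := by positivity
    -- The last value of `halfReg` is still positive, so the factor `1 - q` makes the bound on
    -- objectors strict and contradicts the blocking inequality.
    nlinarith [mul_pos hA hq]

/-- A bound for all loops of the algorithm, in which `κ` is the precision of regret matching. -/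
noncomputable def loopBound (m n L : ℕ) (κ : ℝ) : ℕ :=
  m + n + (m + 1) ^ min L m + ⌈(((m + 1) ^ min L m : ℕ) : ℝ) / κ ^ 2⌉₊

open Classical in
theorem runs_committeeProgram (L : ℕ) (K ε : ℝ) (s : Fin m → ℝ) (P : MonotonePreferences m n)
    (hK : 0 < K) (hε : 0 < ε) (hs : ∀ i, 0 ≤ s i) :
    Runs P (loopBound m n L (ε / 64 * (ε / (64 + 2 * ε)) / (m + 1))) committeeProgram
      (inputState m n L s K ε) fun τ => IsApproxStable P s K (32 + ε) L (τ.output m) := by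
  set θ := ε / (64 + 2 * ε) with hθ
  set κ := ε / 64 * θ / (m + 1) with hκ
  set N := (m + 1) ^ min L m with hN
  set b := ⌈(N : ℝ) / κ ^ 2⌉₊ with hb
  have hM : loopBound m n L κ = m + n + N + b := rfl
  set M := loopBound m n L κ
  have hθ0 : 0 < θ := by positivity
  have hθ1 : θ < 1 := by rw [hθ, div_lt_one (by positivity)]; linarith
  have hκ0 : 0 < κ := by positivity
  have hN0 : 0 < N := by positivity
  set σ := inputState m n L s K ε with hσ
  have i₁ : σ.nats numCand 0 = m := by simp [hσ, inputState]
  have i₂ : σ.nats numVoter 0 = n := by simp [hσ, inputState]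
  have i₃ : σ.nats maxSize 0 = L := by simp [hσ, inputState]
  have i₄ : ∀ A, A ∉ [numCand, numVoter, maxSize] → ∀ a, σ.nats A a = 0 := fun A hA a => by
    simp only [List.mem_cons, List.not_mem_nil, or_false, not_or] at hA
    simp [hσ, inputState, hA]
  have i₅ : ∀ c : Fin m, σ.reals scoreArr c = s c := fun c => by simp [hσ, inputState]
  have i₆ : σ.reals totalReg 0 = K := by simp [hσ, inputState]
  have i₇ : σ.reals epsReg 0 = ε := by simp [hσ, inputState]
  clear_value σ
  refine Runs.seq (runs_setParameters σ) fun σ₁ f₁ ⟨a₁, a₂, a₃, a₄⟩ => ?_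
  rw [i₆, i₇, i₁, ← hθ] at a₁
  rw [i₆, i₇, ← hθ] at a₂
  rw [i₇, i₁, ← hθ, ← hκ] at a₃
  rw [i₁, i₃] at a₄
  have hlimM : min L m ≤ M := (min_le_right _ _).trans (by omega)
  refine Runs.seq (runs_listItems (m := m) σ₁ (by rw [f₁.nats numCand (by decide), i₁]) (by omega)
    (by rwa [a₄]) (by rw [a₄]; omega)
    (by rw [f₁.nats addrArr (by decide), i₄ addrArr (by decide)])
    (fun a => by rw [f₁.nats comArr (by decide), i₄ comArr (by decide)]))
    fun σ₂ f₂ ⟨b₁, b₂⟩ => ?_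
  rw [a₄, ← hN] at b₁
  rw [a₄] at b₂
  have F₂ : Frame (.seq setParameters listItems) σ σ₂ :=
    ((Frame.refl _ σ).then f₁ (by decide)).then f₂ (by decide)
  refine Runs.seq (runs_weighItems (m := m) σ₂ s (by rw [F₂.nats numCand (by decide), i₁]) (by omega)
    (by omega) (fun c => by rw [F₂.reals scoreArr (by decide), i₅])) fun σ₃ f₃ h₃ => ?_
  have F₃ : Frame (.seq (.seq setParameters listItems) weighItems) σ σ₃ :=
    (F₂.mono (by decide) (by decide)).then f₃ (by decide)
  have e₁ : σ₃.nats numItem 0 = N := by rw [f₃.nats numItem (by decide), b₁]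
  have e₂ : σ₃.reals fineReg 0 = κ := by
    rw [f₃.reals fineReg (by decide), f₂.reals fineReg (by decide), a₃]
  refine Runs.seq (runs_setRounds σ₃ (by rwa [e₂]) (by rwa [e₁])
    (by rw [F₃.nats numRound (by decide), i₄ numRound (by decide)]) b (by omega)
    (by rw [e₁, e₂]; exact Nat.le_ceil _)) fun σ₄ f₄ ⟨c₁, c₂, c₃⟩ => ?_
  rw [e₁, e₂] at c₃
  set T := σ₄.nats numRound 0 with hT
  have e₃ : σ₄.nats numVoter 0 = n := by
    rw [f₄.nats numVoter (by decide), F₃.nats numVoter (by decide), i₂]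
  have e₄ : σ₄.nats numItem 0 = N := by rw [f₄.nats numItem (by decide), e₁]
  refine Runs.seq (runs_setBases σ₄ (by omega)) fun σ₅ f₅ h₅ => ?_
  rw [e₃, e₄, ← hT] at h₅
  have e₅ : σ₅.nats numVoter 0 = n := by rw [f₅.nats numVoter (by decide), e₃]
  have e₆ : σ₅.nats numItem 0 = N := by rw [f₅.nats numItem (by decide), e₄]
  refine Runs.seq (runs_rankItems σ₅ e₅ (by omega) (by omega) (n + N) (by omega)
    fun v hv => h₅ v (by omega)) fun σ₆ f₆ h₆ => ?_
  rw [e₆] at h₆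
  have F₆ : Frame (.seq (.seq (.seq (.seq (.seq setParameters listItems) weighItems) setRounds)
      setBases) rankItems) σ σ₆ :=
    (((F₃.mono (by decide) (by decide)).then f₄ (by decide)).then f₅ (by decide)).then f₆ (by decide)
  refine Runs.seq (runs_addLight (m := m) σ₆ s (by rw [F₆.nats numCand (by decide), i₁]) (by omega)
    (fun c => by rw [F₆.reals scoreArr (by decide), i₅])
    (fun a => by rw [F₆.nats outArr (by decide), i₄ outArr (by decide)])) fun σ₇ f₇ h₇ => ?_
  refine Runs.seq (runs_activateVoters σ₇ (by
    rw [f₇.nats numVoter (by decide), F₆.nats numVoter (by decide), i₂]; omega))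
    fun ρ f₈ ⟨d₁, d₂⟩ => ?_
  rw [f₇.nats numVoter (by decide), F₆.nats numVoter (by decide), i₂] at d₁ d₂
  have G : Frame (.seq addLight activateVoters) σ₆ ρ :=
    ((Frame.refl _ σ₆).then f₇ (by decide)).then f₈ (by decide)
  have G' : Frame (.seq (.seq rankItems addLight) activateVoters) σ₅ ρ :=
    ((Frame.refl _ σ₅).then f₆ (by decide)).then G (by decide)
  have G₂ : Frame (.seq weighItems (.seq setRounds (.seq setBases
      (.seq (.seq rankItems addLight) activateVoters)))) σ₂ ρ :=
    ((((Frame.refl _ σ₂).then f₃ (by decide)).then f₄ (by decide)).then f₅ (by decide)).then G'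
      (by decide)
  have r₁ : ρ.nats numCand 0 = m := by
    rw [G.nats numCand (by decide), F₆.nats numCand (by decide), i₁]
  have r₂ : ρ.nats numVoter 0 = n := by
    rw [G.nats numVoter (by decide), F₆.nats numVoter (by decide), i₂]
  have r₃ : ρ.nats numItem 0 = N := by rw [G₂.nats numItem (by decide), b₁]
  have r₄ : ρ.nats numRound 0 = T := by
    rw [G'.nats numRound (by decide), f₅.nats numRound (by decide)]
  have r₅ : ρ.nats baseArr = σ₅.nats baseArr := G'.nats baseArr (by decide)
  have r₆ : ρ.reals lowReg 0 = θ * K / (m + 1) := by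
    rw [G₂.reals lowReg (by decide), f₂.reals lowReg (by decide), a₁]
  have r₇ : ρ.reals halfReg 0 = (1 - θ) * K / 4 := by
    rw [G₂.reals halfReg (by decide), f₂.reals halfReg (by decide), a₂]
  have r₈ : ρ.item m = σ₂.item m := by
    funext i
    rw [State.item, State.committee, G₂.nats comArr (by decide), G₂.nats addrArr (by decide)]
    rfl
  have r₉ : σ₅.item m = σ₂.item m := by
    funext i
    simp (disch := decide) only [State.item, State.committee, f₅.nats comArr, f₄.nats comArr,
      f₃.nats comArr, f₅.nats addrArr, f₄.nats addrArr, f₃.nats addrArr]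
  have r₁₀ : ∀ v (hv : v < n), ∀ i < N, ρ.rank v i = σ₆.nats rankArr (v * (n + N) + i) :=
    fun v hv i _ => by rw [State.rank, r₅, h₅ v (by omega), G.nats rankArr (by decide)]
  have r₁₁ : ρ.reals weightArr = σ₃.reals weightArr := by
    rw [G'.reals weightArr (by decide), f₅.reals weightArr (by decide),
      f₄.reals weightArr (by decide)]
  have r₁₂ : ρ.output m = univ.filter fun c => s c ≤ ρ.reals lowReg 0 := by
    rw [G.reals lowReg (by decide), ← h₇, State.output, State.committee,
      f₈.nats outArr (by decide)]
    rfl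
  have hready : ρ.Ready M := by
    refine ⟨by omega, by omega, by omega, by omega, ?_, ?_, ?_, fun q r hqr hr => ?_⟩
    · rw [r₆]; positivity
    · rw [r₇]
      have : 0 < 1 - θ := by linarith
      positivity
    · rw [d₁, d₂, card_range]
    · rw [r₄] at hr
      rw [r₅, h₅ q (by omega), h₅ r (by omega), r₂, r₃]
      have : (q + 1) * (n + N) ≤ r * (n + N) := Nat.mul_le_mul_right _ hqr
      rw [add_mul, one_mul] at this
      omega
  have hdesc : ρ.Describes s P := by
    refine ⟨r₁, fun i hi => ?_, fun v hv i hi j hj hst => ?_⟩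
    · rw [r₃, ← b₁] at hi
      rw [r₁₁, h₃ i hi, r₈]
    · rw [r₃] at hi hj
      rw [r₁₀ v hv i hi, r₁₀ v hv j hj, h₆ v hv i hi, h₆ v hv j hj]
      rw [r₈] at hst
      rw [r₉]
      -- The items weakly below `j` are weakly below `i` by transitivity, and `i` itself is weakly
      -- below `i` but not below `j`.
      refine card_lt_card ((ssubset_iff_of_subset fun k hk => ?_).2 ⟨i, ?_, ?_⟩)
      · rw [mem_filter] at hk ⊢
        exact ⟨hk.1, P.transitive _ _ _ _ hst.1 hk.2⟩
      · rw [mem_filter]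
        exact ⟨mem_range.2 hi, (P.complete _ _ _).elim id id⟩
      · rw [mem_filter]
        exact fun h => hst.2 h.2
  have hm1 : (0 : ℝ) < m + 1 := by positivity
  refine (runs_stages s hs ρ hready hdesc (by omega) K (ε / 64) κ (by positivity) hκ0.le
    (by rwa [r₃, r₄]) ?_ ?_).mono ?_
  · rw [r₇, r₆, hκ]
    calc ε / 64 * θ / (m + 1) * ((1 - θ) * K / 4)
        = ε / 64 * (θ * K / (m + 1)) * ((1 - θ) / 4) := by ring
      _ ≤ ε / 64 * (θ * K / (m + 1)) * 1 := by gcongr; linarith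
      _ = _ := mul_one _
  -- At most `m` light candidates of weight at most `θK/(m+1)` cost at most `θK`, which is exactly
  -- `K - 4 * halfReg`.
  · have h1 : committeeWeight s (ρ.output m) ≤ m * ρ.reals lowReg 0 := by
      rw [r₁₂, committeeWeight]
      refine (sum_le_card_nsmul _ _ _ fun c hc => (mem_filter.1 hc).2).trans ?_
      rw [nsmul_eq_mul]
      refine mul_le_mul_of_nonneg_right ?_ hready.low
      have := card_filter_le (univ : Finset (Fin m)) fun c => s c ≤ ρ.reals lowReg 0
      rw [card_univ, Fintype.card_fin] at this
      exact_mod_cast this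
    have h2 : m * ρ.reals lowReg 0 ≤ θ * K := by
      rw [r₆, mul_div_assoc', div_le_iff₀ hm1]
      have : 0 < θ * K := by positivity
      linarith
    rw [r₇]
    linarith
  · rintro τ - ⟨hI, hτ⟩
    refine hI.isApproxStable hs (by positivity) hready hdesc d₁ (fun S hS => ?_)
      (fun i hi => ?_) ?_ hτ
    · obtain ⟨j, hj, hjS⟩ := b₂ S (le_min hS ((card_le_univ S).trans (by simp)))
      exact ⟨j, by rwa [r₃, ← b₁], by rw [r₈, hjS]⟩
    · rw [r₁₂]
      exact mem_filter.2 ⟨mem_univ i, hi⟩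
    · have e : 1 - θ = (64 + ε) / (64 + 2 * ε) := by
        rw [hθ]
        field_simp
        ring
      rw [r₇, e]
      field_simp
      ring

/-! ### Polynomial running time -/

/-- The loop bound is polynomial in the size of the problem. -/
theorem loopBound_le (m n L : ℕ) (hL : 1 ≤ L) (ε : ℝ) (hε : 0 < ε) :
    ((loopBound m n L (ε / 64 * (ε / (64 + 2 * ε)) / (m + 1)) + m + 1 : ℕ) : ℝ) ≤
      (8448 ^ 2 + 6) * ((m : ℝ) ^ L + n + 1 / ε + 1) ^ 8 := by
  set X := (m : ℝ) ^ L + n + 1 / ε + 1 with hX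
  have hmL : (0 : ℝ) ≤ (m : ℝ) ^ L := by positivity
  have hn : (0 : ℝ) ≤ n := by positivity
  have hε' : 0 < 1 / ε := by positivity
  have hX1 : 1 ≤ X := by linarith
  have hm : (m : ℝ) ≤ m ^ L := by exact_mod_cast Nat.le_self_pow (by omega) m
  -- Without the cap by `m` this would fail for `m = 1`, where `m ^ L = 1` but `(m + 1) ^ L = 2 ^
  -- L`. For `m ≥ 2`, `m + 1 ≤ m ^ 2` suffices.
  have hNnat : (m + 1) ^ min L m ≤ (m ^ L + 1) ^ 2 := by
    rcases Nat.lt_or_ge m 2 with h | h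
    · interval_cases m
      · rw [zero_add, one_pow]
        exact Nat.one_le_pow _ _ (Nat.succ_pos _)
      · rw [min_eq_right hL]; simp
    · calc (m + 1) ^ min L m ≤ (m + 1) ^ L := Nat.pow_le_pow_right (by omega) (min_le_left _ _)
        _ ≤ (m ^ 2) ^ L := Nat.pow_le_pow_left (by nlinarith) L
        _ = (m ^ L) ^ 2 := by rw [← pow_mul, ← pow_mul, mul_comm]
        _ ≤ (m ^ L + 1) ^ 2 := Nat.pow_le_pow_left (by omega) 2
  set N := (m + 1) ^ min L m with hN
  have hNX : (N : ℝ) ≤ X ^ 2 := by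
    calc (N : ℝ) ≤ ((m : ℝ) ^ L + 1) ^ 2 := by exact_mod_cast hNnat
      _ ≤ X ^ 2 := by gcongr; linarith
  set κ := ε / 64 * (ε / (64 + 2 * ε)) / ((m : ℝ) + 1) with hκ
  have hκ0 : 0 < κ := by positivity
  -- The constant is `8448 = 2 * (4096 + 128)`.
  have hκX : 1 / κ ≤ 8448 * X ^ 3 := by
    have e : 1 / κ = (m + 1) * (4096 * (1 / ε) ^ 2 + 128 * (1 / ε)) := by
      rw [hκ]
      field_simp
      ring
    rw [e]
    have h1 : 1 / ε ≤ X := by linarith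
    have h2 : (m : ℝ) + 1 ≤ 2 * X := by linarith
    calc ((m : ℝ) + 1) * (4096 * (1 / ε) ^ 2 + 128 * (1 / ε))
        ≤ (2 * X) * (4096 * X ^ 2 + 128 * (X * X)) := by
          gcongr
          exact h1.trans (le_mul_of_one_le_left (by linarith) hX1)
      _ = 8448 * X ^ 3 := by ring
  have hb : ((⌈(N : ℝ) / κ ^ 2⌉₊ : ℕ) : ℝ) ≤ 8448 ^ 2 * X ^ 8 + 1 := by
    have h1 : (N : ℝ) / κ ^ 2 ≤ 8448 ^ 2 * X ^ 8 := by
      calc (N : ℝ) / κ ^ 2 = N * (1 / κ) ^ 2 := by ring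
        _ ≤ X ^ 2 * (8448 * X ^ 3) ^ 2 := by gcongr
        _ = 8448 ^ 2 * X ^ 8 := by ring
    exact (Nat.ceil_lt_add_one (by positivity)).le.trans (by linarith)
  have h1 : X ≤ X ^ 8 := le_self_pow₀ hX1 (by norm_num)
  have h2 : X ^ 2 ≤ X ^ 8 := pow_le_pow_right₀ hX1 (by norm_num)
  have h3 : (1 : ℝ) ≤ X ^ 8 := one_le_pow₀ hX1
  rw [loopBound]
  push_cast
  push_cast [hN] at hb hNX
  have h4 : (m : ℝ) ≤ X := by linarith
  have h5 : (n : ℝ) ≤ X := by linarith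
  -- Besides `8448² X⁸` there are six terms, each at most `X⁸`: `m` twice, `n`, the number of items,
  -- and two ones, of which one comes from the ceiling.
  linarith

end RealRAM

theorem mainTheorem7 :
    ∃ (prog : RealRAM.Program) (C d : ℕ),
      ∀ (m n L : ℕ) (K ε : ℝ) (s : Fin m → ℝ) (P : CommitteeSelection.MonotonePreferences m n),
        1 ≤ L → (L : ℝ) ≤ K → 0 < ε → (∀ i, 0 ≤ s i) →
        ∃ (t : ℕ) (σ : RealRAM.State),
          RealRAM.Exec P prog (RealRAM.inputState m n L s K ε) t σ ∧
          (t : ℝ) ≤ C * ((m : ℝ) ^ L + n + 1 / ε + 1) ^ d ∧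
          CommitteeSelection.IsApproxStable P s K (32 + ε) L (σ.output m) := by
  open RealRAM in
  -- Coefficient and depth of the fixed program are constants; raising the bound of `loopBound_le`,
  -- of degree 8, to the power `depth` gives the polynomial.
  refine ⟨committeeProgram, committeeProgram.coef * (8448 ^ 2 + 6) ^ committeeProgram.depth,
    8 * committeeProgram.depth, fun m n L K ε s P hL hK hε hs => ?_⟩
  have hK0 : 0 < K := by
    have : (1 : ℝ) ≤ L := by exact_mod_cast hL
    linarith
  obtain ⟨t, σ, he, ht, hσ⟩ := RealRAM.runs_committeeProgram L K ε s P hK0 hε hs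
  refine ⟨t, σ, he, ?_, hσ⟩
  have ht' : (t : ℝ) ≤ _ := Nat.cast_le.2 ht
  refine ht'.trans ?_
  rw [Nat.cast_mul, Nat.cast_pow]
  have := RealRAM.loopBound_le m n L hL ε hε
  rw [Nat.cast_mul, mul_assoc, pow_mul, Nat.cast_pow, ← mul_pow]
  gcongr
  exact this.trans (le_of_eq (by norm_num))
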